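/- **Definitions.** Let $G=(V,E)$ be a finite connected simple graph, $n=|V|$, $m=|E|$. The coreness of a subgraph $H$ is $\varphi(H)=\min_{x\in V(H)}d_H(x)$, and the coreness of a vertex $x$ is $\varphi_G(x)=\max\{\varphi(H): H\subseteq G,\ x\in V(H)\}$. A connected $t$-core is a connected subgraph all of whose vertices have degree at least $t$ in it. A subgraph $H$ is a *discriminative core* if it is a maximal connected $\varphi(H)$-core and has no subgraph $H'$ with $\varphi(H')>\varphi(H)$. For a vertex $v$ let $G_{N(v)}$ (the ego-network of $v$) be the subgraph induced by the neighbours of $v$, let $c_v(r)$ be the number of discriminative cores of coreness $r$ in $G_{N(v)}$, and let $h(v)=\max\{r\ge 0:\sum_{i=r}^{n}c_v(i)\ge r\}$ be the $h$-index based structural diversity score of $v$. The arboricity $\rho$ of $G$ is the minimum number of edge-disjoint spanning forests that cover all edges of $G$; $d_{\max}$ is the maximum degree. **Algorithm** (efficient top-$k$ search). The input is $G$, given by adjacency lists in any order, and an integer $0\le k\le n$. 1. Compute $\varphi_G(v)$ for all $v$ by core decomposition (repeatedly remove a vertex of least current degree, keeping the vertices bin-sorted by their current degrees). 2. For all $v$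 compute $\widehat h(v)=\max\{x\ge 0: |\{u\in N(v):\min\{\varphi_G(v),\varphi_G(u)-1\}\ge x\}|\ge x(x+1)\}$. 3. Bin-sort the vertices by $\widehat h$, and set $S=\emptyset$. 4. Go through the vertices $v$ in descending order of $\widehat h(v)$. If $|S|=k$ and $\widehat h(v)\le\min_{u\in S}h(u)$, stop. Otherwise compute $h(v)$: extract $G_{N(v)}$; compute its core decomposition; for each $t\ge 1$, count by breadth-first search the components of the vertices of coreness exactly $t$ in $G_{N(v)}$ that have no edge to a vertex of larger coreness, which gives $c_v(t)$; and add up $c_v(t)$ for descending $t$ until the sum is at least $t$ (then $h(v)=t$; if this never happens, $h(v)=0$). If $|S|<k$, add $v$ to $S$; otherwise, if $h(v)>\min_{u\in S}h(u)$, replace a vertex of $S$ of least score by $v$. 5. Return $S$. The algorithm is implemented on a unit-cost random access machine. Time is the number of executed assignments, stores and tests; space is the number of registers and distinct memory cells touched, input included. The ego-networks are extracted with the help of lists that contain, for each vertex, its neighbours of higher degree (ties broken by label), and the elements of $S$ are kept in buckets by score. **Theorem.** There is an absolute constant $C$ such that for every finite connected simple graph $G$, every adjacency list representation of $G$ and every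 $k$ with $0\le k\le n$: * the algorithm stops with a set $S$ of $k$ vertices with the highest scores: $|S|=k$, and $h(u)\ge h(w)$ for all $u\in S$, $w\in V\setminus S$; in particular $S$ maximizes $\min_{u\in S}h(u)$ among the $k$-element subsets of $V$; * if $m\ge 1$, it takes at most $C\rho m$ time and at most $Cm$ space. Moreover $\rho\le d_{\max}$ for every finite connected simple graph $G$, and $\rho\le\sqrt m$ unless $G$ is a triangle. (For the triangle, $\rho=2=d_{\max}>\sqrt3$.) -/

import Mathlib

/-! ## Structural diversity -/

namespace StructDiv

section Diversity

variable {V : Type*}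

/-- The coreness `φ(H)` of a subgraph: the minimum degree in `H` of the vertices of `H`. -/
noncomputable def coreness {G : SimpleGraph V} (H : G.Subgraph) : ℕ :=
  sInf {d | ∃ v ∈ H.verts, d = (H.neighborSet v).ncard}

/-- A connected `t`-core: a connected subgraph, all of whose vertices have degree at least `t`
in it. -/
def IsConnectedCore {G : SimpleGraph V} (t : ℕ) (H : G.Subgraph) : Prop :=
  H.Connected ∧ ∀ v ∈ H.verts, t ≤ (H.neighborSet v).ncard

/-- A discriminative core: a maximal connected `t`-core for its own coreness `t = φ(H)`, which has
no subgraph of larger coreness. -/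
def IsDiscriminativeCore {G : SimpleGraph V} (H : G.Subgraph) : Prop :=
  Maximal (IsConnectedCore (coreness H)) H ∧
    ∀ H' : G.Subgraph, H'.verts.Nonempty → H' ≤ H → ¬ coreness H < coreness H'

/-- The ego-network of `v`: the subgraph of `G` that is induced by the neighbours of `v`. -/
abbrev egoNetwork (G : SimpleGraph V) (v : V) : SimpleGraph (G.neighborSet v) :=
  G.induce (G.neighborSet v)

/-- The entry `c_v(r)` of the diversity vector of `v`: the number of discriminative cores of
coreness `r` in the ego-network of `v`. -/
noncomputable def diversityVector (G : SimpleGraph V) (v : V) (r : ℕ) : ℕ :=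
  {H : (egoNetwork G v).Subgraph | IsDiscriminativeCore H ∧ coreness H = r}.ncard

/-- The `h`-index based structural diversity score
`h(v) = max {r : c_v(r) + c_v(r + 1) + ⋯ + c_v(|V|) ≥ r}`. The set contains `0`, and all its
elements are at most `|V|`. -/
noncomputable def score [Fintype V] (G : SimpleGraph V) (v : V) : ℕ :=
  sSup {r | r ≤ ∑ i ∈ Finset.Icc r (Fintype.card V), diversityVector G v i}

/-- `S` consists of `k` vertices with the highest scores; in particular it maximizes
`min {h(v) : v ∈ S}` among the sets of `k` vertices. -/
structure IsTopK [Fintype V] (G : SimpleGraph V) (k : ℕ) (S : Finset V) : Prop where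
  card_eq : S.card = k
  highest : ∀ u ∈ S, ∀ w, w ∉ S → score G w ≤ score G u
  optimal : ∀ T : Finset V, T.card = k →
    T.inf (fun v => (score G v : ℕ∞)) ≤ S.inf (fun v => (score G v : ℕ∞))

/-- The arboricity: the minimum number of edge-disjoint spanning forests that cover all edges. -/
noncomputable def arboricity (G : SimpleGraph V) : ℕ :=
  sInf {a | ∃ F : Fin a → SimpleGraph V,
    (∀ i, (F i).IsAcyclic) ∧ Pairwise (fun i j => Disjoint (F i) (F j)) ∧ ⨆ i, F i = G}

end Diversity

/-! ## A random access machine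

Programs act on finitely many scalar registers and finitely many arrays of natural numbers. Every
executed assignment, store or test costs one unit of time; the space is the number of registers and
of distinct array cells that the run touches (the cells of the input included). -/

/-- The registers. -/
inductive Var
  | n | k | d | e | flag | h | head | i | j | mn | p | q | r | s | size | t | tail | tmax
  | u | v | w | x | y
  deriving DecidableEq

instance : Fintype Var where
  elems := {.n, .k, .d, .e, .flag, .h, .head, .i, .j, .mn, .p, .q, .r, .s, .size, .t, .tail, .tmax,
    .u, .v, .w, .x, .y}
  complete z := by cases z <;> decide

/-- The arrays. -/
inductive Arr
  | off | adj | deg | vert | pos | cnt | bin | cur | core | hhat | ord | ooff | oadj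
  | loc | edeg | ecur | eoff | eadj | ecore | eord | visited | queue | c
  | first | next | mem
  deriving DecidableEq

/-- A memory state: the contents of the registers and of the arrays. -/
structure State where
  reg : Var → ℕ
  arr : Arr → ℕ → ℕ

/-- Expressions over the registers and the array cells; subtraction is truncated. -/
inductive Expr
  | lit (a : ℕ)
  | var (z : Var)
  | get (A : Arr) (a : Expr)
  | add (a b : Expr)
  | sub (a b : Expr)
  | mul (a b : Expr)

/-- Tests. -/
inductive Test
  | lt (a b : Expr)
  | le (a b : Expr)
  | eq (a b : Expr)
  | and (a b : Test)
  | or (a b : Test)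

/-- Programs. -/
inductive Cmd
  | skip
  | assign (z : Var) (a : Expr)
  | store (A : Arr) (a b : Expr)
  | seq (c₁ c₂ : Cmd)
  | branch (b : Test) (c₁ c₂ : Cmd)
  | loop (b : Test) (c : Cmd)

namespace Expr

/-- The value of an expression. -/
def eval (σ : State) : Expr → ℕ
  | lit a => a
  | var z => σ.reg z
  | get A a => σ.arr A (eval σ a)
  | add a b => eval σ a + eval σ b
  | sub a b => eval σ a - eval σ b
  | mul a b => eval σ a * eval σ b

/-- The array cells that are read in the evaluation of an expression. -/
def cells (σ : State) : Expr → Set (Arr × ℕ)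
  | lit _ => ∅
  | var _ => ∅
  | get A a => insert (A, eval σ a) (cells σ a)
  | add a b => cells σ a ∪ cells σ b
  | sub a b => cells σ a ∪ cells σ b
  | mul a b => cells σ a ∪ cells σ b

instance : Coe Var Expr := ⟨var⟩
instance (a : ℕ) : OfNat Expr a := ⟨lit a⟩
instance : Add Expr := ⟨add⟩
instance : Sub Expr := ⟨sub⟩
instance : Mul Expr := ⟨mul⟩

end Expr

/-- `A i` denotes the `i`-th cell of the array `A`, where `i` is an expression. -/
instance : CoeFun Arr (fun _ => Expr → Expr) := ⟨Expr.get⟩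

namespace Test

/-- The truth of a test. -/
def Holds (σ : State) : Test → Prop
  | lt a b => a.eval σ < b.eval σ
  | le a b => a.eval σ ≤ b.eval σ
  | eq a b => a.eval σ = b.eval σ
  | and a b => Holds σ a ∧ Holds σ b
  | or a b => Holds σ a ∨ Holds σ b

/-- The array cells that are read in a test, evaluated from the left with short-circuiting. -/
def cells (σ : State) : Test → Set (Arr × ℕ)
  | lt a b => a.cells σ ∪ b.cells σ
  | le a b => a.cells σ ∪ b.cells σ
  | eq a b => a.cells σ ∪ b.cells σ
  | and a b => cells σ a ∪ {z | Holds σ a ∧ z ∈ cells σ b}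
  | or a b => cells σ a ∪ {z | ¬ Holds σ a ∧ z ∈ cells σ b}

end Test

/-- The state after the register `z` has received the value `a`. -/
def State.setReg (σ : State) (z : Var) (a : ℕ) : State :=
  { σ with reg := Function.update σ.reg z a }

/-- The state after the cell `A[i]` has received the value `a`. -/
def State.setCell (σ : State) (A : Arr) (i a : ℕ) : State :=
  { σ with arr := Function.update σ.arr A (Function.update (σ.arr A) i a) }

/-- `Exec c σ T M τ`: the program `c`, started in the state `σ`, stops in the state `τ` after `T`
steps, and `M` is the set of the array cells that it reads or writes. -/
inductive Exec : Cmd → State → ℕ → Set (Arr × ℕ) → State → Prop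
  | skip (σ : State) : Exec .skip σ 1 ∅ σ
  | assign (σ : State) (z : Var) (a : Expr) :
      Exec (.assign z a) σ 1 (a.cells σ) (σ.setReg z (a.eval σ))
  | store (σ : State) (A : Arr) (a b : Expr) :
      Exec (.store A a b) σ 1 (insert (A, a.eval σ) (a.cells σ ∪ b.cells σ))
        (σ.setCell A (a.eval σ) (b.eval σ))
  | seq {c₁ c₂ : Cmd} {σ₁ σ₂ σ₃ : State} {T₁ T₂ : ℕ} {M₁ M₂ : Set (Arr × ℕ)} :
      Exec c₁ σ₁ T₁ M₁ σ₂ → Exec c₂ σ₂ T₂ M₂ σ₃ → Exec (.seq c₁ c₂) σ₁ (T₁ + T₂) (M₁ ∪ M₂) σ₃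
  | branch_true {b : Test} {c₁ c₂ : Cmd} {σ τ : State} {T : ℕ} {M : Set (Arr × ℕ)} :
      b.Holds σ → Exec c₁ σ T M τ → Exec (.branch b c₁ c₂) σ (1 + T) (b.cells σ ∪ M) τ
  | branch_false {b : Test} {c₁ c₂ : Cmd} {σ τ : State} {T : ℕ} {M : Set (Arr × ℕ)} :
      ¬ b.Holds σ → Exec c₂ σ T M τ → Exec (.branch b c₁ c₂) σ (1 + T) (b.cells σ ∪ M) τ
  | loop_true {b : Test} {c : Cmd} {σ₁ σ₂ σ₃ : State} {T₁ T₂ : ℕ} {M₁ M₂ : Set (Arr × ℕ)} :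
      b.Holds σ₁ → Exec c σ₁ T₁ M₁ σ₂ → Exec (.loop b c) σ₂ T₂ M₂ σ₃ →
      Exec (.loop b c) σ₁ (1 + T₁ + T₂) (b.cells σ₁ ∪ M₁ ∪ M₂) σ₃
  | loop_false {b : Test} {c : Cmd} {σ : State} :
      ¬ b.Holds σ → Exec (.loop b c) σ 1 (b.cells σ) σ

/-- The space of a run that touches the array cells in `M`. -/
noncomputable def space (M : Set (Arr × ℕ)) : ℕ∞ := M.encard + Fintype.card Var

/-! ## The algorithms -/

section Algorithms

open Var Arr Test Cmd

local infix:50 " ≔ " => Cmd.assign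
local infixr:40 " ;; " => Cmd.seq

/-- `for z = a, a + 1, …, b - 1 do c`. -/
def forRange (z : Var) (a b : Expr) (c : Cmd) : Cmd :=
  z ≔ a ;; loop (lt z b) (c ;; z ≔ z + 1)

/-- Bin sort: lists the numbers `0, …, N - 1` in `out` in ascending order of their keys, which are
less than `N`. Afterwards the numbers with key `a` occupy the `cnt a` places of `out` from `bin a`
on. -/
def binSort (N : Var) (key out : Arr) : Cmd :=
  forRange i 0 N (store cnt i 0) ;;
  forRange i 0 N (store cnt (key i) (cnt (key i) + 1)) ;;
  s ≔ 0 ;;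
  forRange i 0 N (store bin i s ;; store cur i s ;; s ≔ s + cnt i) ;;
  forRange i 0 N (store out (cur (key i)) i ;; store cur (key i) (cur (key i) + 1))

/-- Core decomposition of the graph on `0, …, N - 1` in which the neighbours of `x` are
`tgt a` for `src x ≤ a < src (x + 1)`; the coreness of `x` is stored in `res x`.

The vertices are kept in `vert` in ascending order of their current degrees, `pos` is the inverse
of `vert`, and `bin a` is the first place of a vertex of degree `a`. The vertices at the places
below `i` are those that have been removed. -/
def coreDecomposition (N : Var) (src tgt res : Arr) : Cmd :=
  forRange i 0 N (store deg i (src (i + 1) - src i)) ;;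
  binSort N deg vert ;;
  forRange i 0 N (store pos (vert i) i) ;;
  t ≔ 1 ;;
  i ≔ 0 ;;
  loop (lt i N)
    (branch (lt (deg (vert i)) t)
      -- remove the vertex `x` and update the degrees of its neighbours
      (x ≔ vert i ;;
       store res x (t - 1) ;;
       forRange e (src x) (src (x + 1))
        (y ≔ tgt e ;;
         branch (le t (deg y))
          -- exchange `y` with the first vertex of its bin, and move it to the bin below
          (p ≔ bin (deg y) ;;
           w ≔ vert p ;;
           store vert (pos y) w ;;
           store pos w (pos y) ;;
           store vert p y ;;
           store pos y p ;;
           store bin (deg y) (p + 1) ;;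
           store deg y (deg y - 1))
          skip) ;;
       i ≔ i + 1)
      (t ≔ t + 1))

/-- The lists of the neighbours of each vertex that follow it in the order by degree, with ties
broken by the label: those of `v` are `oadj a` for `ooff v ≤ a < ooff (v + 1)`. -/
def orientEdges : Cmd :=
  p ≔ 0 ;;
  store ooff 0 0 ;;
  forRange v 0 n
    (forRange e (off v) (off (v + 1))
      (u ≔ adj e ;;
       branch
        (or (lt (off (v + 1) - off v) (off (u + 1) - off u))
          (and (eq (off (v + 1) - off v) (off (u + 1) - off u)) (lt v u)))
        (store oadj p u ;; p ≔ p + 1)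
        skip) ;;
     store ooff (v + 1) p)

/-- Runs `c` once for each edge of the ego-network of `v`, with the labels of its ends in the
ego-network in `i` and `j`. -/
def forEgoEdges (c : Cmd) : Cmd :=
  forRange i 0 d
    (u ≔ adj (off v + i) ;;
     forRange e (ooff u) (ooff (u + 1))
      (branch (lt 0 (loc (oadj e)))
        (j ≔ loc (oadj e) - 1 ;; c)
        skip))

/-- Extracts the ego-network of `v`. It has `d` vertices; the neighbour of `v` at the place `i` of
its list receives the label `i`, and the neighbours of `i` in the ego-network become `eadj a` for
`eoff i ≤ a < eoff (i + 1)`. -/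
def extractEgo : Cmd :=
  d ≔ off (v + 1) - off v ;;
  forRange i 0 d (store loc (adj (off v + i)) (i + 1) ;; store edeg i 0) ;;
  forEgoEdges (store edeg i (edeg i + 1) ;; store edeg j (edeg j + 1)) ;;
  store eoff 0 0 ;;
  forRange i 0 d (store ecur i (eoff i) ;; store eoff (i + 1) (eoff i + edeg i)) ;;
  forEgoEdges
    (store eadj (ecur i) j ;; store ecur i (ecur i + 1) ;;
     store eadj (ecur j) i ;; store ecur j (ecur j + 1)) ;;
  forRange i 0 d (store loc (adj (off v + i)) 0)

/-- Discriminative core decomposition of the ego-network: the number of discriminative cores of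
coreness `a` is stored in `c a` for `1 ≤ a ≤ tmax`. -/
def discriminativeDecomposition : Cmd :=
  coreDecomposition d eoff eadj ecore ;;
  tmax ≔ 0 ;;
  forRange i 0 d
    (store visited i 0 ;; branch (lt tmax (ecore i)) (tmax ≔ ecore i) skip) ;;
  binSort d ecore eord ;;
  head ≔ 0 ;;
  tail ≔ 0 ;;
  forRange t 1 (tmax + 1)
    (store c t 0 ;;
     forRange q (bin t) (bin t + cnt t)
      (u ≔ eord q ;;
       flag ≔ 1 ;;
       branch (eq (visited u) 0)
        (store visited u 1 ;;
         store queue tail u ;;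
         tail ≔ tail + 1 ;;
         loop (lt head tail)
          (x ≔ queue head ;;
           head ≔ head + 1 ;;
           forRange e (eoff x) (eoff (x + 1))
            (y ≔ eadj e ;;
             branch (eq (ecore y) t)
              (branch (eq (visited y) 0)
                (store queue tail y ;; tail ≔ tail + 1 ;; store visited y 1)
                skip)
              (branch (lt t (ecore y)) (flag ≔ 0) skip))) ;;
         branch (eq flag 1) (store c t (c t + 1)) skip)
        skip))

/-- Computes the score of `v` and leaves it in `h`; the assignment `t ≔ 0` ends the loop. -/
def computeScore : Cmd :=
  extractEgo ;;
  discriminativeDecomposition ;;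
  h ≔ 0 ;;
  t ≔ tmax ;;
  loop (lt 0 t)
    (h ≔ h + c t ;;
     branch (le t h) (h ≔ t ;; t ≔ 0) (t ≔ t - 1))

/-- Computes for each vertex `v` the upper bound
`ĥ(v) = max {x : |{u ∈ N(v) : min {φ(v), φ(u) - 1} ≥ x}| ≥ x (x + 1)}` of its score; the
assignment `x ≔ 0` ends the inner loop. -/
def upperBounds : Cmd :=
  forRange v 0 n
    (d ≔ off (v + 1) - off v ;;
     forRange i 0 (d + 1) (store cnt i 0) ;;
     forRange e (off v) (off (v + 1))
      (y ≔ core (adj e) - 1 ;;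
       branch (lt (core v) y) (y ≔ core v) skip ;;
       store cnt y (cnt y + 1)) ;;
     store hhat v 0 ;;
     s ≔ 0 ;;
     x ≔ d ;;
     loop (lt 0 x)
      (s ≔ s + cnt x ;;
       branch (le (x * (x + 1)) s) (store hhat v x ;; x ≔ 0) (x ≔ x - 1)))

/-- Adds `v`, whose score is `h`, to the answer set. -/
def insertVertex : Cmd :=
  store next v (first h) ;;
  store first h (v + 1) ;;
  store mem v 1

/-- The efficient top-`k` search framework.

The answer set is kept as the array `mem` of its membership values, together with the number `size`
of its elements, the least score `mn` of its elements, and for each score `a` a linked list, through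
`first a` and `next`, of its elements of score `a` (a vertex `v` is entered as `v + 1`, and `0` ends
the list). The assignment `r ≔ 0` ends the search. -/
def topKSearch : Cmd :=
  coreDecomposition n off adj core ;;
  upperBounds ;;
  binSort n hhat ord ;;
  orientEdges ;;
  forRange i 0 n (store loc i 0 ;; store first i 0 ;; store mem i 0) ;;
  size ≔ 0 ;;
  mn ≔ n ;;
  r ≔ n ;;
  loop (lt 0 r)
    (r ≔ r - 1 ;;
     v ≔ ord r ;;
     branch (and (eq size k) (le (hhat v) mn))
      (r ≔ 0)
      (computeScore ;;
       branch (lt size k)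
        (insertVertex ;;
         branch (lt h mn) (mn ≔ h) skip ;;
         size ≔ size + 1)
        (branch (lt mn h)
          (u ≔ first mn - 1 ;;
           store first mn (next u) ;;
           store mem u 0 ;;
           insertVertex ;;
           loop (eq (first mn) 0) (mn ≔ mn + 1))
          skip)))

end Algorithms

/-! ## Input and output -/

/-- `L` is an adjacency list representation of `G`: `L v` lists the neighbours of `v`, in any order
and without repetitions. -/
def IsAdjacencyList {n : ℕ} (G : SimpleGraph (Fin n)) (L : Fin n → List (Fin n)) : Prop :=
  ∀ v, (L v).Nodup ∧ ∀ u, u ∈ L v ↔ G.Adj v u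

/-- The initial state: the registers `n` and `k` hold the number of vertices and the parameter, the
array `adj` holds the concatenation of the lists `L 0, …, L (n - 1)`, and `off v` is the place where
the list of `v` begins. Everything else is `0`. -/
def initialState {n : ℕ} (L : Fin n → List (Fin n)) (k : ℕ) : State where
  reg := fun
    | .n => n
    | .k => k
    | _ => 0
  arr := fun
    | .off => fun a => if a ≤ n then (((List.ofFn L).take a).map List.length).sum else 0
    | .adj => fun a => ((List.ofFn L).flatten.map Fin.val).getD a 0
    | _ => fun _ => 0

/-- The answer set that is held by the array `mem`. -/
def answer (n : ℕ) (σ : State) : Finset (Fin n) :=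
  Finset.univ.filter fun v => σ.arr .mem v = 1

end StructDiv

/-! Four ingredients are combined: a verification of the program with time and space, a description
of discriminative cores by levels of coreness, a charging argument over forests, and a construction
of forest covers.

Verification. `wp` is total correctness together with the running time and a common bound `K` for
all array indices. There are finitely many arrays, so the space is linear in `K`, and `K` is linear
in `n + m`. The core decomposition maintains two facts at level `t`: every `t`-core lies in the set
of remaining vertices, and every remaining vertex lies in some `(t - 1)`-core. A vertex removed with
degree below `t` therefore has coreness `t - 1`.

Cores. A component of the vertices of coreness at least `t` is the largest connected `t`-core
through any of its vertices. It is discriminative of coreness `t` exactly when all its vertices have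
coreness `t`, that is, when it is a component of the vertices of coreness exactly `t` without an
edge to a larger coreness (`isDiscriminativeCore_iff`). This is what the breadth-first search
counts. Such a component at level `r` has at least `r + 1` vertices, and distinct ones are disjoint
(`ncard_topComps_mul_le`). Joining `v` to a core of its ego-network raises the coreness by one
(`HasCoreness.of_ego`). A score `s` thus yields `s (s + 1)` neighbours of large coreness, so the
score is at most the bound used for sorting (`score_mul_le`), and the early stop loses nothing.

Time. The score of `v` costs its degree plus the out-degrees of its neighbours in the orientation
towards larger degree. Summed over `v`, every oriented edge is paid for as often as the smaller
degree of its ends (`sum_outdegree_eq`). In a rooted forest each edge is charged to its child, whose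
degree is at least that smaller degree; each forest contributes at most `2 m`, and the total is at
most `2 ρ m` (`sum_forestCover_le`). Everything else is linear in `n + m`, where connectedness gives
`n ≤ m + 1`. Advancing the least score is amortised, since it never falls once the answer is full.

Arboricity. A vertex of degree at most `a` can be added to a cover by `a` forests, one edge per
forest, so only the `(a + 1)`-cores need to be covered (`forestCover_of_coreSets`). For `a` the
maximum degree there is no nonempty one. If `m < (a + 1)²` and `a ≥ 2`, such a core has at most `2 a
+ 1` vertices; up to `2 a` the complete graph is covered (`forestCover_complete`), and the last case
is `forestCover_odd`. For `a = 1` the core is a triangle, which by connectedness is the whole graph.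
-/

set_option linter.constructorNameAsVariable false

namespace StructDiv

/-! ## Symbolic execution -/

/-- The evaluation of the expression reads only cells with an index below `K`. -/
def Expr.Ok (K : ℕ) (σ : State) (a : Expr) : Prop := ∀ z ∈ a.cells σ, z.2 < K

/-- The evaluation of the test reads only cells with an index below `K`. -/
def Test.Ok (K : ℕ) (σ : State) (b : Test) : Prop := ∀ z ∈ b.cells σ, z.2 < K

section Eval

variable (K : ℕ) (σ : State) (a b : Expr) (z : Var) (A : Arr)

@[simp] theorem Expr.eval_ofNat (l : ℕ) : (ofNat(l) : Expr).eval σ = OfNat.ofNat l := rfl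
@[simp] theorem Expr.eval_var : (Expr.var z).eval σ = σ.reg z := rfl
@[simp] theorem Expr.eval_get : (Expr.get A a).eval σ = σ.arr A (a.eval σ) := rfl
@[simp] theorem Expr.eval_add : (a + b).eval σ = a.eval σ + b.eval σ := rfl
@[simp] theorem Expr.eval_sub : (a - b).eval σ = a.eval σ - b.eval σ := rfl
@[simp] theorem Expr.eval_mul : (a * b).eval σ = a.eval σ * b.eval σ := rfl

@[simp] theorem Expr.ok_ofNat (l : ℕ) : (ofNat(l) : Expr).Ok K σ :=
  fun _ h => absurd h (Set.notMem_empty _)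
@[simp] theorem Expr.ok_var : (Expr.var z).Ok K σ := fun _ h => absurd h (Set.notMem_empty _)
@[simp] theorem Expr.ok_get : (Expr.get A a).Ok K σ ↔ a.eval σ < K ∧ a.Ok K σ := by
  simp [Expr.Ok, Expr.cells]
theorem ok_union {s t : Set (Arr × ℕ)} :
    (∀ z ∈ s ∪ t, z.2 < K) ↔ (∀ z ∈ s, z.2 < K) ∧ ∀ z ∈ t, z.2 < K := by
  simp only [Set.mem_union, or_imp, forall_and]
@[simp] theorem Expr.ok_add : (a + b).Ok K σ ↔ a.Ok K σ ∧ b.Ok K σ := ok_union K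
@[simp] theorem Expr.ok_sub : (a - b).Ok K σ ↔ a.Ok K σ ∧ b.Ok K σ := ok_union K
@[simp] theorem Expr.ok_mul : (a * b).Ok K σ ↔ a.Ok K σ ∧ b.Ok K σ := ok_union K

@[simp] theorem Test.ok_lt : (Test.lt a b).Ok K σ ↔ a.Ok K σ ∧ b.Ok K σ := ok_union K
@[simp] theorem Test.ok_le : (Test.le a b).Ok K σ ↔ a.Ok K σ ∧ b.Ok K σ := ok_union K
@[simp] theorem Test.ok_eq : (Test.eq a b).Ok K σ ↔ a.Ok K σ ∧ b.Ok K σ := ok_union K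
@[simp] theorem Test.ok_and (p q : Test) :
    (Test.and p q).Ok K σ ↔ p.Ok K σ ∧ (p.Holds σ → q.Ok K σ) := by
  simp only [Test.Ok, Test.cells, ok_union, Set.mem_ofPred_eq]
  tauto
@[simp] theorem Test.ok_or (p q : Test) :
    (Test.or p q).Ok K σ ↔ p.Ok K σ ∧ (¬ p.Holds σ → q.Ok K σ) := by
  simp only [Test.Ok, Test.cells, ok_union, Set.mem_ofPred_eq]
  tauto

@[simp] theorem Test.holds_lt : (Test.lt a b).Holds σ ↔ a.eval σ < b.eval σ := Iff.rfl
@[simp] theorem Test.holds_le : (Test.le a b).Holds σ ↔ a.eval σ ≤ b.eval σ := Iff.rfl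
@[simp] theorem Test.holds_eq : (Test.eq a b).Holds σ ↔ a.eval σ = b.eval σ := Iff.rfl
@[simp] theorem Test.holds_and (p q : Test) :
    (Test.and p q).Holds σ ↔ p.Holds σ ∧ q.Holds σ := Iff.rfl
@[simp] theorem Test.holds_or (p q : Test) :
    (Test.or p q).Holds σ ↔ p.Holds σ ∨ q.Holds σ := Iff.rfl

end Eval

section Update

variable (σ : State) (z w : Var) (A B : Arr) (i a : ℕ)

@[simp] theorem State.setReg_arr : (σ.setReg z a).arr = σ.arr := rfl
@[simp] theorem State.setCell_reg : (σ.setCell A i a).reg = σ.reg := rfl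
@[simp] theorem State.setReg_reg_same : (σ.setReg z a).reg z = a := Function.update_self ..
@[simp] theorem State.setCell_arr_same :
    (σ.setCell A i a).arr A = Function.update (σ.arr A) i a := Function.update_self ..

variable {z w A B}

@[simp] theorem State.setReg_reg_ne (h : w ≠ z) : (σ.setReg z a).reg w = σ.reg w :=
  Function.update_of_ne h ..
@[simp] theorem State.setCell_arr_ne (h : B ≠ A) : (σ.setCell A i a).arr B = σ.arr B :=
  Function.update_of_ne h ..

end Update

/-! ### Weakest preconditions with time and space -/

/-- The program `c`, started in `σ`, stops; it touches only cells with an index below `K`, and the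
running time and the final state satisfy `Q`. -/
def wp (K : ℕ) (c : Cmd) (Q : ℕ → State → Prop) (σ : State) : Prop :=
  ∃ T M τ, Exec c σ T M τ ∧ (∀ z ∈ M, z.2 < K) ∧ Q T τ

namespace Cmd

/-- The program contains no assignment to the register `z`. -/
def keepsReg (z : Var) : Cmd → Prop
  | skip => True
  | assign w _ => z ≠ w
  | store _ _ _ => True
  | seq c₁ c₂ => keepsReg z c₁ ∧ keepsReg z c₂
  | branch _ c₁ c₂ => keepsReg z c₁ ∧ keepsReg z c₂
  | loop _ c => keepsReg z c

/-- The program contains no store to the array `A`. -/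
def keepsArr (A : Arr) : Cmd → Prop
  | skip => True
  | assign _ _ => True
  | store B _ _ => A ≠ B
  | seq c₁ c₂ => keepsArr A c₁ ∧ keepsArr A c₂
  | branch _ c₁ c₂ => keepsArr A c₁ ∧ keepsArr A c₂
  | loop _ c => keepsArr A c

instance decidableKeepsReg (z : Var) : (c : Cmd) → Decidable (keepsReg z c)
  | skip => .isTrue trivial
  | assign w _ => inferInstanceAs (Decidable (z ≠ w))
  | store _ _ _ => .isTrue trivial
  | seq c₁ c₂ => @instDecidableAnd _ _ (decidableKeepsReg z c₁) (decidableKeepsReg z c₂)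
  | branch _ c₁ c₂ => @instDecidableAnd _ _ (decidableKeepsReg z c₁) (decidableKeepsReg z c₂)
  | loop _ c => decidableKeepsReg z c

instance decidableKeepsArr (A : Arr) : (c : Cmd) → Decidable (keepsArr A c)
  | skip => .isTrue trivial
  | assign _ _ => .isTrue trivial
  | store B _ _ => inferInstanceAs (Decidable (A ≠ B))
  | seq c₁ c₂ => @instDecidableAnd _ _ (decidableKeepsArr A c₁) (decidableKeepsArr A c₂)
  | branch _ c₁ c₂ => @instDecidableAnd _ _ (decidableKeepsArr A c₁) (decidableKeepsArr A c₂)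
  | loop _ c => decidableKeepsArr A c

end Cmd

/-- The states `σ` and `τ` agree on what the program `c` does not write. -/
def Frame (c : Cmd) (σ τ : State) : Prop :=
  (∀ z, c.keepsReg z → τ.reg z = σ.reg z) ∧ ∀ A, c.keepsArr A → τ.arr A = σ.arr A

theorem Frame.refl (c : Cmd) (σ : State) : Frame c σ σ := ⟨fun _ _ => rfl, fun _ _ => rfl⟩

theorem Frame.trans {c : Cmd} {ρ σ τ : State} (h₁ : Frame c ρ σ) (h₂ : Frame c σ τ) :
    Frame c ρ τ :=
  ⟨fun z hz => (h₂.1 z hz).trans (h₁.1 z hz), fun A hA => (h₂.2 A hA).trans (h₁.2 A hA)⟩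

theorem Frame.mono {c c' : Cmd} {σ τ : State} (h : Frame c σ τ)
    (hr : ∀ z, c'.keepsReg z → c.keepsReg z) (ha : ∀ A, c'.keepsArr A → c.keepsArr A) :
    Frame c' σ τ :=
  ⟨fun z hz => h.1 z (hr z hz), fun A hA => h.2 A (ha A hA)⟩

/-- What a program leaves alone is read off its syntax, which is decidable for concrete programs.
Specifications can then omit everything that does not change. -/
theorem Exec.frame {c : Cmd} {σ τ : State} {T : ℕ} {M : Set (Arr × ℕ)} (h : Exec c σ T M τ) :
    Frame c σ τ := by
  induction h with
  | skip σ => exact .refl ..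
  | assign σ z a => exact ⟨fun w hw => σ.setReg_reg_ne _ hw, fun _ _ => rfl⟩
  | store σ A a b => exact ⟨fun _ _ => rfl, fun B hB => σ.setCell_arr_ne _ _ hB⟩
  | seq _ _ h₁ h₂ =>
    exact .trans (h₁.mono (fun _ h => And.left h) fun _ h => And.left h)
      (h₂.mono (fun _ h => And.right h) fun _ h => And.right h)
  | branch_true _ _ h => exact h.mono (fun _ h => And.left h) fun _ h => And.left h
  | branch_false _ _ h => exact h.mono (fun _ h => And.right h) fun _ h => And.right h
  | loop_true _ _ _ h₁ h₂ => exact (h₁.mono (fun _ h => h) fun _ h => h).trans h₂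
  | loop_false _ => exact .refl ..

section Rules

variable {K : ℕ} {c c₁ c₂ : Cmd} {Q Q' : ℕ → State → Prop} {σ : State}

/-- The consequence rule also hands over the frame of the run, so facts about unwritten registers
and arrays survive a call. -/
theorem wp.mono (h : wp K c Q σ) (hQ : ∀ T τ, Frame c σ τ → Q T τ → Q' T τ) : wp K c Q' σ := by
  obtain ⟨T, M, τ, h, hM, hq⟩ := h
  exact ⟨T, M, τ, h, hM, hQ T τ h.frame hq⟩

theorem wp_skip (h : Q 1 σ) : wp K .skip Q σ := ⟨1, ∅, σ, .skip σ, by simp, h⟩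

theorem wp_assign {z : Var} {a : Expr} (ha : a.Ok K σ) (h : Q 1 (σ.setReg z (a.eval σ))) :
    wp K (.assign z a) Q σ := ⟨1, _, _, .assign σ z a, ha, h⟩

theorem wp_store {A : Arr} {a b : Expr} (hi : a.eval σ < K) (ha : a.Ok K σ) (hb : b.Ok K σ)
    (h : Q 1 (σ.setCell A (a.eval σ) (b.eval σ))) : wp K (.store A a b) Q σ := by
  refine ⟨1, _, _, .store σ A a b, ?_, h⟩
  rintro z (rfl | hz)
  · exact hi
  · exact (ok_union K).2 ⟨ha, hb⟩ z hz

theorem wp_seq (h : wp K c₁ (fun T₁ τ => wp K c₂ (fun T₂ ρ => Q (T₁ + T₂) ρ) τ) σ) :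
    wp K (.seq c₁ c₂) Q σ := by
  obtain ⟨T₁, M₁, τ, h₁, hM₁, T₂, M₂, ρ, h₂, hM₂, h⟩ := h
  exact ⟨_, _, _, .seq h₁ h₂, (ok_union K).2 ⟨hM₁, hM₂⟩, h⟩

theorem wp_branch {b : Test} (hb : b.Ok K σ)
    (h₁ : b.Holds σ → wp K c₁ (fun T τ => Q (1 + T) τ) σ)
    (h₂ : ¬ b.Holds σ → wp K c₂ (fun T τ => Q (1 + T) τ) σ) : wp K (.branch b c₁ c₂) Q σ := by
  by_cases h : b.Holds σ
  · obtain ⟨T, M, τ, hE, hM, hQ⟩ := h₁ h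
    exact ⟨_, _, _, .branch_true h hE, (ok_union K).2 ⟨hb, hM⟩, hQ⟩
  · obtain ⟨T, M, τ, hE, hM, hQ⟩ := h₂ h
    exact ⟨_, _, _, .branch_false h hE, (ok_union K).2 ⟨hb, hM⟩, hQ⟩

/-- A loop with invariant `P`, which may depend on the time that has elapsed, and variant `μ`. -/
theorem wp_loop {b : Test} (P : ℕ → State → Prop) (μ : State → ℕ) (h0 : P 0 σ)
    (hok : ∀ T τ, Frame (.loop b c) σ τ → P T τ → b.Ok K τ)
    (hstep : ∀ T τ, Frame (.loop b c) σ τ → P T τ → b.Holds τ →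
      wp K c (fun T' τ' => P (T + T' + 1) τ' ∧ μ τ' < μ τ) τ)
    (hQ : ∀ T τ, Frame (.loop b c) σ τ → P T τ → ¬ b.Holds τ → Q (T + 1) τ) :
    wp K (.loop b c) Q σ := by
  -- The elapsed time `T` is generalised together with the state, because the invariant may refer to
  -- it; the induction is on the variant.
  suffices H : ∀ l T τ, μ τ = l → Frame (.loop b c) σ τ → P T τ →
      wp K (.loop b c) (fun T' ρ => Q (T + T') ρ) τ by
    simpa using H _ 0 σ rfl (.refl ..) h0
  intro l
  induction l using Nat.strong_induction_on with
  | _ l ih =>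
    intro T τ hl hF hP
    by_cases hb : b.Holds τ
    · obtain ⟨T₁, M₁, τ₁, hE₁, hM₁, hP₁, hμ⟩ := hstep T τ hF hP hb
      have hF₁ : Frame (.loop b c) σ τ₁ := hF.trans (hE₁.frame.mono (fun _ h => h) fun _ h => h)
      obtain ⟨T₂, M₂, τ₂, hE₂, hM₂, hQ₂⟩ := ih _ (hl ▸ hμ) _ τ₁ rfl hF₁ hP₁
      refine ⟨_, _, _, .loop_true hb hE₁ hE₂,
        (ok_union K).2 ⟨(ok_union K).2 ⟨hok T τ hF hP, hM₁⟩, hM₂⟩, ?_⟩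
      convert hQ₂ using 1
      ring
    · exact ⟨_, _, _, .loop_false hb, hok T τ hF hP, hQ T τ hF hP hb⟩

/-- A counting loop with invariant `P`, which may depend on the counter and the elapsed time. -/
theorem wp_forRange {z : Var} {a b : Expr} (P : ℕ → ℕ → State → Prop) (lo hi : ℕ)
    (ha : a.Ok K σ) (hlo : a.eval σ = lo) (hle : lo ≤ hi)
    (hb : ∀ i T τ, lo ≤ i → i ≤ hi → τ.reg z = i → Frame (forRange z a b c) σ τ → P i T τ →
      b.Ok K τ ∧ b.eval τ = hi)
    (hz : c.keepsReg z)
    (h0 : P lo 1 (σ.setReg z lo))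
    (hstep : ∀ i T τ, lo ≤ i → i < hi → τ.reg z = i → Frame (forRange z a b c) σ τ → P i T τ →
      wp K c (fun T' τ' => P (i + 1) (T + T' + 2) (τ'.setReg z (i + 1))) τ)
    (hQ : ∀ T τ, τ.reg z = hi → Frame (forRange z a b c) σ τ → P hi T τ → Q (T + 1) τ) :
    wp K (forRange z a b c) Q σ := by
  refine wp_seq (wp_assign ha ?_)
  rw [hlo]
  have hsub : ∀ {τ}, Frame (.loop (.lt z b) (.seq c (.assign z (Expr.var z + 1))))
      (σ.setReg z lo) τ → Frame (forRange z a b c) σ τ := fun {τ} h =>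
    ⟨fun w hw => (h.1 w hw.2).trans (by simp [show w ≠ z from hw.1]),
      fun A hA => (h.2 A hA.2).trans rfl⟩
  refine wp_loop (fun T τ => lo ≤ τ.reg z ∧ τ.reg z ≤ hi ∧ P (τ.reg z) (1 + T) τ)
    (fun τ => hi - τ.reg z) (by simpa [hle] using h0) ?_ ?_ ?_
  · rintro T τ hF ⟨h₁, h₂, hP⟩
    simpa using (hb _ _ τ h₁ h₂ rfl (hsub hF) hP).1
  · rintro T τ hF ⟨h₁, h₂, hP⟩ hlt
    have hlt' : τ.reg z < hi := by
      simpa [(hb _ _ τ h₁ h₂ rfl (hsub hF) hP).2] using hlt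
    refine wp_seq ((hstep _ _ τ h₁ hlt' rfl (hsub hF) hP).mono fun T' τ' hF' hP' => ?_)
    have hz' : τ'.reg z = τ.reg z := hF'.1 z hz
    refine wp_assign (by simp) ?_
    -- The two extra units per round pay for the loop test and for the increment of the counter.
    have e : 1 + T + T' + 2 = 1 + (T + (T' + 1) + 1) := by ring
    rw [e] at hP'
    simp only [Expr.eval_add, Expr.eval_var, Expr.eval_ofNat, hz', State.setReg_reg_same]
    exact ⟨⟨by omega, by omega, hP'⟩, by omega⟩
  · rintro T τ hF ⟨h₁, h₂, hP⟩ hge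
    have he := hb _ _ τ h₁ h₂ rfl (hsub hF) hP
    have : τ.reg z = hi := by
      simp [he.2] at hge
      omega
    rw [this] at hP
    have := hQ _ _ this (hsub hF) hP
    rwa [add_assoc] at this

end Rules

open Finset

/-! ## Bin sort -/

/-- The array `out` lists the numbers below `N` in ascending order of their keys; `cnt a` is the
number of the keys that are equal to `a`, and `bin a` the number of the keys below `a`. -/
structure BinSorted (N : ℕ) (key out bin cnt : ℕ → ℕ) : Prop where
  cnt : ∀ a < N, cnt a = #{v ∈ range N | key v = a}
  bin : ∀ a < N, bin a = #{v ∈ range N | key v < a}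
  perm : ∃ pos : ℕ → ℕ, (∀ v < N, pos v < N ∧ out (pos v) = v) ∧
    (∀ q < N, out q < N ∧ pos (out q) = q) ∧
    ∀ v < N, ∀ a, pos v < #{v ∈ range N | key v < a} ↔ key v < a

theorem card_filter_lt_succ (N : ℕ) (key : ℕ → ℕ) (a : ℕ) :
    #{v ∈ range N | key v < a + 1} = #{v ∈ range N | key v < a} + #{v ∈ range N | key v = a} := by
  rw [← card_union_of_disjoint]
  · congr 1
    ext v
    simp only [mem_filter, mem_union, mem_range]
    omega
  · rw [disjoint_filter]
    intro v _ h
    omega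

theorem card_filter_lt_mono (N : ℕ) (key : ℕ → ℕ) {a b : ℕ} (h : a ≤ b) :
    #{v ∈ range N | key v < a} ≤ #{v ∈ range N | key v < b} :=
  card_le_card fun v => by
    simp only [mem_filter, mem_range]
    omega

theorem card_filter_range_succ (i : ℕ) (p : ℕ → Prop) [DecidablePred p] :
    #{v ∈ range (i + 1) | p v} = #{v ∈ range i | p v} + if p i then 1 else 0 := by
  rw [range_add_one, filter_insert]
  split_ifs
  · rw [card_insert_of_notMem (by simp)]
  · simp

/-- The place that bin sort assigns to `v`. -/
def sortPos (N : ℕ) (key : ℕ → ℕ) (v : ℕ) : ℕ :=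
  #{w ∈ range N | key w < key v} + #{w ∈ range v | key w = key v}

/-- The offset of `v` inside its key class counts earlier members only, so it is smaller than the
size of the class. Hence the class with key `b` stays inside its own block of places. -/
theorem sortPos_lt_iff {N : ℕ} {key : ℕ → ℕ} {v : ℕ} (hv : v < N) (a : ℕ) :
    sortPos N key v < #{w ∈ range N | key w < a} ↔ key v < a := by
  constructor
  · intro h
    by_contra! h'
    exact (h.trans_le (card_filter_lt_mono N key h')).not_ge (Nat.le_add_right ..)
  · intro h
    refine lt_of_lt_of_le ?_ (card_filter_lt_mono N key h)
    rw [card_filter_lt_succ, sortPos]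
    refine Nat.add_lt_add_left (card_lt_card ?_) _
    rw [ssubset_iff_of_subset
      (filter_subset_filter _ (range_subset_range.2 hv.le))]
    exact ⟨v, by simp [hv], by simp⟩

theorem sortPos_lt {N : ℕ} {key : ℕ → ℕ} {v : ℕ} (hv : v < N) : sortPos N key v < N :=
  ((sortPos_lt_iff hv _).2 (Nat.lt_succ_self _)).trans_le
    ((card_filter_le _ _).trans_eq (card_range N))

/-- The place determines the key by `sortPos_lt_iff`, and among equal keys the offset is strictly
increasing in the number. -/
theorem sortPos_injOn (N : ℕ) (key : ℕ → ℕ) : Set.InjOn (sortPos N key) (range N : Set ℕ) := by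
  intro v hv w hw h
  simp only [coe_range, Set.mem_Iio] at hv hw
  have hk : key v = key w := le_antisymm
    (Nat.lt_succ_iff.1 ((sortPos_lt_iff hv _).1 (h ▸ (sortPos_lt_iff hw _).2 (Nat.lt_succ_self _))))
    (Nat.lt_succ_iff.1 ((sortPos_lt_iff hw _).1 (h ▸ (sortPos_lt_iff hv _).2 (Nat.lt_succ_self _))))
  rw [sortPos, sortPos, hk, Nat.add_left_cancel_iff] at h
  have key_lt : ∀ {v w : ℕ}, key v = key w → v < w →
      #{x ∈ range v | key x = key w} < #{x ∈ range w | key x = key w} := by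
    intro v w hk hlt
    refine card_lt_card ?_
    rw [ssubset_iff_of_subset (filter_subset_filter _ (range_subset_range.2 hlt.le))]
    exact ⟨v, by simp [hlt, hk], by simp⟩
  rcases lt_trichotomy v w with hlt | rfl | hlt
  · exact absurd h (key_lt hk hlt).ne
  · rfl
  · exact absurd h (hk ▸ (key_lt hk.symm hlt)).ne'

theorem exists_sortPos_eq {N : ℕ} (key : ℕ → ℕ) {q : ℕ} (hq : q < N) :
    ∃ v < N, sortPos N key v = q := by
  have := Finset.surj_on_of_inj_on_of_card_le (s := range N) (t := range N)
    (fun v _ => sortPos N key v) (fun v hv => mem_range.2 (sortPos_lt (mem_range.1 hv)))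
    (fun v w hv hw h => sortPos_injOn N key (by simpa using hv) (by simpa using hw) h) le_rfl
    q (mem_range.2 hq)
  obtain ⟨v, hv, h⟩ := this
  exact ⟨v, mem_range.1 hv, h.symm⟩

theorem wp_binSort {K : ℕ} {N : Var} {key out : Arr} {σ : State}
    (hN : N ≠ .i ∧ N ≠ .s) (hkey : key ≠ .cnt ∧ key ≠ .bin ∧ key ≠ .cur ∧ key ≠ out)
    (hout : out ≠ .cnt ∧ out ≠ .bin ∧ out ≠ .cur) (hK : σ.reg N ≤ K)
    (hlt : ∀ v < σ.reg N, σ.arr key v < σ.reg N) :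
    wp K (binSort N key out) (fun T τ => T ≤ 20 * σ.reg N + 20 ∧
      BinSorted (σ.reg N) (σ.arr key) (τ.arr out) (τ.arr .bin) (τ.arr .cnt)) σ := by
  obtain ⟨hNi, hNs⟩ := hN
  obtain ⟨hkc, hkb, hku, hko⟩ := hkey
  obtain ⟨hoc, hob, hou⟩ := hout
  set M := σ.reg N with hM
  set f := σ.arr key with hf
  unfold binSort
  refine wp_seq (wp_forRange (fun i T τ => T ≤ 1 + 3 * i ∧ ∀ v < i, τ.arr .cnt v = 0) 0 M
    (by simp) (by simp) (Nat.zero_le _) ?_ (by simp [Cmd.keepsReg]) (by simp) ?_ ?_)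
  · intro i T τ _ _ hi hF _
    simp [hF.1 N (by simp [forRange, Cmd.keepsReg, hNi]), hM]
  · rintro i T τ - hiM hi hF ⟨hT, hP⟩
    refine wp_store (by simp; omega) (by simp) (by simp) ?_
    simp only [Expr.eval_var, hi, Expr.eval_ofNat, State.setReg_arr, State.setCell_arr_same]
    refine ⟨by omega, fun v hv => ?_⟩
    rcases eq_or_ne v i with rfl | hne
    · simp
    · rw [Function.update_of_ne hne]
      exact hP v (by omega)
  rintro T₁ σ₁ - hF₁ ⟨hT₁, hP₁⟩
  have hN₁ : σ₁.reg N = M := hF₁.1 N (by simp [forRange, Cmd.keepsReg, hNi])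
  have hf₁ : σ₁.arr key = f := hF₁.2 key (by simp [forRange, Cmd.keepsArr, hkc])
  refine wp_seq (wp_forRange (fun i T τ => T ≤ 1 + 3 * i ∧
    ∀ a < M, τ.arr .cnt a = #{v ∈ range i | f v = a}) 0 M
    (by simp) (by simp) (Nat.zero_le _) ?_ (by simp [Cmd.keepsReg]) (by simpa using hP₁) ?_ ?_)
  · intro i T τ _ _ hi hF _
    simp [hF.1 N (by simp [forRange, Cmd.keepsReg, hNi]), hN₁]
  · rintro i T τ - hiM hi hF ⟨hT, hP⟩
    have hfτ : τ.arr key = f := (hF.2 key (by simp [forRange, Cmd.keepsArr, hkc])).trans hf₁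
    have := hlt i hiM
    refine wp_store (by simp [hi, hfτ]; omega) (by simp [hi]; omega)
      (by simp [hi, hfτ]; omega) ?_
    simp only [Expr.eval_var, hi, Expr.eval_ofNat, State.setReg_arr, State.setCell_arr_same,
      Expr.eval_get, Expr.eval_add, hfτ]
    refine ⟨by omega, fun a ha => ?_⟩
    rw [card_filter_range_succ, Function.update_apply]
    split_ifs with h₁ h₂ h₂
    · rw [hP _ this, h₁]
    · exact absurd h₁.symm h₂
    · exact absurd h₂.symm h₁
    · exact hP a ha
  rintro T₂ σ₂ - hF₂ ⟨hT₂, hP₂⟩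
  have hN₂ : σ₂.reg N = M := (hF₂.1 N (by simp [forRange, Cmd.keepsReg, hNi])).trans hN₁
  have hf₂ : σ₂.arr key = f := (hF₂.2 key (by simp [forRange, Cmd.keepsArr, hkc])).trans hf₁
  refine wp_seq (wp_assign (by simp) ?_)
  refine wp_seq (wp_forRange (fun i T τ => T ≤ 1 + 5 * i ∧
    τ.reg .s = #{v ∈ range M | f v < i} ∧
    ∀ a < i, τ.arr .bin a = #{v ∈ range M | f v < a} ∧ τ.arr .cur a = #{v ∈ range M | f v < a}) 0 M
    (by simp) (by simp) (Nat.zero_le _) ?_ (by simp [Cmd.keepsReg]) (by simp) ?_ ?_)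
  · intro i T τ _ _ hi hF _
    simp [hF.1 N (by simp [forRange, Cmd.keepsReg, hNi, hNs]), hN₂, hNs]
  · rintro i T τ - hiM hi hF ⟨hT, hs, hP⟩
    have hc : τ.arr .cnt = σ₂.arr .cnt := (hF.2 .cnt (by simp [forRange, Cmd.keepsArr]))
    refine wp_seq (wp_store (by simp; omega) (by simp) (by simp) ?_)
    refine wp_seq (wp_store (by simp; omega) (by simp) (by simp) ?_)
    refine wp_assign (by simp; omega) ?_
    simp only [Expr.eval_var, hi, State.setReg_arr, State.setCell_arr_same, State.setCell_reg, hs,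
      Expr.eval_get, Expr.eval_add, ne_eq, reduceCtorEq, not_false_eq_true, State.setReg_reg_ne,
      State.setReg_reg_same, State.setCell_arr_ne, hc, hP₂ i hiM, card_filter_lt_succ, true_and]
    refine ⟨by omega, fun a ha => ?_⟩
    simp only [Function.update_apply]
    split_ifs with h
    · simp [h]
    · exact hP a (by omega)
  rintro T₃ σ₃ - hF₃ ⟨hT₃, -, hP₃⟩
  have hN₃ : σ₃.reg N = M :=
    (hF₃.1 N (by simp [forRange, Cmd.keepsReg, hNi, hNs])).trans (by simp [hNs, hN₂])
  have hf₃ : σ₃.arr key = f := (hF₃.2 key (by simp [forRange, Cmd.keepsArr, hkb, hku])).trans hf₂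
  have hc₃ : σ₃.arr .cnt = σ₂.arr .cnt := hF₃.2 .cnt (by simp [forRange, Cmd.keepsArr])
  -- The cursor of key `a` stands at the start of its block plus the number of earlier items with
  -- that key. For item `i` it therefore points exactly to `sortPos`.
  refine wp_forRange (fun i T τ => T ≤ 1 + 4 * i ∧
    (∀ a < M, τ.arr .cur a = #{v ∈ range M | f v < a} + #{v ∈ range i | f v = a}) ∧
    ∀ v < i, τ.arr out (sortPos M f v) = v) 0 M
    (by simp) (by simp) (Nat.zero_le _) ?_ (by simp [Cmd.keepsReg])
    ⟨by omega, fun a ha => by simp [(hP₃ a ha).2], by simp⟩ ?_ ?_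
  · intro i T τ _ _ hi hF _
    simp [hF.1 N (by simp [forRange, Cmd.keepsReg, hNi]), hN₃]
  · rintro i T τ - hiM hi hF ⟨hT, hcur, hP⟩
    have hfτ : τ.arr key = f := (hF.2 key (by simp [forRange, Cmd.keepsArr, hku, hko])).trans hf₃
    have h1 := hlt i hiM
    have h2 : τ.arr .cur (f i) = sortPos M f i := by rw [hcur _ h1, sortPos]
    have h3 : sortPos M f i < M := sortPos_lt hiM
    refine wp_seq (wp_store (by simp [hi, hfτ, h2]; omega) (by simp [hi, hfτ]; omega) (by simp) ?_)
    refine wp_store (by simp [hi, hfτ, hko]; omega) (by simp [hi]; omega)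
      (by simp [hi, hfτ, hko]; omega) ?_
    simp only [Expr.eval_var, hi, State.setReg_arr, State.setCell_arr_same, State.setCell_reg,
      Expr.eval_get, Expr.eval_add, ne_eq, not_false_eq_true, hko, hfτ, hou, hou.symm,
      State.setCell_arr_ne, h2, Expr.eval_ofNat]
    refine ⟨by omega, fun a ha => ?_, fun v hv => ?_⟩
    · rw [card_filter_range_succ, Function.update_apply]
      split_ifs with h₁ h₂ h₂
      · rw [← h2, hcur _ h1, h₁, add_assoc]
      · exact absurd h₁.symm h₂
      · exact absurd h₂.symm h₁
      · exact hcur a ha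
    · rcases eq_or_ne v i with rfl | hne
      · simp
      · rw [Function.update_of_ne]
        · exact hP v (by omega)
        · exact fun h => hne (sortPos_injOn M f (by simp; omega) (by simp; omega) h)
  · rintro T₄ σ₄ - hF₄ ⟨hT₄, -, hP₄⟩
    refine ⟨by omega, fun a ha => ?_, fun a ha => ?_, sortPos M f, fun v hv => ?_, fun q hq => ?_,
      fun v hv a => sortPos_lt_iff hv a⟩
    · rw [hF₄.2 .cnt (by simp [forRange, Cmd.keepsArr, hoc.symm]), hc₃, hP₂ a ha]
    · rw [hF₄.2 .bin (by simp [forRange, Cmd.keepsArr, hob.symm]), (hP₃ a ha).1]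
    · exact ⟨sortPos_lt hv, hP₄ v hv⟩
    · obtain ⟨v, hv, rfl⟩ := exists_sortPos_eq f hq
      rw [hP₄ v hv]
      exact ⟨hv, rfl⟩

theorem keepsReg_binSort {N : Var} {key out : Arr} {z : Var} (h : z ≠ .i ∧ z ≠ .s) :
    (binSort N key out).keepsReg z := by
  simp [binSort, forRange, Cmd.keepsReg, h]

theorem keepsArr_binSort {N : Var} {key out A : Arr}
    (h : A ≠ .cnt ∧ A ≠ .bin ∧ A ≠ .cur ∧ A ≠ out) : (binSort N key out).keepsArr A := by
  simp [binSort, forRange, Cmd.keepsArr, h]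

/-! ## Adjacency arrays and core decomposition -/

/-- For `x < N`, the cells `tgt e` with `src x ≤ e < src (x + 1)` list the `y` with `R x y`. -/
structure Lists (N : ℕ) (src tgt : ℕ → ℕ) (R : ℕ → ℕ → Prop) : Prop where
  zero : src 0 = 0
  mono : ∀ x < N, src x ≤ src (x + 1)
  inj : ∀ x < N, Set.InjOn tgt (Set.Ico (src x) (src (x + 1)))
  mem : ∀ x < N, ∀ y, R x y ↔ ∃ e, src x ≤ e ∧ e < src (x + 1) ∧ tgt e = y

/-- `R` is the adjacency relation of a simple graph on the numbers below `N`. -/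
structure IsGraph (N : ℕ) (R : ℕ → ℕ → Prop) : Prop where
  symm : ∀ {x y}, R x y → R y x
  irrefl : ∀ x, ¬ R x x
  lt : ∀ {x y}, R x y → x < N

theorem IsGraph.lt' {N : ℕ} {R : ℕ → ℕ → Prop} (h : IsGraph N R) {x y : ℕ} (hxy : R x y) :
    y < N := h.lt (h.symm hxy)

theorem IsGraph.ne {N : ℕ} {R : ℕ → ℕ → Prop} (h : IsGraph N R) {x y : ℕ} (hxy : R x y) :
    x ≠ y := by
  rintro rfl
  exact h.irrefl x hxy

namespace Lists

variable {N : ℕ} {src tgt : ℕ → ℕ} {R : ℕ → ℕ → Prop}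

theorem src_le (h : Lists N src tgt R) {x y : ℕ} (hxy : x ≤ y) (hy : y ≤ N) : src x ≤ src y := by
  induction hxy with
  | refl => exact le_rfl
  | step _ ih => exact (ih (by omega)).trans (h.mono _ (by omega))

theorem rel (h : Lists N src tgt R) {x e : ℕ} (hx : x < N) (h₁ : src x ≤ e)
    (h₂ : e < src (x + 1)) : R x (tgt e) := (h.mem x hx _).2 ⟨e, h₁, h₂, rfl⟩

theorem degree [DecidableRel R] (h : Lists N src tgt R) (hR : ∀ {x y}, R x y → y < N) {x : ℕ}
    (hx : x < N) : #{y ∈ range N | R x y} = src (x + 1) - src x := by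
  rw [← Nat.card_Ico, ← card_image_of_injOn (s := Ico (src x) (src (x + 1))) (f := tgt)
    (by simpa using h.inj x hx)]
  congr 1
  ext y
  simp only [mem_filter, mem_range, h.mem x hx, mem_image, mem_Ico, and_assoc]
  constructor
  · exact fun h => h.2
  · rintro hy
    exact ⟨hR ((h.mem x hx y).2 hy), hy⟩

theorem sum_degree [DecidableRel R] (h : Lists N src tgt R) (hR : ∀ {x y}, R x y → y < N) :
    ∑ x ∈ range N, #{y ∈ range N | R x y} = src N := by
  have : ∀ M ≤ N, ∑ x ∈ range M, #{y ∈ range N | R x y} = src M := by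
    intro M hM
    induction M with
    | zero => simp [h.zero]
    | succ M ih =>
      rw [sum_range_succ, ih (by omega), h.degree hR (by omega)]
      have := h.mono M (by omega)
      omega
  exact this N le_rfl

end Lists

/-! ### Core sets and the invariants of the peeling process -/

/-- The finite set `W` is a `t`-core: every element of `W` has at least `t` neighbours in `W`. -/
def IsCoreSet {α : Type*} (R : α → α → Prop) [DecidableRel R] (t : ℕ) (W : Finset α) : Prop :=
  ∀ w ∈ W, t ≤ #{z ∈ W | R w z}

theorem IsCoreSet.anti {α : Type*} {R : α → α → Prop} [DecidableRel R] {s t : ℕ} {W : Finset α}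
    (h : IsCoreSet R t W) (hst : s ≤ t) : IsCoreSet R s W := fun w hw => hst.trans (h w hw)

/-- The coreness of `x` in the graph with the adjacency relation `R` is `a`. -/
def HasCoreness {α : Type*} (R : α → α → Prop) [DecidableRel R] (x : α) (a : ℕ) : Prop :=
  ∀ t, t ≤ a ↔ ∃ W : Finset α, x ∈ W ∧ IsCoreSet R t W

theorem HasCoreness.le_card {α : Type*} {R : α → α → Prop} [DecidableRel R] {x : α} {a : ℕ}
    (h : HasCoreness R x a) (s : Finset α) (hs : ∀ y, R x y → y ∈ s) : a ≤ #{y ∈ s | R x y} := by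
  obtain ⟨W, hx, hW⟩ := (h a).1 le_rfl
  refine (hW x hx).trans (card_le_card fun y => ?_)
  simp only [mem_filter]
  exact fun h => ⟨hs y h.2, h.2⟩

/-- The invariant on the vertices sorted by degree; only the bins from `t` on are maintained. -/
structure BinInv (N t : ℕ) (vert pos deg bin : ℕ → ℕ) : Prop where
  pos_lt : ∀ x < N, pos x < N ∧ vert (pos x) = x
  vert_lt : ∀ q < N, vert q < N ∧ pos (vert q) = q
  bin_iff : ∀ a, t ≤ a → a < N → ∀ x < N, pos x < bin a ↔ deg x < a
  deg_lt : ∀ x < N, deg x < N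

namespace BinInv

variable {N t : ℕ} {vert pos deg bin : ℕ → ℕ}

theorem bin_le (h : BinInv N t vert pos deg bin) {y : ℕ} (hy : y < N) (hty : t ≤ deg y) :
    bin (deg y) ≤ pos y := by
  have := (h.bin_iff (deg y) hty (h.deg_lt y hy) y hy).not
  omega

theorem bin_lt (h : BinInv N t vert pos deg bin) {y : ℕ} (hy : y < N) (hty : t ≤ deg y) :
    bin (deg y) < N := (h.bin_le hy hty).trans_lt (h.pos_lt y hy).1

/-- The vertex at the first place of the bin is not before that bin, and it is not after `y`, which
precedes the next bin. If `deg y + 1 = N` there is no next bin, but then the general bound on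
degrees suffices. -/
theorem deg_first (h : BinInv N t vert pos deg bin) {y : ℕ} (hy : y < N) (hty : t ≤ deg y) :
    deg (vert (bin (deg y))) = deg y := by
  have h1 := h.bin_le hy hty
  obtain ⟨h2, h3⟩ := h.vert_lt _ (h.bin_lt hy hty)
  set w := vert (bin (deg y))
  have h4 := h.bin_iff (deg y) hty (h.deg_lt y hy) w h2
  have h5 := h.deg_lt w h2
  by_cases h6 : deg y + 1 < N
  · have h7 := h.bin_iff _ (hty.trans (Nat.le_succ _)) h6 w h2
    have h8 := h.bin_iff _ (hty.trans (Nat.le_succ _)) h6 y hy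
    omega
  · omega

/-- Both vertices that are exchanged have degree at least `t`, so neither lies among the first `l`
places, whose vertices have degree below `t`. -/
theorem unchanged_iff (h : BinInv N t vert pos deg bin) {y : ℕ} (hy : y < N) (hty : t ≤ deg y)
    {l : ℕ} (hl : ∀ x < N, pos x < l → deg x < t) {x : ℕ} (hx : x < N) :
    Function.update (Function.update pos (vert (bin (deg y))) (pos y)) y (bin (deg y)) x < l ↔
      pos x < l := by
  obtain ⟨h2, h3⟩ := h.vert_lt _ (h.bin_lt hy hty)
  have h4 := h.deg_first hy hty
  have h5 := hl _ h2
  have h6 := hl _ hy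
  simp only [Function.update_apply]
  split_ifs with e₁ e₂
  · subst e₁
    omega
  · subst e₂
    omega
  · rfl

/-- After the exchange `y` is first in its bin, and moving the boundary by one place puts it into
the bin below. Only the boundary at `deg y` changes. The new degree may be `t - 1`, where bins are
no longer maintained. -/
theorem decrease (h : BinInv N t vert pos deg bin) {y : ℕ} (hy : y < N) (hty : t ≤ deg y)
    (ht : 1 ≤ t) :
    BinInv N t
      (Function.update (Function.update vert (pos y) (vert (bin (deg y)))) (bin (deg y)) y)
      (Function.update (Function.update pos (vert (bin (deg y))) (pos y)) y (bin (deg y)))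
      (Function.update deg y (deg y - 1))
      (Function.update bin (deg y) (bin (deg y) + 1)) := by
  obtain ⟨h2, h3⟩ := h.vert_lt _ (h.bin_lt hy hty)
  have h1 := h.bin_le hy hty
  have h0 := h.bin_lt hy hty
  have h4 := h.deg_first hy hty
  obtain ⟨h5, h6⟩ := h.pos_lt y hy
  have hd := h.deg_lt y hy
  set p := bin (deg y) with hp
  set w := vert p with hw
  refine ⟨fun x hx => ?_, fun q hq => ?_, fun a hta ha x hx => ?_, fun x hx => ?_⟩
  · simp only [Function.update_apply]
    obtain ⟨h7, h8⟩ := h.pos_lt x hx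
    by_cases e₁ : x = y
    · simp [e₁, h0]
    by_cases e₂ : x = w
    · have e₃ : pos y ≠ p := fun he => e₁ (by rw [← h8, ← h6, he, e₂, h3])
      rw [if_neg e₁, if_pos e₂, if_neg e₃, if_pos rfl]
      exact ⟨h5, e₂.symm⟩
    · simp only [e₁, e₂, if_false, h7, true_and]
      rw [if_neg, if_neg, h8]
      · intro he
        exact e₁ (by rw [← h8, he, h6])
      · intro he
        exact e₂ (by rw [← h8, he])
  · simp only [Function.update_apply]
    obtain ⟨h7, h8⟩ := h.vert_lt q hq
    by_cases e₁ : q = p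
    · simp [e₁, hy]
    by_cases e₂ : q = pos y
    · simp only [e₂, if_true]
      rw [if_neg (by omega)]
      refine ⟨h2, ?_⟩
      split_ifs with e₃
      · rw [← h3, e₃]
      · rfl
    · simp only [e₁, e₂, if_false, h7, true_and]
      rw [if_neg, if_neg, h8]
      · intro he
        exact e₁ (by rw [← h8, he, h3])
      · intro he
        exact e₂ (by rw [← h8, he])
  · have hx' := h.bin_iff a hta ha x hx
    have hy' := h.bin_iff a hta ha y hy
    have hw' := h.bin_iff a hta ha w h2
    have hxp : pos x = p → x = w := fun he => by rw [← (h.pos_lt x hx).2, he]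
    have hyw : pos y = p → y = w := fun he => by rw [← h6, he]
    simp only [Function.update_apply]
    by_cases e₁ : x = y
    · subst e₁
      simp only [if_true]
      by_cases e₃ : a = deg x
      · simp only [e₃, if_true]
        omega
      · simp only [e₃, if_false]
        omega
    by_cases e₂ : x = w
    · subst e₂
      have : pos y ≠ p := fun he => e₁ (hyw he).symm
      by_cases e₃ : a = deg y
      · simp only [e₁, e₃, if_true, if_false]
        omega
      · simp only [e₁, e₃, if_true, if_false]
        omega
    · have : pos x ≠ p := fun he => e₂ (hxp he)
      by_cases e₃ : a = deg y
      · subst e₃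
        simp only [e₁, e₂, if_true, if_false]
        omega
      · simp only [e₁, e₂, e₃, if_false]
        exact hx'
  · simp only [Function.update_apply]
    split_ifs
    · omega
    · exact h.deg_lt x hx

end BinInv

/-- The invariant on the current degrees: `d x` is the degree of `x` in the current graph unless it
has fallen below `t`. -/
def DegInv (t : ℕ) (U : Finset ℕ) (deg d : ℕ → ℕ) : Prop :=
  ∀ x ∈ U, (t ≤ deg x → deg x = d x) ∧ (deg x < t → d x < t)

/-- The invariant of the core decomposition at the level `t`, with the set `U` of the vertices that
have not been removed. -/
structure CoreInv (N : ℕ) (R : ℕ → ℕ → Prop) [DecidableRel R] (t i : ℕ) (U : Finset ℕ)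
    (vert pos deg bin res : ℕ → ℕ) : Prop where
  bins : BinInv N t vert pos deg bin
  one_le : 1 ≤ t
  le : t ≤ N + 1
  mem : ∀ x, x ∈ U ↔ x < N ∧ i ≤ pos x
  removed : ∀ x < N, pos x < i → deg x < t ∧ HasCoreness R x (res x)
  degs : DegInv t U deg fun x => #{y ∈ U | R x y}
  upper : ∀ W, IsCoreSet R t W → W ⊆ U
  lower : ∀ x ∈ U, ∃ W, x ∈ W ∧ IsCoreSet R (t - 1) W

namespace CoreInv

variable {N : ℕ} {R : ℕ → ℕ → Prop} [DecidableRel R] {t i : ℕ} {U : Finset ℕ}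
  {vert pos deg bin res : ℕ → ℕ}

/-- The order by degree passes the bound `t` on from the first remaining vertex to all of them. The
remaining set is thus itself a `t`-core, which is the witness for `lower` at the next level. -/
theorem increase (h : CoreInv N R t i U vert pos deg bin res) (hi : i < N)
    (ht : t ≤ deg (vert i)) : CoreInv N R (t + 1) i U vert pos deg bin res ∧ t < N := by
  obtain ⟨hv, hp⟩ := h.bins.vert_lt i hi
  have htN : t < N := ht.trans_lt (h.bins.deg_lt _ hv)
  have key : ∀ x ∈ U, t ≤ deg x := by
    intro x hx
    obtain ⟨hx, hix⟩ := (h.mem x).1 hx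
    have h1 := h.bins.bin_iff t le_rfl htN x hx
    have h2 := h.bins.bin_iff t le_rfl htN _ hv
    omega
  refine ⟨⟨⟨h.bins.pos_lt, h.bins.vert_lt, fun a ha => h.bins.bin_iff a (by omega), h.bins.deg_lt⟩, by omega,
    by omega, h.mem, fun x hx hxi => ?_, fun x hx => ?_, fun W hW => h.upper W (hW.anti (by omega)),
    fun x hx => ⟨U, hx, fun y hy => ?_⟩⟩, htN⟩
  · exact ⟨(h.removed x hx hxi).1.trans (Nat.lt_succ_self t), (h.removed x hx hxi).2⟩
  · have := (h.degs x hx).1 (key x hx)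
    exact ⟨fun _ => this, fun h => this ▸ h⟩
  · have h1 : deg y = #{z ∈ U | R y z} := (h.degs y hy).1 (key y hy)
    have h2 := key y hy
    simp only [add_tsub_cancel_right]
    omega

/-- The invariant `lower` gives coreness at least `t - 1`. A `t`-core through `x` would lie in `U`
by `upper` and give `x` at least `t` neighbours there. -/
theorem hasCoreness (h : CoreInv N R t i U vert pos deg bin res) {x : ℕ} (hx : x ∈ U)
    (hdx : deg x < t) : HasCoreness R x (t - 1) := by
  intro s
  constructor
  · intro hs
    obtain ⟨W, hW, hc⟩ := h.lower x hx
    exact ⟨W, hW, hc.anti hs⟩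
  · rintro ⟨W, hW, hc⟩
    by_contra! hs
    have h1 := h.upper W (hc.anti (by omega))
    have h2 : #{y ∈ U | R x y} < t := (h.degs x hx).2 hdx
    have h3 := hc x hW
    have h4 := card_le_card (filter_subset_filter (fun y => R x y) h1)
    omega

end CoreInv

theorem sum_range_filter_insert {U : Finset ℕ} {x : ℕ} (hx : x ∈ U) (f : ℕ → ℕ) :
    ∑ y ∈ U.erase x, f y + f x = ∑ y ∈ U, f y := sum_erase_add _ _ hx

theorem card_filter_erase {α : Type*} [DecidableEq α] {U : Finset α} {x : α} (hx : x ∈ U)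
    (p : α → Prop) [DecidablePred p] :
    #{y ∈ U | p y} = #{y ∈ U.erase x | p y} + if p x then 1 else 0 := by
  rw [filter_erase]
  split_ifs with h
  · rw [card_erase_add_one (by simp [hx, h])]
  · rw [erase_eq_of_notMem (by simp [h]), add_zero]

theorem wp_coreDecomposition {K : ℕ} {N : Var} {src tgt res : Arr} {σ : State}
    {R : ℕ → ℕ → Prop} [DecidableRel R]
    (hN : N ≠ .i ∧ N ≠ .s ∧ N ≠ .t ∧ N ≠ .x ∧ N ≠ .e ∧ N ≠ .y ∧ N ≠ .p ∧ N ≠ .w)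
    (hsrc : src ≠ .cnt ∧ src ≠ .bin ∧ src ≠ .cur ∧ src ≠ .vert ∧ src ≠ .pos ∧ src ≠ .deg ∧
      src ≠ res)
    (htgt : tgt ≠ .cnt ∧ tgt ≠ .bin ∧ tgt ≠ .cur ∧ tgt ≠ .vert ∧ tgt ≠ .pos ∧ tgt ≠ .deg ∧
      tgt ≠ res)
    (hres : res ≠ .cnt ∧ res ≠ .bin ∧ res ≠ .cur ∧ res ≠ .vert ∧ res ≠ .pos ∧ res ≠ .deg)
    (hL : Lists (σ.reg N) (σ.arr src) (σ.arr tgt) R) (hR : IsGraph (σ.reg N) R)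
    (hK : σ.reg N < K) (hK' : σ.arr src (σ.reg N) ≤ K) :
    wp K (coreDecomposition N src tgt res) (fun T τ =>
      T ≤ 40 * σ.reg N + 20 * σ.arr src (σ.reg N) + 60 ∧
      ∀ x < σ.reg N, HasCoreness R x (τ.arr res x)) σ := by
  obtain ⟨n1, n2, n3, n4, n5, n6, n7, n8⟩ := hN
  obtain ⟨s1, s2, s3, s4, s5, s6, s7⟩ := hsrc
  obtain ⟨t1, t2, t3, t4, t5, t6, t7⟩ := htgt
  obtain ⟨r1, r2, r3, r4, r5, r6⟩ := hres
  generalize hM : σ.reg N = M at *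
  generalize hf : σ.arr src = f at *
  generalize hg : σ.arr tgt = g at *
  unfold coreDecomposition
  -- the degrees
  refine wp_seq (wp_forRange (fun i T τ => T ≤ 1 + 3 * i ∧
    ∀ v < i, τ.arr .deg v = f (v + 1) - f v) 0 M (by simp) (by simp) (Nat.zero_le _) ?_
    (by simp [Cmd.keepsReg]) (by simp) ?_ ?_)
  · intro i T τ _ _ hi hF _
    simp [hF.1 N (by simp [forRange, Cmd.keepsReg, n1]), hM]
  · rintro i T τ - hiM hi hF ⟨hT, hP⟩
    have hfτ : τ.arr src = f := (hF.2 src (by simp [forRange, Cmd.keepsArr, s6])).trans hf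
    refine wp_store (by simp; omega) (by simp) (by simp [hi]; omega) ?_
    simp only [Expr.eval_var, hi, Expr.eval_ofNat, State.setReg_arr, State.setCell_arr_same,
      Expr.eval_sub, Expr.eval_get, Expr.eval_add, hfτ]
    refine ⟨by omega, fun v hv => ?_⟩
    rcases eq_or_ne v i with rfl | hne
    · simp
    · rw [Function.update_of_ne hne]
      exact hP v (by omega)
  rintro T₁ σ₁ - hF₁ ⟨hT₁, hP₁⟩
  have hN₁ : σ₁.reg N = M := (hF₁.1 N (by simp [forRange, Cmd.keepsReg, n1])).trans hM
  have hf₁ : σ₁.arr src = f := (hF₁.2 src (by simp [forRange, Cmd.keepsArr, s6])).trans hf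
  have hg₁ : σ₁.arr tgt = g := (hF₁.2 tgt (by simp [forRange, Cmd.keepsArr, t6])).trans hg
  have hdeg : ∀ v < M, σ₁.arr .deg v = #{y ∈ range M | R v y} := fun v hv => by
    rw [hP₁ v hv, hL.degree hR.lt' hv]
  have hdlt : ∀ v < M, σ₁.arr .deg v < M := fun v hv => by
    rw [hdeg v hv]
    have h1 : #{y ∈ range M | R v y} < #(range M) := card_lt_card <| by
      rw [ssubset_iff_of_subset (filter_subset _ _)]
      exact ⟨v, by simpa using hv, by simp [hR.irrefl v]⟩
    simpa using h1
  -- bin sort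
  refine wp_seq ((wp_binSort ⟨n1, n2⟩ (by simp) (by simp) (by omega)
    (by simpa [hN₁] using hdlt)).mono ?_)
  rw [hN₁]
  rintro T₂ σ₂ hF₂ ⟨hT₂, -, hb₂, pos, hpos, hvert, hiff⟩
  have hN₂ : σ₂.reg N = M := (hF₂.1 N (keepsReg_binSort ⟨n1, n2⟩)).trans hN₁
  have hf₂ : σ₂.arr src = f := (hF₂.2 src (keepsArr_binSort ⟨s1, s2, s3, s4⟩)).trans hf₁
  have hg₂ : σ₂.arr tgt = g := (hF₂.2 tgt (keepsArr_binSort ⟨t1, t2, t3, t4⟩)).trans hg₁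
  have hd₂ : σ₂.arr .deg = σ₁.arr .deg := hF₂.2 _ (keepsArr_binSort (by simp))
  refine wp_seq (wp_forRange (fun i T τ => T ≤ 1 + 3 * i ∧
    ∀ v < M, pos v < i → τ.arr .pos v = pos v) 0 M (by simp) (by simp) (Nat.zero_le _) ?_
    (by simp [Cmd.keepsReg]) (by simp) ?_ ?_)
  · intro i T τ _ _ hi hF _
    simp [hF.1 N (by simp [forRange, Cmd.keepsReg, n1]), hN₂]
  · rintro i T τ - hiM hi hF ⟨hT, hP⟩
    have hv : τ.arr .vert = σ₂.arr .vert := hF.2 _ (by simp [forRange, Cmd.keepsArr])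
    obtain ⟨h1, h2⟩ := hvert i hiM
    refine wp_store (by simp [hi, hv]; omega) (by simp [hi]; omega) (by simp) ?_
    simp only [Expr.eval_var, hi, Expr.eval_get, State.setReg_arr, State.setCell_arr_same, hv]
    refine ⟨by omega, fun v hvM hlt => ?_⟩
    rcases eq_or_ne v (σ₂.arr .vert i) with rfl | hne
    · simp [h2]
    · rw [Function.update_of_ne hne]
      refine hP v hvM (lt_of_le_of_ne (by omega) fun he => hne ?_)
      rw [← he, (hpos v hvM).2]
  rintro T₃ σ₃ - hF₃ ⟨hT₃, hP₃⟩
  have hN₃ : σ₃.reg N = M := (hF₃.1 N (by simp [forRange, Cmd.keepsReg, n1])).trans hN₂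
  have hf₃ : σ₃.arr src = f := (hF₃.2 src (by simp [forRange, Cmd.keepsArr, s5])).trans hf₂
  have hg₃ : σ₃.arr tgt = g := (hF₃.2 tgt (by simp [forRange, Cmd.keepsArr, t5])).trans hg₂
  have hd₃ : σ₃.arr .deg = σ₁.arr .deg :=
    (hF₃.2 .deg (by simp [forRange, Cmd.keepsArr])).trans hd₂
  have hv₃ : σ₃.arr .vert = σ₂.arr .vert := hF₃.2 _ (by simp [forRange, Cmd.keepsArr])
  have hb₃ : σ₃.arr .bin = σ₂.arr .bin := hF₃.2 _ (by simp [forRange, Cmd.keepsArr])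
  have hp₃ : ∀ v < M, σ₃.arr .pos v = pos v := fun v hv => hP₃ v hv (hpos v hv).1
  refine wp_seq (wp_assign (by simp) (wp_seq (wp_assign (by simp) ?_)))
  -- the removal of the vertices
  have hI : CoreInv M R 1 0 (range M) (σ₃.arr .vert) (σ₃.arr .pos) (σ₃.arr .deg) (σ₃.arr .bin)
      (σ₃.arr res) := by
    -- At `t = 1` a singleton serves as the `0`-core for `lower`, and the vertices of a `1`-core
    -- have neighbours, so they are genuine vertices.
    refine ⟨⟨fun x hx => ?_, fun q hq => ?_, fun a _ ha x hx => ?_, fun x hx => ?_⟩, le_rfl,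
      by omega, by simp, by simp, fun x hx => ?_, fun W hW w hw => ?_, fun x hx => ⟨{x}, by simp,
        by simp [IsCoreSet]⟩⟩
    · rw [hp₃ x hx, hv₃]
      exact hpos x hx
    · rw [hv₃, hp₃ _ (hvert q hq).1]
      exact hvert q hq
    · rw [hp₃ x hx, hb₃, hb₂ a ha, hd₃]
      exact hiff x hx a
    · rw [hd₃]
      exact hdlt x hx
    · rw [hd₃, hdeg x (by simpa using hx)]
      exact ⟨fun _ => rfl, fun h => h⟩
    · obtain ⟨z, hz⟩ := card_pos.1 (hW w hw)
      exact mem_range.2 (hR.lt (mem_filter.1 hz).2)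
  -- A potential bounds the time: each list entry of a remaining vertex holds 14 units, each place
  -- not yet passed 10, and each level not yet reached 4.
  refine wp_loop (fun T τ => ∃ U, CoreInv M R (τ.reg .t) (τ.reg .i) U (τ.arr .vert) (τ.arr .pos)
      (τ.arr .deg) (τ.arr .bin) (τ.arr res) ∧ τ.reg .i ≤ M ∧
      T + (14 * ∑ x ∈ U, (f (x + 1) - f x) + 10 * (M - τ.reg .i) + 4 * (M + 1 - τ.reg .t)) ≤
        14 * f M + 14 * M + 4)
    (fun τ => (M - τ.reg .i) + (M + 1 - τ.reg .t)) ?_ ?_ ?_ ?_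
  · refine ⟨range M, by simpa using hI, by simp, ?_⟩
    have : ∑ x ∈ range M, (f (x + 1) - f x) = f M := by
      rw [← hL.sum_degree hR.lt']
      exact sum_congr rfl fun x hx => (hL.degree hR.lt' (mem_range.1 hx)).symm
    rw [this]
    simp
    omega
  · rintro T τ hF ⟨U, hU, -⟩
    have hNτ : τ.reg N = M :=
      (hF.1 N (by simp [forRange, Cmd.keepsReg, *])).trans (by simp [hN₃, n1, n3])
    simp
  · rintro T τ hF ⟨U, hU, hiM, hT⟩ hlt
    have hNτ : τ.reg N = M :=
      (hF.1 N (by simp [forRange, Cmd.keepsReg, *])).trans (by simp [hN₃, n1, n3])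
    have hfτ : τ.arr src = f :=
      (hF.2 src (by simp [forRange, Cmd.keepsArr, *])).trans (by simp [hf₃])
    have hgτ : τ.arr tgt = g :=
      (hF.2 tgt (by simp [forRange, Cmd.keepsArr, *])).trans (by simp [hg₃])
    generalize hi : τ.reg .i = i at *
    generalize ht : τ.reg .t = t at *
    have hlt' : i < M := by simpa [hi, hNτ] using hlt
    obtain ⟨hv, hp⟩ := hU.bins.vert_lt i hlt'
    refine wp_branch (by simp [hi]; omega) ?_ ?_
    · intro hdx
      generalize hx : τ.arr .vert i = x at *
      have hdx' : τ.arr .deg x < t := by simpa [hi, hx, ht] using hdx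
      have hxU : x ∈ U := (hU.mem x).2 ⟨hv, by omega⟩
      have hcx := hU.hasCoreness hxU hdx'
      have hmem : ∀ z, z ∈ U.erase x ↔ z < M ∧ i + 1 ≤ τ.arr .pos z := by
        intro z
        rw [mem_erase, hU.mem]
        constructor
        · rintro ⟨h1, h2, h3⟩
          refine ⟨h2, lt_of_le_of_ne h3 fun he => h1 ?_⟩
          rw [← hx, he, (hU.bins.pos_lt z h2).2]
        · rintro ⟨h1, h2⟩
          exact ⟨by rintro rfl; omega, h1, by omega⟩
      refine wp_seq (wp_assign (by simp [hi]; omega) ?_)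
      refine wp_seq (wp_store (by simp [hi, hx]; omega) (by simp) (by simp) ?_)
      simp only [Expr.eval_var, Expr.eval_get, hi, hx, Expr.eval_sub, Expr.eval_ofNat, ne_eq,
        reduceCtorEq, not_false_eq_true, State.setReg_reg_ne, ht, State.setReg_reg_same]
      generalize hτ' : (τ.setReg Var.x x).setCell res x (t - 1) = τ'
      have hτr : ∀ z, z ≠ .x → τ'.reg z = τ.reg z := fun z hz => by simp [← hτ', hz]
      have hτa : ∀ A, A ≠ res → τ'.arr A = τ.arr A := fun A hA => by simp [← hτ', hA]
      have hxτ : τ'.reg .x = x := by simp [← hτ']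
      have htτ : τ'.reg .t = t := by rw [hτr _ (by simp), ht]
      -- While the list of `x` is scanned, the neighbours not yet met still count their edge to `x`;
      -- this is the extra 0 or 1 in the degree. Degrees below `t` are no longer updated, so the
      -- stored values are exact only from `t` on.
      refine wp_seq (wp_forRange (fun e T τ₁ => T ≤ 1 + 12 * (e - f x) ∧
        BinInv M t (τ₁.arr .vert) (τ₁.arr .pos) (τ₁.arr .deg) (τ₁.arr .bin) ∧
        (∀ z < M, τ₁.arr .pos z < i + 1 ↔ τ.arr .pos z < i + 1) ∧
        (∀ z < M, τ.arr .pos z < i + 1 → τ₁.arr .deg z < t) ∧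
        DegInv t (U.erase x) (τ₁.arr .deg) fun z => #{y ∈ U.erase x | R z y} +
          if z ∈ (Ico e (f (x + 1))).image g then 1 else 0) (f x) (f (x + 1))
        (by simp [hxτ]; omega) (by simp [hxτ, hτa src s7, hfτ]) (hL.mono x hv) ?_
        (by simp [Cmd.keepsReg]) ?_ ?_ ?_)
      · intro e T₁ τ₁ _ _ _ hF₁ _
        have h1 : τ₁.reg .x = x := (hF₁.1 .x (by simp [forRange, Cmd.keepsReg])).trans hxτ
        have h2 : τ₁.arr src = f :=
          (hF₁.2 src (by simp [forRange, Cmd.keepsArr, *])).trans (by rw [hτa src s7, hfτ])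
        simp [h1, h2]
        omega
      · simp only [State.setReg_arr, hτa _ r4.symm, hτa _ r5.symm, hτa _ r6.symm, hτa _ r2.symm]
        refine ⟨by omega, hU.bins, by simp, fun z hz hlt => ?_, fun z hz => ?_⟩
        · rcases Nat.lt_succ_iff_lt_or_eq.1 hlt with h | h
          · exact (hU.removed z hz h).1
          · rwa [show z = x by rw [← hx, ← h, (hU.bins.pos_lt z hz).2]]
        · have h1 := hU.degs z (mem_of_mem_erase hz)
          have h2 : z ∈ (Ico (f x) (f (x + 1))).image g ↔ R z x := by
            rw [show R z x ↔ R x z from ⟨hR.symm, hR.symm⟩, hL.mem x hv]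
            simp [and_assoc]
          simp only [card_filter_erase hxU] at h1
          simpa only [h2] using h1
      · rintro e T₁ τ₁ he₁ he₂ he hF₁ ⟨hT₁, hB, hpos₁, hrem, hD⟩
        have h1 : τ₁.reg .t = t := (hF₁.1 .t (by simp [forRange, Cmd.keepsReg])).trans htτ
        have h2 : τ₁.arr tgt = g :=
          (hF₁.2 tgt (by simp [forRange, Cmd.keepsArr, *])).trans (by rw [hτa tgt t7, hgτ])
        have h3 : e < K := he₂.trans_le ((hL.src_le (Nat.succ_le_of_lt hv) le_rfl).trans hK')
        have hxy : R x (g e) := hL.rel hv he₁ he₂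
        have hy : g e < M := hR.lt' hxy
        have hsplit : ∀ z, z ∈ (Ico e (f (x + 1))).image g ↔
            z = g e ∨ z ∈ (Ico (e + 1) (f (x + 1))).image g := by
          intro z
          simp only [mem_image, mem_Ico]
          constructor
          · rintro ⟨e', ⟨h4, h5⟩, rfl⟩
            rcases h4.eq_or_lt with rfl | h4
            · exact .inl rfl
            · exact .inr ⟨e', ⟨h4, h5⟩, rfl⟩
          · rintro (rfl | ⟨e', ⟨h4, h5⟩, rfl⟩)
            · exact ⟨e, ⟨le_rfl, he₂⟩, rfl⟩
            · exact ⟨e', ⟨by omega, h5⟩, rfl⟩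
        -- The list has no repetitions, so the correction for this neighbour disappears for good at
        -- this entry.
        have hnot : g e ∉ (Ico (e + 1) (f (x + 1))).image g := by
          intro h4
          obtain ⟨e', h4, h5⟩ := mem_image.1 h4
          rw [mem_Ico] at h4
          have := hL.inj x hv ⟨by omega, h4.2⟩ ⟨he₁, he₂⟩ h5
          omega
        refine wp_seq (wp_assign (by simp [he, h3]) ?_)
        simp only [Expr.eval_get, Expr.eval_var, he, h2]
        generalize g e = y at *
        refine wp_branch (by simp; omega) ?_ ?_
        · intro hty
          have hty : t ≤ τ₁.arr .deg y := by simpa [h1] using hty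
          have hbK := hB.bin_lt hy hty
          have hdK := hB.deg_lt y hy
          have hwK := (hB.vert_lt _ hbK).1
          have hpK := (hB.pos_lt y hy).1
          refine wp_seq (wp_assign (by simp; omega) ?_)
          refine wp_seq (wp_assign (by simp; omega) ?_)
          refine wp_seq (wp_store (by simp; omega) (by simp; omega) (by simp) ?_)
          refine wp_seq (wp_store (by simp; omega) (by simp) (by simp; omega) ?_)
          refine wp_seq (wp_store (by simp; omega) (by simp) (by simp) ?_)
          refine wp_seq (wp_store (by simp; omega) (by simp) (by simp) ?_)
          refine wp_seq (wp_store (by simp; omega) (by simp; omega) (by simp) ?_)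
          refine wp_store (by simp; omega) (by simp) (by simp; omega) ?_
          simp only [Expr.eval_var, Expr.eval_get, Expr.eval_sub, Expr.eval_add, Expr.eval_ofNat,
            ne_eq, reduceCtorEq, not_false_eq_true, State.setReg_reg_ne, State.setReg_reg_same,
            State.setReg_arr, State.setCell_reg, State.setCell_arr_same, State.setCell_arr_ne]
          have hlow : ∀ z < M, τ₁.arr .pos z < i + 1 → τ₁.arr .deg z < t :=
            fun z hz h => hrem z hz ((hpos₁ z hz).1 h)
          refine ⟨by omega, hB.decrease hy hty hU.one_le, fun z hz => ?_, fun z hz h => ?_,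
            fun z hz => ?_⟩
          · rw [hB.unchanged_iff hy hty hlow hz]
            exact hpos₁ z hz
          · have := hrem z hz h
            rw [Function.update_apply]
            split_ifs with hzy
            · subst hzy
              omega
            · exact this
          · have h4 := hD z hz
            dsimp only at h4 ⊢
            rcases eq_or_ne z y with rfl | hzy
            · rw [Function.update_self]
              rw [if_pos ((hsplit z).2 (.inl rfl))] at h4
              rw [if_neg hnot]
              have := h4.1 hty
              have := hU.one_le
              exact ⟨fun _ => by omega, fun _ => by omega⟩
            · rw [if_congr ((hsplit z).trans (or_iff_right hzy)) rfl rfl] at h4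
              simpa only [Function.update_of_ne hzy] using h4
        · intro hty
          have hty : τ₁.arr .deg y < t := by simpa [h1] using hty
          refine wp_skip ?_
          simp only [State.setReg_arr]
          refine ⟨by omega, hB, hpos₁, hrem, fun z hz => ?_⟩
          have h4 := hD z hz
          dsimp only at h4 ⊢
          rcases eq_or_ne z y with rfl | hzy
          · rw [if_pos ((hsplit z).2 (.inl rfl))] at h4
            rw [if_neg hnot]
            have := h4.2 hty
            exact ⟨fun _ => by omega, fun _ => by omega⟩
          · rwa [if_congr ((hsplit z).trans (or_iff_right hzy)) rfl rfl] at h4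
      · rintro T₁ τ₁ - hF₁ ⟨hT₁, hB, hpos₁, hrem, hD⟩
        have h1 : τ₁.reg .t = t := (hF₁.1 .t (by simp [forRange, Cmd.keepsReg])).trans htτ
        have h2 : τ₁.reg .i = i :=
          (hF₁.1 .i (by simp [forRange, Cmd.keepsReg])).trans (by rw [hτr _ (by simp), hi])
        have h3 : τ₁.arr res = Function.update (τ.arr res) x (t - 1) :=
          (hF₁.2 res (by simp [forRange, Cmd.keepsArr, *])).trans (by simp [← hτ'])
        refine wp_assign (by simp) ?_
        simp only [Expr.eval_var, Expr.eval_add, Expr.eval_ofNat, ne_eq, reduceCtorEq,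
          not_false_eq_true, State.setReg_reg_ne, State.setReg_reg_same, State.setReg_arr, h1, h2,
          h3]
        refine ⟨⟨U.erase x, ⟨hB, hU.one_le, hU.le, fun z => ?_, fun z hz hzi => ?_, by simpa using hD,
          fun W hW z hz => ?_, fun z hz => hU.lower z (mem_of_mem_erase hz)⟩, by omega, ?_⟩,
          by omega⟩
        · rw [hmem z]
          refine and_congr_right fun hz => ?_
          have := hpos₁ z hz
          omega
        · have hzi := (hpos₁ z hz).1 hzi
          refine ⟨hrem z hz hzi, ?_⟩
          rcases Nat.lt_succ_iff_lt_or_eq.1 hzi with h | h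
          · rw [Function.update_of_ne]
            · exact (hU.removed z hz h).2
            · rintro rfl
              omega
          · rw [show z = x by rw [← hx, ← h, (hU.bins.pos_lt z hz).2], Function.update_self]
            exact hcx
        -- The removed vertex has coreness `t - 1 < t`, hence it lies in no `t`-core.
        · refine mem_erase.2 ⟨?_, hU.upper W hW hz⟩
          rintro rfl
          have h4 := hU.one_le
          have h5 := (hcx t).2 ⟨W, hz, hW⟩
          omega
        · have h4 := sum_range_filter_insert hxU (fun x => f (x + 1) - f x)
          omega
    · intro hdx
      have hdx' : t ≤ τ.arr .deg (τ.arr .vert i) := by simpa [hi, ht] using hdx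
      obtain ⟨h1, h2⟩ := hU.increase hlt' hdx'
      refine wp_assign (by simp) ?_
      simp only [Expr.eval_var, Expr.eval_add, Expr.eval_ofNat, ne_eq, reduceCtorEq,
          not_false_eq_true, State.setReg_reg_ne, State.setReg_reg_same, State.setReg_arr, hi, ht]
      exact ⟨⟨U, h1, hiM, by omega⟩, by omega⟩
  · rintro T τ hF ⟨U, hU, hiM, hT⟩ hge
    have hNτ : τ.reg N = M :=
      (hF.1 N (by simp [forRange, Cmd.keepsReg, *])).trans (by simp [hN₃, n1, n3])
    have hge' : M ≤ τ.reg .i := by simpa [hNτ] using hge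
    refine ⟨by omega, fun x hx => (hU.removed x hx ?_).2⟩
    exact (hU.bins.pos_lt x hx).1.trans_le hge'

/-! ## The orientation of the edges -/

/-- The order of the vertices by degree, with ties broken by the label. -/
def DegLT (f : ℕ → ℕ) (v u : ℕ) : Prop :=
  f (v + 1) - f v < f (u + 1) - f u ∨ f (v + 1) - f v = f (u + 1) - f u ∧ v < u

instance (f : ℕ → ℕ) : DecidableRel (DegLT f) := fun _ _ => instDecidableOr

/-- The edges, oriented towards the end that is larger in the order by degree. -/
def Oriented (R : ℕ → ℕ → Prop) (f : ℕ → ℕ) (v u : ℕ) : Prop := R v u ∧ DegLT f v u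

instance (R : ℕ → ℕ → Prop) [DecidableRel R] (f : ℕ → ℕ) : DecidableRel (Oriented R f) :=
  fun _ _ => instDecidableAnd

/-- The labels break all ties, so the order by degree is total; with `Oriented.asymm`, every edge
has exactly one orientation. -/
theorem IsGraph.oriented_or {N : ℕ} {R : ℕ → ℕ → Prop} (hR : IsGraph N R) (f : ℕ → ℕ) {x y : ℕ} :
    R x y ↔ Oriented R f x y ∨ Oriented R f y x := by
  constructor
  · intro h
    have hne := hR.ne h
    have h' := hR.symm h
    rcases lt_or_ge (f (x + 1) - f x) (f (y + 1) - f y) with h1 | h1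
    · exact .inl ⟨h, .inl h1⟩
    rcases h1.lt_or_eq with h1 | h1
    · exact .inr ⟨h', .inl h1⟩
    rcases lt_or_gt_of_ne hne with h2 | h2
    · exact .inl ⟨h, .inr ⟨h1.symm, h2⟩⟩
    · exact .inr ⟨h', .inr ⟨h1, h2⟩⟩
  · rintro (h | h)
    · exact h.1
    · exact hR.symm h.1

theorem Oriented.asymm {R : ℕ → ℕ → Prop} {f : ℕ → ℕ} {x y : ℕ} (h : Oriented R f x y) :
    ¬ Oriented R f y x := by
  rintro ⟨-, h2⟩
  have h1 := h.2
  unfold DegLT at h1 h2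
  omega

/-- Adjacency arrays are built row by row: a new last row leaves all earlier offsets and entries in
place. -/
theorem Lists.extend {N : ℕ} {src tgt src' tgt' : ℕ → ℕ} {R : ℕ → ℕ → Prop}
    (h : Lists N src tgt R) (hsrc : ∀ x ≤ N, src' x = src x)
    (htgt : ∀ e < src N, tgt' e = tgt e) (hle : src' N ≤ src' (N + 1))
    (hinj : Set.InjOn tgt' (Set.Ico (src' N) (src' (N + 1))))
    (hmem : ∀ y, R N y ↔ ∃ e, src' N ≤ e ∧ e < src' (N + 1) ∧ tgt' e = y) :
    Lists (N + 1) src' tgt' R := by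
  have key : ∀ x < N, ∀ e < src (x + 1), tgt' e = tgt e := fun x hx e he =>
    htgt e (he.trans_le (h.src_le (Nat.succ_le_of_lt hx) le_rfl))
  refine ⟨by rw [hsrc 0 (Nat.zero_le _), h.zero], fun x hx => ?_, fun x hx => ?_,
    fun x hx y => ?_⟩ <;> rcases Nat.lt_succ_iff_lt_or_eq.1 hx with hx | rfl
  · rw [hsrc x hx.le, hsrc _ hx]
    exact h.mono x hx
  · exact hle
  · rw [hsrc x hx.le, hsrc _ hx]
    intro e he e' he' hee
    rw [key x hx e he.2, key x hx e' he'.2] at hee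
    exact h.inj x hx he he' hee
  · exact hinj
  · rw [hsrc x hx.le, hsrc _ hx, h.mem x hx]
    refine exists_congr fun e => and_congr_right fun _ => and_congr_right fun he => ?_
    rw [key x hx e he]
  · exact hmem y

theorem exists_lt_succ_iff {p : ℕ → Prop} {a b : ℕ} (h : a ≤ b) :
    (∃ e, a ≤ e ∧ e < b + 1 ∧ p e) ↔ (∃ e, a ≤ e ∧ e < b ∧ p e) ∨ p b := by
  constructor
  · rintro ⟨e, h1, h2, h3⟩
    rcases Nat.lt_succ_iff_lt_or_eq.1 h2 with h2 | rfl
    · exact .inl ⟨e, h1, h2, h3⟩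
    · exact .inr h3
  · rintro (⟨e, h1, h2, h3⟩ | h3)
    · exact ⟨e, h1, by omega, h3⟩
    · exact ⟨b, h, by omega, h3⟩

theorem injOn_update {f : ℕ → ℕ} {a b y : ℕ} (hf : Set.InjOn f (Set.Ico a b))
    (hy : ¬ ∃ e, a ≤ e ∧ e < b ∧ f e = y) :
    Set.InjOn (Function.update f b y) (Set.Ico a (b + 1)) := by
  intro e he e' he' h
  simp only [Function.update_apply] at h
  have hb : ∀ e, e ∈ Set.Ico a (b + 1) → e ≠ b → e ∈ Set.Ico a b := fun e he hne =>
    ⟨he.1, lt_of_le_of_ne (Nat.lt_succ_iff.1 he.2) hne⟩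
  split_ifs at h with h1 h2 h2
  · rw [h1, h2]
  · exact absurd ⟨e', (hb e' he' h2).1, (hb e' he' h2).2, h.symm⟩ hy
  · exact absurd ⟨e, (hb e he h1).1, (hb e he h1).2, h⟩ hy
  · exact hf (hb e he h1) (hb e' he' h2) h

theorem exists_update_iff {f : ℕ → ℕ} {a b y z : ℕ} (h : a ≤ b) :
    (∃ e, a ≤ e ∧ e < b + 1 ∧ Function.update f b y e = z) ↔
      (∃ e, a ≤ e ∧ e < b ∧ f e = z) ∨ y = z := by
  rw [exists_lt_succ_iff h, Function.update_self]
  refine or_congr_left (exists_congr fun e => and_congr_right fun _ => and_congr_right fun he => ?_)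
  rw [Function.update_of_ne he.ne]

theorem wp_orientEdges {K : ℕ} {σ : State} {R : ℕ → ℕ → Prop}
    (hL : Lists (σ.reg .n) (σ.arr .off) (σ.arr .adj) R) (hR : IsGraph (σ.reg .n) R)
    (hK : σ.reg .n < K) (hK' : σ.arr .off (σ.reg .n) ≤ K) :
    wp K orientEdges (fun T τ =>
      T ≤ 10 * σ.reg .n + 10 * σ.arr .off (σ.reg .n) + 10 ∧
      Lists (σ.reg .n) (τ.arr .ooff) (τ.arr .oadj) (Oriented R (σ.arr .off)) ∧
      τ.arr .ooff (σ.reg .n) ≤ σ.arr .off (σ.reg .n)) σ := by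
  generalize hM : σ.reg .n = M at *
  generalize hf : σ.arr .off = f at *
  generalize hg : σ.arr .adj = g at *
  unfold orientEdges
  refine wp_seq (wp_assign (by simp) (wp_seq (wp_store (by simp; omega) (by simp) (by simp) ?_)))
  refine wp_forRange (fun v T τ => T ≤ 1 + 10 * v + 10 * f v ∧ τ.reg .p = τ.arr .ooff v ∧
    τ.arr .ooff v ≤ f v ∧ Lists v (τ.arr .ooff) (τ.arr .oadj) (Oriented R f)) 0 M
    (by simp) (by simp) (Nat.zero_le _) ?_ (by decide) ?_ ?_ ?_
  · intro v T τ _ _ hi hF _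
    have := hF.1 .n (by decide)
    simp [this, hM]
  · refine ⟨by simp, by simp, by simp, ⟨by simp, by simp, by simp, by simp⟩⟩
  · rintro v T τ - hvM hv hF ⟨hT, hp, hle, hlists⟩
    have hfτ : τ.arr .off = f := (hF.2 .off (by decide)).trans (by simp [hf])
    have hgτ : τ.arr .adj = g := (hF.2 .adj (by decide)).trans (by simp [hg])
    have hfM : f (v + 1) ≤ f M := hL.src_le (Nat.succ_le_of_lt hvM) le_rfl
    generalize ho : τ.arr .ooff = o at *
    -- The row under construction holds precisely those entries of the scanned part of the list of
    -- `v` that follow `v` in the order; the earlier rows are untouched.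
    refine wp_seq (wp_forRange (fun e T τ₁ => T ≤ 1 + 7 * (e - f v) ∧ o v ≤ τ₁.reg .p ∧
      τ₁.reg .p ≤ o v + (e - f v) ∧ (∀ q < o v, τ₁.arr .oadj q = τ.arr .oadj q) ∧
      Set.InjOn (τ₁.arr .oadj) (Set.Ico (o v) (τ₁.reg .p)) ∧
      ∀ y, (∃ q, o v ≤ q ∧ q < τ₁.reg .p ∧ τ₁.arr .oadj q = y) ↔
        ∃ e', f v ≤ e' ∧ e' < e ∧ (g e' = y ∧ DegLT f v y)) (f v) (f (v + 1))
      (by simp [hv]; omega) (by simp [hv, hfτ]) (hL.mono v hvM) ?_ (by decide) ?_ ?_ ?_)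
    · intro e T₁ τ₁ _ _ _ hF₁ _
      have h1 : τ₁.reg .v = v := (hF₁.1 .v (by decide)).trans hv
      have h2 : τ₁.arr .off = f := (hF₁.2 .off (by decide)).trans hfτ
      simp [h1, h2]
      omega
    · refine ⟨by omega, by simp [hp], by simp [hp], by simp, by simp [hp], fun y => ?_⟩
      simp only [State.setReg_arr, ne_eq, reduceCtorEq, not_false_eq_true, State.setReg_reg_ne, hp]
      exact ⟨fun ⟨q, h1, h2, _⟩ => by omega, fun ⟨q, h1, h2, _⟩ => by omega⟩
    · rintro e T₁ τ₁ he₁ he₂ he hF₁ ⟨hT₁, hp₁, hp₂, hold, hinj, hmem⟩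
      have h1 : τ₁.reg .v = v := (hF₁.1 .v (by decide)).trans hv
      have h2 : τ₁.arr .off = f := (hF₁.2 .off (by decide)).trans hfτ
      have h3 : τ₁.arr .adj = g := (hF₁.2 .adj (by decide)).trans hgτ
      have hy := hR.lt' (hL.rel hvM he₁ he₂)
      refine wp_seq (wp_assign (by simp [he]; omega) ?_)
      simp only [Expr.eval_get, Expr.eval_var, he, h3]
      refine wp_branch (by simp [h1]; omega) ?_ ?_
      · intro ht
        have ht' : DegLT f v (g e) := by simpa [h1, h2, DegLT] using ht
        refine wp_seq (wp_store (by simp; omega) (by simp) (by simp) (wp_assign (by simp) ?_))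
        simp only [Expr.eval_var, Expr.eval_add, Expr.eval_ofNat, ne_eq, reduceCtorEq,
          not_false_eq_true, State.setReg_reg_ne, State.setReg_reg_same, State.setReg_arr,
          State.setCell_reg, State.setCell_arr_same]
        refine ⟨by omega, by omega, by omega, fun q hq => ?_, injOn_update hinj ?_, fun y => ?_⟩
        · rw [Function.update_of_ne (by omega), hold q hq]
        · rw [hmem]
          rintro ⟨e', h4, h5, h6, -⟩
          have := hL.inj v hvM ⟨h4, by omega⟩ ⟨he₁, he₂⟩ h6
          omega
        · rw [exists_update_iff hp₁, hmem, exists_lt_succ_iff he₁]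
          refine or_congr_right ⟨?_, fun h => h.1⟩
          rintro rfl
          exact ⟨rfl, ht'⟩
      · intro ht
        have ht' : ¬ DegLT f v (g e) := by simpa [h1, h2, DegLT] using ht
        refine wp_skip ?_
        simp only [ne_eq, reduceCtorEq, not_false_eq_true, State.setReg_reg_ne, State.setReg_arr]
        refine ⟨by omega, by omega, by omega, hold, hinj, fun y => ?_⟩
        rw [hmem, exists_lt_succ_iff he₁]
        refine ⟨.inl, fun h => h.resolve_right ?_⟩
        rintro ⟨rfl, h⟩
        exact ht' h
    · rintro T₁ τ₁ - hF₁ ⟨hT₁, hp₁, hp₂, hold, hinj, hmem⟩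
      have h1 : τ₁.reg .v = v := (hF₁.1 .v (by decide)).trans hv
      have h2 : τ₁.arr .ooff = o := (hF₁.2 .ooff (by decide)).trans ho
      have hle' := hL.mono v hvM
      refine wp_store (by simp [h1]; omega) (by simp) (by simp) ?_
      simp only [Expr.eval_var, Expr.eval_add, Expr.eval_ofNat, ne_eq, reduceCtorEq,
          not_false_eq_true, State.setReg_reg_ne, State.setReg_arr, State.setCell_arr_ne,
          State.setCell_reg, State.setCell_arr_same, h1, h2, Function.update_self]
      refine ⟨by omega, trivial, by omega, hlists.extend (fun x hx => ?_) hold ?_ ?_ fun y => ?_⟩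
      · rw [Function.update_of_ne (by omega)]
      · rwa [Function.update_self, Function.update_of_ne (by omega)]
      · rwa [Function.update_self, Function.update_of_ne (by omega)]
      · rw [Function.update_self, Function.update_of_ne (by omega), hmem, Oriented, hL.mem v hvM]
        constructor
        · rintro ⟨⟨e, h1, h2, h3⟩, h4⟩
          exact ⟨e, h1, h2, h3, h4⟩
        · rintro ⟨e, h1, h2, h3, h4⟩
          exact ⟨⟨e, h1, h2, h3⟩, h4⟩
  · rintro T τ - hF ⟨hT, -, hle, hlists⟩
    exact ⟨by omega, hlists, hle⟩

/-! ## The extraction of the ego-networks -/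

/-- The vertices `a 0, …, a (d - 1)` of an ego-network, together with the oriented lists of the
graph. -/
structure EgoData (M d : ℕ) (a o h : ℕ → ℕ) (S : ℕ → ℕ → Prop) : Prop where
  lists : Lists M o h S
  rel_lt : ∀ {x y}, S x y → y < M
  lt : ∀ i < d, a i < M
  inj : ∀ i < d, ∀ j < d, a i = a j → i = j

/-- The oriented edges of the ego-network. -/
def egoEdges (d : ℕ) (a : ℕ → ℕ) (S : ℕ → ℕ → Prop) [DecidableRel S] : Finset (ℕ × ℕ) :=
  {p ∈ range d ×ˢ range d | S (a p.1) (a p.2)}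

theorem mem_egoEdges {d : ℕ} {a : ℕ → ℕ} {S : ℕ → ℕ → Prop} [DecidableRel S] {i j : ℕ} :
    (i, j) ∈ egoEdges d a S ↔ i < d ∧ j < d ∧ S (a i) (a j) := by
  simp [egoEdges, and_assoc]

/-- An iteration rule in which the invariant is indexed by the set of edges already treated. Each
oriented edge of the ego-network is met once, so `hstep` may assume that the current edge is new.
The invariant must be insensitive to the registers that the iteration itself writes, which is
`hset`. The cost is governed by the out-degrees of the vertices of the ego-network in the whole
graph. -/
theorem wp_forEgoEdges {K : ℕ} {c : Cmd} {Q : ℕ → State → Prop} {σ : State} {M d v : ℕ}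
    {a o h : ℕ → ℕ} {S : ℕ → ℕ → Prop} [DecidableRel S] (B : ℕ)
    (P : Finset (ℕ × ℕ) → State → Prop)
    (hc : c.keepsReg .i ∧ c.keepsReg .e ∧ c.keepsReg .u ∧ c.keepsReg .d ∧ c.keepsReg .v ∧
      c.keepsArr .off ∧ c.keepsArr .adj ∧ c.keepsArr .ooff ∧ c.keepsArr .oadj ∧ c.keepsArr .loc)
    (hd : σ.reg .d = d) (hv : σ.reg .v = v) (ho : σ.arr .ooff = o) (hh : σ.arr .oadj = h)
    (ha : ∀ i < d, σ.arr .adj (σ.arr .off v + i) = a i) (hE : EgoData M d a o h S)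
    (hloc : ∀ i < d, σ.arr .loc (a i) = i + 1)
    (hloc' : ∀ u < M, 0 < σ.arr .loc u → ∃ i < d, a i = u)
    (hK : v < K ∧ σ.arr .off v + d ≤ K ∧ M < K ∧ o M ≤ K)
    (h0 : P ∅ σ)
    (hset : ∀ s τ z b, z = .i ∨ z = .e ∨ z = .u ∨ z = .j → P s τ → P s (τ.setReg z b))
    (hstep : ∀ s i j τ, Frame (forEgoEdges c) σ τ → (i, j) ∈ egoEdges d a S →
      s ⊆ egoEdges d a S → (i, j) ∉ s → τ.reg .i = i → τ.reg .j = j → P s τ →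
      wp K c (fun T τ' => T ≤ B ∧ P (insert (i, j) s) τ') τ)
    (hQ : ∀ T τ, Frame (forEgoEdges c) σ τ →
      T ≤ 2 + 8 * d + (B + 6) * ∑ i ∈ range d, (o (a i + 1) - o (a i)) →
      P (egoEdges d a S) τ → Q T τ) :
    wp K (forEgoEdges c) Q σ := by
  obtain ⟨c1, c2, c3, c4, c5, c6, c7, c8, c9, c10⟩ := hc
  obtain ⟨hK1, hK2, hK3, hK4⟩ := hK
  unfold forEgoEdges at *
  refine wp_forRange (fun i T τ =>
    T ≤ 1 + 8 * i + (B + 6) * ∑ i ∈ range i, (o (a i + 1) - o (a i)) ∧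
    P {p ∈ egoEdges d a S | p.1 < i} τ) 0 d
    (by simp) (by simp) (Nat.zero_le _) ?_ (by simp [forRange, Cmd.keepsReg, *]) ?_ ?_ ?_
  · intro i T τ _ _ hi hF _
    have := (hF.1 .d (by simp [forRange, Cmd.keepsReg, *])).trans hd
    simp [this]
  · exact ⟨by simp, by simpa using hset _ _ .i 0 (by simp) h0⟩
  · rintro i T τ - hid hi hF ⟨hT, hP⟩
    have hvτ : τ.reg .v = v := (hF.1 .v (by simp [forRange, Cmd.keepsReg, *])).trans hv
    have hoffτ : τ.arr .off = σ.arr .off := (hF.2 .off (by simp [forRange, Cmd.keepsArr, *]))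
    have hadjτ : τ.arr .adj = σ.arr .adj := (hF.2 .adj (by simp [forRange, Cmd.keepsArr, *]))
    have hoτ : τ.arr .ooff = o := (hF.2 .ooff (by simp [forRange, Cmd.keepsArr, *])).trans ho
    have hai := hE.lt i hid
    have hoM : o (a i + 1) ≤ o M := hE.lists.src_le hai le_rfl
    refine wp_seq (wp_assign (by simp [hi, hvτ, hoffτ]; omega) ?_)
    simp only [Expr.eval_get, Expr.eval_var, Expr.eval_add, hi, hvτ, hoffτ, hadjτ, ha i hid]
    -- Treated so far: all edges that leave earlier labels, and the edges from `i` to targets in the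
    -- scanned part of its oriented list.
    refine wp_forRange (fun e T τ₁ => T ≤ 1 + (B + 6) * (e - o (a i)) ∧
      P {p ∈ egoEdges d a S | p.1 < i ∨ p.1 = i ∧ a p.2 ∈ (Ico (o (a i)) e).image h} τ₁)
      (o (a i)) (o (a i + 1))
      (by simp; omega) (by simp [hoτ]) (hE.lists.mono _ hai) ?_ (by simp [Cmd.keepsReg, *])
      ?_ ?_ ?_
    · intro e T₁ τ₁ _ _ _ hF₁ _
      have h1 : τ₁.reg .u = a i :=
        (hF₁.1 .u (by simp [forRange, Cmd.keepsReg, *])).trans (by simp)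
      have h2 : τ₁.arr .ooff = o := (hF₁.2 .ooff (by simp [forRange, Cmd.keepsArr, *])).trans hoτ
      simp [h1, h2]
      omega
    · refine ⟨by simp, ?_⟩
      simpa using hset _ _ .e (o (a i)) (by simp) (hset _ _ .u (a i) (by simp) hP)
    · rintro e T₁ τ₁ he₁ he₂ he hF₁ ⟨hT₁, hP₁⟩
      -- The frames of the outer loop, of the assignment and of the inner loop are composed into one
      -- for the whole iteration, as `hstep` requires.
      have hF₂ := (hF.trans ⟨fun z hz => State.setReg_reg_ne (z := .u) _ _ ?_, fun _ _ => rfl⟩).trans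
        (hF₁.mono (c' := forRange .i 0 (Expr.var .d)
        (.seq (.assign .u (.get .adj (.get .off (.var .v) + .var .i)))
          (forRange .e (.get .ooff (.var .u)) (.get .ooff (.var .u + 1))
            (.branch (.lt 0 (.get .loc (.get .oadj (.var .e))))
              (.seq (.assign .j (.get .loc (.get .oadj (.var .e)) - 1)) c) .skip))))
        (fun z hz => ?_) fun A hA => ?_)
      rotate_left
      · simp [forRange, Cmd.keepsReg] at hz
        tauto
      · simp [forRange, Cmd.keepsReg] at hz ⊢
        tauto
      · simp [forRange, Cmd.keepsArr] at hA ⊢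
        tauto
      have h2 : τ₁.arr .oadj = h := (hF₂.2 .oadj (by simp [forRange, Cmd.keepsArr, *])).trans hh
      have h3 : τ₁.arr .loc = σ.arr .loc := (hF₂.2 .loc (by simp [forRange, Cmd.keepsArr, *]))
      have h4 : τ₁.reg .i = i := (hF₁.1 .i (by simp [forRange, Cmd.keepsReg, *])).trans (by simp [hi])
      have hS : S (a i) (h e) := hE.lists.rel hai he₁ he₂
      have hhe := hE.rel_lt hS
      have hT₂ : (B + 6) * (e + 1 - o (a i)) = (B + 6) * (e - o (a i)) + (B + 6) := by
        rw [Nat.sub_add_comm he₁, mul_add, mul_one]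
      have himage : ∀ x, x ∈ (Ico (o (a i)) (e + 1)).image h ↔
          x = h e ∨ x ∈ (Ico (o (a i)) e).image h := by
        intro x
        rw [Nat.Ico_succ_right_eq_insert_Ico he₁, image_insert, mem_insert]
      refine wp_branch (by simp [he, h2]; omega) ?_ ?_
      · intro ht
        obtain ⟨j, hj, haj⟩ := hloc' _ hhe (by simpa [he, h2, h3] using ht)
        have hij : (i, j) ∈ egoEdges d a S := mem_egoEdges.2 ⟨hid, hj, haj ▸ hS⟩
        refine wp_seq (wp_assign (by simp [he, h2]; omega) ?_)
        simp only [Expr.eval_get, Expr.eval_var, Expr.eval_sub, Expr.eval_ofNat, he, h2, h3, ← haj,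
          hloc j hj, add_tsub_cancel_right]
        refine (hstep _ i j (τ₁.setReg .j j) (hF₂.trans ⟨fun z hz => ?_, fun _ _ => rfl⟩) hij (filter_subset _ _)
          ?_ (by simp [h4]) (by simp) (hset _ _ .j j (by simp) hP₁)).mono ?_
        · refine State.setReg_reg_ne _ _ ?_
          simp [forRange, Cmd.keepsReg] at hz
          tauto
        · simp only [mem_filter, not_and, mem_image, mem_Ico, lt_self_iff_false, true_and, false_or]
          rintro - ⟨e', ⟨h5, h6⟩, h7⟩
          have := hE.lists.inj _ hai ⟨h5, by omega⟩ ⟨he₁, he₂⟩ (by rw [h7, haj])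
          omega
        · rintro T₂ τ₂ hF₃ ⟨hT₃, hP₃⟩
          refine ⟨by omega, ?_⟩
          convert hset _ _ .e (e + 1) (by simp) hP₃ using 1
          ext ⟨x, y⟩
          simp only [mem_filter, mem_insert, himage, Prod.mk.injEq, mem_egoEdges] at hij ⊢
          constructor
          · rintro ⟨⟨h6, h7, h8⟩, h9 | ⟨rfl, h9 | h9⟩⟩
            · tauto
            · exact .inl ⟨rfl, hE.inj _ h7 _ hj (h9.trans haj.symm)⟩
            · tauto
          · rintro (⟨rfl, rfl⟩ | h6)
            · exact ⟨hij, .inr ⟨rfl, .inl haj⟩⟩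
            · tauto
      · intro ht
        refine wp_skip ⟨by omega, ?_⟩
        convert hset _ _ .e (e + 1) (by simp) hP₁ using 1
        refine filter_congr ?_
        rintro ⟨x, y⟩ hxy
        have hy := mem_egoEdges.1 hxy
        rw [himage]
        -- The cell of `loc` at this target is zero, whereas a vertex of the ego-network holds its
        -- label plus one.
        have : a y ≠ h e := by
          intro h5
          have := hloc y hy.2.1
          simp [he, h2, h3, ← h5] at ht
          omega
        simp [this]
    · rintro T₁ τ₁ - hF₁ ⟨hT₁, hP₁⟩
      rw [sum_range_succ, mul_add (B + 6)]
      refine ⟨by omega, ?_⟩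
      convert hset _ _ .i (i + 1) (by simp) hP₁ using 1
      refine filter_congr ?_
      rintro ⟨x, y⟩ hxy
      obtain ⟨h1, h2, h3⟩ := mem_egoEdges.1 hxy
      simp only [mem_image, mem_Ico, Nat.lt_succ_iff_lt_or_eq]
      refine or_congr_right ⟨?_, fun h => h.1⟩
      rintro rfl
      obtain ⟨e, h4, h5, h6⟩ := (hE.lists.mem _ hai _).1 h3
      exact ⟨rfl, e, ⟨h4, h5⟩, h6⟩
  · rintro T τ - hF ⟨hT, hP⟩
    refine hQ _ _ hF (by omega) ?_
    convert hP using 1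
    refine (filter_true_of_mem ?_).symm
    rintro ⟨x, y⟩ hxy
    exact (mem_egoEdges.1 hxy).1

/-- The number of the oriented edges in `s` at `i`. -/
def edgeCount (s : Finset (ℕ × ℕ)) (i : ℕ) : ℕ := #{p ∈ s | p.1 = i} + #{p ∈ s | p.2 = i}

theorem edgeCount_insert {s : Finset (ℕ × ℕ)} {i j : ℕ} (h : (i, j) ∉ s) (x : ℕ) :
    edgeCount (insert (i, j) s) x =
      edgeCount s x + (if x = i then 1 else 0) + if x = j then 1 else 0 := by
  unfold edgeCount
  rw [filter_insert, filter_insert]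
  have h1 : ∀ p : ℕ × ℕ → Prop, [DecidablePred p] → (i, j) ∉ {x ∈ s | p x} := fun p _ h' =>
    h (mem_of_mem_filter _ h')
  simp only [eq_comm (a := x)]
  split_ifs <;> (try simp only [card_insert_of_notMem (h1 _)]) <;> omega

/-- An edge that is still missing leaves a free cell in the rows of both of its ends. This keeps
each row within the space reserved for it. -/
theorem edgeCount_lt {s t : Finset (ℕ × ℕ)} {i j : ℕ} (h : (i, j) ∉ s) (hst : insert (i, j) s ⊆ t) :
    edgeCount s i < edgeCount t i ∧ edgeCount s j < edgeCount t j := by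
  have key : ∀ x, edgeCount (insert (i, j) s) x ≤ edgeCount t x := fun x =>
    add_le_add (card_le_card (filter_subset_filter _ hst))
      (card_le_card (filter_subset_filter _ hst))
  have h1 := key i
  have h2 := key j
  rw [edgeCount_insert h] at h1 h2
  split_ifs at h1 h2 <;> omega

theorem sum_edgeCount {s : Finset (ℕ × ℕ)} {d : ℕ} (h : ∀ p ∈ s, p.1 < d ∧ p.2 < d) :
    ∑ i ∈ range d, edgeCount s i = 2 * #s := by
  unfold edgeCount
  rw [sum_add_distrib, ← card_eq_sum_card_fiberwise (fun p hp => by simpa using (h p hp).1),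
    ← card_eq_sum_card_fiberwise (fun p hp => by simpa using (h p hp).2), two_mul]

/-- The edges that start at label `i` inject into the out-neighbours of `a i`, since `a` is
injective. -/
theorem EgoData.card_egoEdges_le {M d : ℕ} {a o h : ℕ → ℕ} {S : ℕ → ℕ → Prop} [DecidableRel S]
    (hE : EgoData M d a o h S) :
    #(egoEdges d a S) ≤ ∑ i ∈ range d, (o (a i + 1) - o (a i)) := by
  rw [card_eq_sum_card_fiberwise (f := Prod.fst) (t := range d) fun p hp => by
    simpa using (mem_egoEdges.1 hp).1]
  refine sum_le_sum fun i hi => ?_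
  have hi := mem_range.1 hi
  rw [← hE.lists.degree hE.rel_lt (hE.lt i hi)]
  refine card_le_card_of_injOn (fun p => a p.2) ?_ ?_
  · rintro ⟨x, y⟩ hp
    simp only [coe_filter, mem_egoEdges, Set.mem_ofPred_eq, mem_range] at hp ⊢
    obtain ⟨⟨h1, h2, h3⟩, rfl⟩ := hp
    exact ⟨hE.lt y h2, h3⟩
  · rintro ⟨x, y⟩ hp ⟨x', y'⟩ hp' he
    simp only [coe_filter, mem_egoEdges, Set.mem_ofPred_eq] at hp hp'
    rw [Prod.mk.injEq]
    exact ⟨hp.2.trans hp'.2.symm, hE.inj _ hp.1.2.1 _ hp'.1.2.1 he⟩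

theorem EgoData.sum_le {M d : ℕ} {a o h : ℕ → ℕ} {S : ℕ → ℕ → Prop}
    (hE : EgoData M d a o h S) : ∑ i ∈ range d, (o (a i + 1) - o (a i)) ≤ o M := by
  have h1 : ∑ x ∈ range M, (o (x + 1) - o x) = o M := by
    have key : ∀ l ≤ M, ∑ x ∈ range l, (o (x + 1) - o x) = o l := by
      intro l hl
      induction l with
      | zero => simp [hE.lists.zero]
      | succ l ih =>
        have := hE.lists.mono l hl
        rw [sum_range_succ, ih (by omega)]
        omega
    exact key M le_rfl
  rw [← h1, ← sum_image (f := fun x => o (x + 1) - o x) (g := a)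
    fun i hi j hj => hE.inj _ (by simpa using hi) _ (by simpa using hj)]
  exact sum_le_sum_of_subset fun x => by
    simp only [mem_image, mem_range]
    rintro ⟨i, hi, rfl⟩
    exact hE.lt i hi

/-- The adjacency arrays under construction: the row of `i` begins at `eoff i` and has `cnt i`
entries, which are the `y` with `row i y`. -/
structure RowInv (d : ℕ) (eoff ecur eadj cnt : ℕ → ℕ) (row : ℕ → ℕ → Prop) : Prop where
  cur : ∀ i < d, ecur i = eoff i + cnt i
  inj : ∀ i < d, Set.InjOn eadj (Set.Ico (eoff i) (ecur i))
  mem : ∀ i < d, ∀ y, (∃ q, eoff i ≤ q ∧ q < ecur i ∧ eadj q = y) ↔ row i y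

/-- The reserved rows are disjoint intervals and row `i` is not full, so the written cell belongs to
no other row. -/
theorem RowInv.push {d : ℕ} {eoff ecur eadj cnt size : ℕ → ℕ} {row : ℕ → ℕ → Prop}
    (h : RowInv d eoff ecur eadj cnt row) (hoff : ∀ x < d, ∀ y < d, x < y → eoff x + size x ≤ eoff y)
    (hcnt : ∀ x < d, cnt x ≤ size x) {i y : ℕ} (hi : i < d) (hlt : cnt i < size i)
    (hy : ¬ row i y) :
    RowInv d eoff (Function.update ecur i (ecur i + 1)) (Function.update eadj (ecur i) y)
      (fun x => cnt x + if x = i then 1 else 0) fun x z => row x z ∨ x = i ∧ z = y := by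
  have hle : eoff i ≤ ecur i := by
    rw [h.cur i hi]
    exact Nat.le_add_right ..
  have hne : ∀ x < d, x ≠ i → ∀ q, eoff x ≤ q → q < ecur x → q ≠ ecur i := by
    intro x hx hxi q h1 h2
    have h3 := h.cur x hx
    have h4 := h.cur i hi
    have h5 := hcnt x hx
    rcases lt_or_gt_of_ne hxi with h6 | h6
    · have := hoff x hx i hi h6
      omega
    · have := hoff i hi x hx h6
      omega
  refine ⟨fun x hx => ?_, fun x hx => ?_, fun x hx z => ?_⟩ <;> rcases eq_or_ne x i with rfl | hxi
  · rw [Function.update_self, if_pos rfl, h.cur x hx, add_assoc]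
  · rw [Function.update_of_ne hxi, if_neg hxi, h.cur x hx, add_zero]
  · rw [Function.update_self]
    exact injOn_update (h.inj x hi) (by rwa [h.mem x hi])
  · rw [Function.update_of_ne hxi]
    refine (h.inj x hx).congr fun q hq => ?_
    rw [Function.update_of_ne (hne x hx hxi q hq.1 hq.2)]
  · rw [Function.update_self, exists_update_iff hle, h.mem x hx]
    simp [eq_comm]
  · rw [Function.update_of_ne hxi]
    simp only [hxi, false_and, or_false]
    rw [← h.mem x hx]
    refine exists_congr fun q => and_congr_right fun h1 => and_congr_right fun h2 => ?_
    rw [Function.update_of_ne (hne x hx hxi q h1 h2)]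

/-- The adjacency relation of the ego-network whose vertices have the labels `0, …, d - 1` and are
`a 0, …, a (d - 1)`. -/
def egoRel (d : ℕ) (a : ℕ → ℕ) (R : ℕ → ℕ → Prop) (i j : ℕ) : Prop := i < d ∧ j < d ∧ R (a i) (a j)

instance (d : ℕ) (a : ℕ → ℕ) (R : ℕ → ℕ → Prop) [DecidableRel R] : DecidableRel (egoRel d a R) :=
  fun _ _ => instDecidableAnd

theorem IsGraph.egoRel {N d : ℕ} {a : ℕ → ℕ} {R : ℕ → ℕ → Prop} (h : IsGraph N R) :
    IsGraph d (egoRel d a R) :=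
  ⟨fun h' => ⟨h'.2.1, h'.1, h.symm h'.2.2⟩, fun _ h' => h.irrefl _ h'.2.2, fun h' => h'.1⟩

/-- Two passes over the same edges: the first counts the degrees, which fix the offsets by prefix
sums, and the second fills the rows. The array `loc` is cleaned only at the neighbours of `v`, which
keeps the cost local and makes the next extraction possible. -/
theorem wp_extractEgo {K M v : ℕ} {σ : State} {R : ℕ → ℕ → Prop} [DecidableRel R] {f a o : ℕ → ℕ}
    {d : ℕ} (hv : σ.reg .v = v) (hvM : v < M) (hf : σ.arr .off = f) (ho : σ.arr .ooff = o)
    (ha : ∀ i, σ.arr .adj (f v + i) = a i) (hd : f (v + 1) - f v = d)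
    (hL : Lists M f (σ.arr .adj) R) (hR : IsGraph M R)
    (hO : Lists M o (σ.arr .oadj) (Oriented R f)) (hoM : o M ≤ f M)
    (hloc : ∀ u < M, σ.arr .loc u = 0) (hK : M < K) (hK' : 2 * f M ≤ K) :
    wp K extractEgo (fun T τ =>
      T ≤ 30 * d + 30 * ∑ i ∈ range d, (o (a i + 1) - o (a i)) + 30 ∧
      τ.reg .d = d ∧ Lists d (τ.arr .eoff) (τ.arr .eadj) (egoRel d a R) ∧
      τ.arr .eoff d ≤ 2 * ∑ i ∈ range d, (o (a i + 1) - o (a i)) ∧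
      ∀ u < M, τ.arr .loc u = 0) σ := by
  have hfv := hL.mono v hvM
  have hfM : f (v + 1) ≤ f M := hL.src_le hvM le_rfl
  have haR : ∀ i < d, R v (a i) := fun i hi => by
    rw [← ha]
    exact hL.rel hvM (by omega) (by omega)
  have hE : EgoData M d a o (σ.arr .oadj) (Oriented R f) := by
    refine ⟨hO, fun h => hR.lt' h.1, fun i hi => hR.lt' (haR i hi), fun i hi j hj h => ?_⟩
    rw [← ha, ← ha] at h
    have := hL.inj v hvM ⟨by omega, by omega⟩ ⟨by omega, by omega⟩ h
    omega
  have hdM : d ≤ M := by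
    rw [← hd, ← hL.degree hR.lt' hvM]
    exact (card_filter_le _ _).trans_eq (card_range M)
  have hcard := hE.card_egoEdges_le
  have hsum := hE.sum_le
  set D := egoEdges d a (Oriented R f) with hD
  have hDlt : ∀ p ∈ D, p.1 < d ∧ p.2 < d := fun p hp =>
    ⟨(mem_egoEdges.1 hp).1, (mem_egoEdges.1 hp).2.1⟩
  generalize hW : ∑ i ∈ range d, (o (a i + 1) - o (a i)) = W at *
  unfold extractEgo
  refine wp_seq (wp_assign (by simp; omega) ?_)
  simp only [Expr.eval_get, Expr.eval_var, Expr.eval_add, Expr.eval_sub, Expr.eval_ofNat, hf, hv, hd]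
  -- Labels are stored increased by one, so that zero means "not a neighbour of `v`".
  refine wp_seq (wp_forRange (fun i T τ => T ≤ 1 + 4 * i ∧
    (∀ j < i, τ.arr .loc (a j) = j + 1 ∧ τ.arr .edeg j = 0) ∧
    ∀ u < M, 0 < τ.arr .loc u → ∃ j < i, a j = u) 0 d
    (by simp) (by simp) (Nat.zero_le _) ?_ (by decide) ?_ ?_ ?_)
  · intro i T τ _ _ hi hF _
    simp [hF.1 .d (by decide)]
  · exact ⟨by simp, by simp, fun u hu h => by simp [hloc u hu] at h⟩
  · rintro i T τ - hid hi hF ⟨hT, hP, hP'⟩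
    have h1 : τ.reg .v = v := (hF.1 .v (by decide)).trans (by simp [hv])
    have h2 : τ.arr .off = f := (hF.2 .off (by decide)).trans (by simp [hf])
    have h3 : τ.arr .adj = σ.arr .adj := (hF.2 .adj (by decide))
    have h4 := hE.lt i hid
    refine wp_seq (wp_store (by simp [h1, h2, h3, hi, ha]; omega) (by simp [h1, h2, hi]; omega)
      (by simp) (wp_store (by simp [hi]; omega) (by simp) (by simp) ?_))
    simp only [Expr.eval_get, Expr.eval_var, Expr.eval_add, Expr.eval_ofNat, h1, h2, h3, hi, ha,
      State.setReg_arr, State.setCell_arr_same, ne_eq, reduceCtorEq, not_false_eq_true,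
      State.setCell_arr_ne, State.setCell_reg]
    refine ⟨by omega, fun j hj => ?_, fun u hu h => ?_⟩
    · rcases eq_or_ne j i with rfl | hne
      · simp
      · rw [Function.update_of_ne hne, Function.update_of_ne]
        · exact hP j (by omega)
        · exact fun h => hne (hE.inj _ (by omega) _ hid h)
    · rcases eq_or_ne u (a i) with rfl | hne
      · exact ⟨i, by omega, rfl⟩
      · rw [Function.update_of_ne hne] at h
        obtain ⟨j, hj, hju⟩ := hP' u hu h
        exact ⟨j, by omega, hju⟩
  rintro T₁ σ₁ - hF₁ ⟨hT₁, hP₁, hP₁'⟩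
  have hd₁ : σ₁.reg .d = d := (hF₁.1 .d (by decide)).trans (by simp)
  have hv₁ : σ₁.reg .v = v := (hF₁.1 .v (by decide)).trans (by simp [hv])
  have hf₁ : σ₁.arr .off = f := (hF₁.2 .off (by decide)).trans (by simp [hf])
  have ho₁ : σ₁.arr .ooff = o := (hF₁.2 .ooff (by decide)).trans (by simp [ho])
  have hh₁ : σ₁.arr .oadj = σ.arr .oadj := (hF₁.2 .oadj (by decide))
  have hg₁ : σ₁.arr .adj = σ.arr .adj := (hF₁.2 .adj (by decide))
  refine wp_seq (wp_forEgoEdges (S := Oriented R f) 2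
    (fun s τ => ∀ i < d, τ.arr .edeg i = edgeCount s i) (by decide) hd₁ hv₁ ho₁ hh₁
    (fun i _ => by rw [hf₁, hg₁, ha]) hE (fun i hi => (hP₁ i hi).1) hP₁'
    (by rw [hf₁]; omega) (fun i hi => by simp [(hP₁ i hi).2, edgeCount]) ?_ ?_ ?_)
  · rintro s τ z b - h
    simpa using h
  · rintro s i j τ hF hij hs hnot hi hj hP
    obtain ⟨h1, h2, h3⟩ := mem_egoEdges.1 hij
    refine wp_seq (wp_store (by simp [hi]; omega) (by simp) (by simp [hi]; omega)
      (wp_store (by simp [hj]; omega) (by simp) (by simp [hj]; omega) ?_))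
    simp only [Expr.eval_get, Expr.eval_var, Expr.eval_add, Expr.eval_ofNat, hi, hj,
      State.setCell_arr_same, State.setCell_reg]
    refine ⟨by omega, fun x hx => ?_⟩
    have hne : i ≠ j := by
      rintro rfl
      exact hR.irrefl _ h3.1
    rw [edgeCount_insert hnot, ← hP x hx]
    simp only [Function.update_apply, hne.symm, if_false]
    split_ifs with h4 h5 h5
    · omega
    · rw [h4]
    · rw [h5]
    · rfl
  rintro T₂ σ₂ hF₂ hT₂ hP₂
  rw [hW] at hT₂
  rw [← hD] at hP₂
  have hd₂ : σ₂.reg .d = d := (hF₂.1 .d (by decide)).trans hd₁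
  have hv₂ : σ₂.reg .v = v := (hF₂.1 .v (by decide)).trans hv₁
  have hf₂ : σ₂.arr .off = f := (hF₂.2 .off (by decide)).trans hf₁
  have ho₂ : σ₂.arr .ooff = o := (hF₂.2 .ooff (by decide)).trans ho₁
  have hh₂ : σ₂.arr .oadj = σ.arr .oadj := (hF₂.2 .oadj (by decide)).trans hh₁
  have hg₂ : σ₂.arr .adj = σ.arr .adj := (hF₂.2 .adj (by decide)).trans hg₁
  have hl₂ : σ₂.arr .loc = σ₁.arr .loc := (hF₂.2 .loc (by decide))
  refine wp_seq (wp_store (by simp; omega) (by simp) (by simp) ?_)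
  refine wp_seq (wp_forRange (fun i T τ => T ≤ 1 + 4 * i ∧
    τ.arr .eoff i = ∑ j ∈ range i, edgeCount D j ∧
    ∀ j < i, τ.arr .ecur j = τ.arr .eoff j ∧ τ.arr .eoff j = ∑ j ∈ range j, edgeCount D j) 0 d
    (by simp) (by simp) (Nat.zero_le _) ?_ (by decide) (by simp) ?_ ?_)
  · intro i T τ _ _ hi hF _
    simp [hF.1 .d (by decide), hd₂]
  · rintro i T τ - hid hi hF ⟨hT, hP, hP'⟩
    have h1 : τ.arr .edeg = σ₂.arr .edeg := hF.2 .edeg (by decide)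
    refine wp_seq (wp_store (by simp [hi]; omega) (by simp) (by simp [hi]; omega)
      (wp_store (by simp [hi]; omega) (by simp) (by simp [hi]; omega) ?_))
    simp only [Expr.eval_get, Expr.eval_var, Expr.eval_add, Expr.eval_ofNat, hi, h1,
      State.setReg_arr, State.setCell_arr_same, ne_eq, reduceCtorEq, not_false_eq_true,
      State.setCell_arr_ne, State.setCell_reg, Function.update_self, sum_range_succ, hP₂ i hid, hP]
    refine ⟨by omega, trivial, fun j hj => ?_⟩
    rcases eq_or_ne j i with rfl | hne
    · rw [Function.update_self, Function.update_of_ne (by omega), hP]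
      exact ⟨rfl, rfl⟩
    · rw [Function.update_of_ne hne, Function.update_of_ne (by omega)]
      exact hP' j (by omega)
  rintro T₃ σ₃ - hF₃ ⟨hT₃, hP₃, hP₃'⟩
  have hd₃ : σ₃.reg .d = d := (hF₃.1 .d (by decide)).trans (by simp [hd₂])
  have hv₃ : σ₃.reg .v = v := (hF₃.1 .v (by decide)).trans (by simp [hv₂])
  have hf₃ : σ₃.arr .off = f := (hF₃.2 .off (by decide)).trans (by simp [hf₂])
  have ho₃ : σ₃.arr .ooff = o := (hF₃.2 .ooff (by decide)).trans (by simp [ho₂])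
  have hh₃ : σ₃.arr .oadj = σ.arr .oadj := (hF₃.2 .oadj (by decide)).trans (by simp [hh₂])
  have hg₃ : σ₃.arr .adj = σ.arr .adj := (hF₃.2 .adj (by decide)).trans (by simp [hg₂])
  have hl₃ : σ₃.arr .loc = σ₁.arr .loc := (hF₃.2 .loc (by decide)).trans (by simp [hl₂])
  generalize hq : σ₃.arr .eoff = q at *
  have hq' : ∀ j ≤ d, q j = ∑ j ∈ range j, edgeCount D j := fun j hj => by
    rcases hj.eq_or_lt with rfl | hj
    · exact hP₃
    · exact (hP₃' j hj).2
  have hqs : ∀ j < d, q (j + 1) = q j + edgeCount D j := fun j hj => by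
    rw [hq' _ hj, hq' _ hj.le, sum_range_succ]
  have hqmono : ∀ x y, x ≤ y → y ≤ d → q x ≤ q y := fun x y h1 h2 => by
    rw [hq' x (h1.trans h2), hq' y h2]
    exact sum_le_sum_of_subset (range_subset_range.2 h1)
  have hqd : q d = 2 * #D := (hq' d le_rfl).trans (sum_edgeCount hDlt)
  have hqlt : ∀ x < d, ∀ y < d, x < y → q x + edgeCount D x ≤ q y := fun x hx y hy hxy =>
    (hqs x hx).symm.trans_le (hqmono _ _ hxy hy.le)
  refine wp_seq (wp_forEgoEdges (S := Oriented R f) 4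
    (fun s τ => RowInv d q (τ.arr .ecur) (τ.arr .eadj) (edgeCount s)
      fun x y => (x, y) ∈ s ∨ (y, x) ∈ s) (by decide) hd₃ hv₃ ho₃ hh₃
    (fun i _ => by rw [hf₃, hg₃, ha]) hE (by rw [hl₃]; exact fun i hi => (hP₁ i hi).1)
    (by rwa [hl₃]) (by rw [hf₃]; omega) ?_ ?_ ?_ ?_)
  · refine ⟨fun i hi => by simp [(hP₃' i hi).1, edgeCount], fun i hi => by simp [(hP₃' i hi).1],
      fun i hi y => ?_⟩
    rw [(hP₃' i hi).1]
    simp only [notMem_empty, or_false, iff_false, not_exists, not_and]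
    intro q h1 h2
    omega
  · rintro s τ z b - h
    simpa using h
  · rintro s i j τ hF hij hs hnot hi hj hP
    obtain ⟨h1, h2, h3⟩ := mem_egoEdges.1 hij
    have hne : i ≠ j := by
      rintro rfl
      exact hR.irrefl _ h3.1
    -- The orientation is asymmetric, so neither end has been entered in the row of the other
    -- before.
    have hnot' : (j, i) ∉ s := fun h => h3.asymm (mem_egoEdges.1 (hs h)).2.2
    have hcl : ∀ x, edgeCount s x ≤ edgeCount D x := fun x =>
      add_le_add (card_le_card (filter_subset_filter _ hs))
        (card_le_card (filter_subset_filter _ hs))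
    obtain ⟨h4, h5⟩ := edgeCount_lt hnot (insert_subset hij hs)
    rw [← hD] at h4 h5
    have h6 := hP.cur i h1
    have h7 := hP.cur j h2
    have h8 := hqs i h1
    have h9 := hqs j h2
    have h10 := hqmono (i + 1) d h1 le_rfl
    have h11 := hqmono (j + 1) d h2 le_rfl
    -- One oriented edge yields two entries: `j` in the row of `i`, then `i` in the row of `j`.
    have hp₁ := hP.push hqlt (fun x _ => hcl x) h1 h4 (y := j) (by simp [hnot, hnot'])
    have hp₂ := hp₁.push hqlt (fun x _ => ?_) h2 (by simpa [hne.symm] using h5) (y := i)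
      (by simp [hnot, hnot', hne.symm])
    rotate_left
    · split_ifs with h
      · rw [h]
        exact h4
      · exact hcl x
    rw [Function.update_of_ne hne.symm] at hp₂
    refine wp_seq (wp_store (by simp [hi]; omega) (by simp [hi]; omega) (by simp) ?_)
    refine wp_seq (wp_store (by simp [hi]; omega) (by simp) (by simp [hi]; omega) ?_)
    refine wp_seq (wp_store (by simp [hi, hj, hne.symm]; omega) (by simp [hj]; omega) (by simp) ?_)
    refine wp_store (by simp [hj]; omega) (by simp) (by simp [hj]; omega) ?_
    simp only [Expr.eval_get, Expr.eval_var, Expr.eval_add, Expr.eval_ofNat, hi, hj,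
      State.setCell_arr_same, State.setCell_reg, ne_eq, reduceCtorEq, not_false_eq_true,
      State.setCell_arr_ne, Function.update_of_ne hne.symm]
    refine ⟨by omega, ?_⟩
    convert hp₂ using 1
    · funext x
      exact edgeCount_insert hnot x
    · funext x y
      simp only [mem_insert, Prod.mk.injEq, eq_iff_iff]
      tauto
  rintro T₄ σ₄ hF₄ hT₄ hP₄
  rw [hW] at hT₄
  rw [← hD] at hP₄
  have hd₄ : σ₄.reg .d = d := (hF₄.1 .d (by decide)).trans hd₃
  have hv₄ : σ₄.reg .v = v := (hF₄.1 .v (by decide)).trans hv₃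
  have hf₄ : σ₄.arr .off = f := (hF₄.2 .off (by decide)).trans hf₃
  have hg₄ : σ₄.arr .adj = σ.arr .adj := (hF₄.2 .adj (by decide)).trans hg₃
  have hl₄ : σ₄.arr .loc = σ₁.arr .loc := (hF₄.2 .loc (by decide)).trans hl₃
  have hq₄ : σ₄.arr .eoff = q := (hF₄.2 .eoff (by decide)).trans hq
  -- Any cell of `loc` that is still nonzero belongs to a neighbour whose label is at least `i`; at
  -- the end there is none.
  refine wp_forRange (fun i T τ => T ≤ 1 + 3 * i ∧
    ∀ u < M, 0 < τ.arr .loc u → ∃ j, i ≤ j ∧ j < d ∧ a j = u) 0 d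
    (by simp) (by simp) (Nat.zero_le _) ?_ (by decide) ?_ ?_ ?_
  · intro i T τ _ _ hi hF _
    simp [hF.1 .d (by decide), hd₄]
  · simpa [hl₄] using hP₁'
  · rintro i T τ - hid hi hF ⟨hT, hP⟩
    have h1 : τ.reg .v = v := (hF.1 .v (by decide)).trans hv₄
    have h2 : τ.arr .off = f := (hF.2 .off (by decide)).trans hf₄
    have h3 : τ.arr .adj = σ.arr .adj := (hF.2 .adj (by decide)).trans hg₄
    have h4 := hE.lt i hid
    refine wp_store (by simp [h1, h2, h3, hi, ha]; omega) (by simp [h1, h2, hi]; omega)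
      (by simp) ?_
    simp only [Expr.eval_get, Expr.eval_var, Expr.eval_add, Expr.eval_ofNat, h1, h2, h3, hi, ha,
      State.setReg_arr, State.setCell_arr_same]
    refine ⟨by omega, fun u hu h => ?_⟩
    rw [Function.update_apply] at h
    split_ifs at h with hua
    · exact absurd h (lt_irrefl 0)
    · obtain ⟨j, h5, h6, h7⟩ := hP u hu h
      refine ⟨j, lt_of_le_of_ne h5 ?_, h6, h7⟩
      rintro rfl
      exact hua h7.symm
  · rintro T τ - hF ⟨hT, hP⟩
    have h1 : τ.arr .eoff = q := (hF.2 .eoff (by decide)).trans hq₄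
    have h2 : τ.arr .eadj = σ₄.arr .eadj := hF.2 .eadj (by decide)
    refine ⟨by omega, (hF.1 .d (by decide)).trans hd₄, ?_, by rw [h1]; omega, fun u hu => ?_⟩
    · rw [h1, h2]
      refine ⟨by simp [hq' 0], fun x hx => by rw [hqs x hx]; omega, fun x hx => ?_, fun x hx y => ?_⟩
      · rw [hqs x hx, ← hP₄.cur x hx]
        exact hP₄.inj x hx
      · rw [hqs x hx, ← hP₄.cur x hx, hP₄.mem x hx, mem_egoEdges, mem_egoEdges, egoRel,
          hR.oriented_or f]
        tauto
    · by_contra! h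
      obtain ⟨j, h3, h4, -⟩ := hP u hu (Nat.pos_of_ne_zero h)
      omega

/-! ## The components of the vertices of equal coreness -/

section Levels

variable {α : Type*} (E : α → α → Prop) (κ : α → ℕ) (t : ℕ)

/-- Adjacency of two vertices of coreness `t`. -/
def LevelAdj (x y : α) : Prop := E x y ∧ κ x = t ∧ κ y = t

/-- The component of `u` among the vertices of coreness `t`. -/
def levelComp (u : α) : Set α := {y | Relation.ReflTransGen (LevelAdj E κ t) u y}

/-- There is no edge from `s` to a vertex of coreness above `t`. -/
def IsTop (s : Set α) : Prop := ∀ y ∈ s, ∀ z, E y z → κ z ≤ t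

/-- The components, among the vertices of coreness `t`, of the elements of `D` that have no edge to
a vertex of larger coreness. -/
def topComps (D : Set α) : Set (Set α) :=
  {s | ∃ u ∈ D, κ u = t ∧ levelComp E κ t u = s ∧ IsTop E κ t s}

variable {E κ t}

theorem mem_levelComp_self (u : α) : u ∈ levelComp E κ t u := Relation.ReflTransGen.refl

theorem levelComp_eq (hE : ∀ {x y}, E x y → E y x) {u y : α} (h : y ∈ levelComp E κ t u) :
    levelComp E κ t y = levelComp E κ t u := by
  have hs : Relation.ReflTransGen (LevelAdj E κ t) y u :=
    (@Relation.ReflTransGen.stdSymm _ _ ⟨fun x y h => ⟨hE h.1, h.2.2, h.2.1⟩⟩).symm _ _ h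
  ext z
  exact ⟨fun hz => Relation.ReflTransGen.trans h hz, fun hz => Relation.ReflTransGen.trans hs hz⟩

theorem levelComp_level {u y : α} (hu : κ u = t) (h : y ∈ levelComp E κ t u) : κ y = t := by
  rcases Relation.ReflTransGen.cases_tail h with rfl | ⟨z, -, hz⟩
  · exact hu
  · exact hz.2.2

theorem levelComp_subset {u : α} {s : Set α} (hu : u ∈ s)
    (hs : ∀ x ∈ s, ∀ y, LevelAdj E κ t x y → y ∈ s) : levelComp E κ t u ⊆ s := by
  intro y hy
  induction hy with
  | refl => exact hu
  | tail _ h ih => exact hs _ ih _ h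

end Levels

/-! ### Breadth-first search inside one level -/

/-- The marked vertices. -/
def visitedSet (d : ℕ) (vis : ℕ → ℕ) : Finset ℕ := {x ∈ range d | vis x ≠ 0}

theorem mem_visitedSet {d : ℕ} {vis : ℕ → ℕ} {x : ℕ} : x ∈ visitedSet d vis ↔ x < d ∧ vis x ≠ 0 := by
  simp [visitedSet]

theorem visitedSet_update {d : ℕ} (vis : ℕ → ℕ) {y : ℕ} (hy : y < d) :
    visitedSet d (Function.update vis y 1) = insert y (visitedSet d vis) := by
  ext x
  simp only [mem_visitedSet, mem_insert, Function.update_apply]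
  split_ifs with h
  · simp [h, hy]
  · simp [h]

section Program

open Var Arr Test Cmd

/-- The breadth-first search of the component of `u` among the vertices of coreness `t`. -/
def visitComponent : Cmd :=
  .seq (store visited u 1) <| .seq (store queue tail u) <| .seq (assign tail (tail + 1)) <|
  loop (lt head tail) <| .seq (assign x (queue head)) <| .seq (assign head (head + 1)) <|
  forRange e (eoff x) (eoff (x + 1)) <| .seq (assign y (eadj e)) <|
  branch (eq (ecore y) t)
    (branch (eq (visited y) 0)
      (.seq (store queue tail y) (.seq (assign tail (tail + 1)) (store visited y 1)))
      skip)
    (branch (lt t (ecore y)) (assign flag 0) skip)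

end Program

/-- The invariant of the breadth-first search: `V` is the set of the marked vertices, `V₀` its
initial value, and the places from `#V₀` to `head` of the queue have been processed, apart from the
neighbours in `N` of the last of them. -/
structure BFSInv (E : ℕ → ℕ → Prop) (κ : ℕ → ℕ) (t u : ℕ) (V₀ : Finset ℕ) (head tail flag : ℕ)
    (queue : ℕ → ℕ) (V : Finset ℕ) (N : ℕ → ℕ → Prop) : Prop where
  sub : V₀ ⊆ V
  mem : u ∈ V
  comp : ∀ x ∈ V, x ∉ V₀ → x ∈ levelComp E κ t u
  le : #V₀ ≤ head
  head_le : head ≤ tail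
  card : tail = #V
  new : ∀ x, x ∈ V ∧ x ∉ V₀ ↔ ∃ q, #V₀ ≤ q ∧ q < tail ∧ queue q = x
  inj : Set.InjOn queue (Set.Ico #V₀ tail)
  adj : ∀ q, #V₀ ≤ q → q < head → ∀ y, N q y → κ y = t → y ∈ V
  flag : flag = 1 ↔ ∀ q, #V₀ ≤ q → q < head → ∀ y, N q y → κ y ≤ t

/-- The marked set `V₀` is closed under adjacency inside the level, so the component of `u` is
disjoint from it. The queue has one cell per marked vertex and is never reset, hence `head` and
`tail` start and end at the number of marked vertices. The time is charged to the newly marked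
vertices and their degrees. -/
theorem wp_visitComponent {K d t u : ℕ} {E : ℕ → ℕ → Prop} {κ f g : ℕ → ℕ} {σ : State}
    {V₀ : Finset ℕ} (hf : σ.arr .eoff = f) (hg : σ.arr .eadj = g) (hκ : σ.arr .ecore = κ)
    (ht : σ.reg .t = t) (hu : σ.reg .u = u) (hud : u < d) (hut : κ u = t)
    (hV₀ : visitedSet d (σ.arr .visited) = V₀) (huV : u ∉ V₀) (hhead : σ.reg .head = #V₀)
    (htail : σ.reg .tail = #V₀) (hflag : σ.reg .flag = 1)
    (hcl : ∀ x ∈ V₀, ∀ y, LevelAdj E κ t x y → y ∈ V₀)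
    (hL : Lists d f g E) (hE : IsGraph d E) (hK : d < K) (hK' : f d ≤ K) :
    wp K visitComponent (fun T τ =>
      T ≤ 10 + ∑ x ∈ visitedSet d (τ.arr .visited) \ V₀, (10 + 10 * (f (x + 1) - f x)) ∧
      (∀ x, x ∈ visitedSet d (τ.arr .visited) ↔ x ∈ V₀ ∨ x ∈ levelComp E κ t u) ∧
      τ.reg .head = #(visitedSet d (τ.arr .visited)) ∧
      τ.reg .tail = #(visitedSet d (τ.arr .visited)) ∧
      (τ.reg .flag = 1 ↔ IsTop E κ t (levelComp E κ t u))) σ := by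
  have hcard : ∀ vis, #(visitedSet d vis) ≤ d := fun vis =>
    (card_filter_le _ _).trans_eq (card_range d)
  have hV₀d : #V₀ < d := by
    have h1 : V₀ ⊂ range d := by
      rw [ssubset_iff_of_subset (hV₀ ▸ filter_subset _ _)]
      exact ⟨u, by simpa using hud, huV⟩
    simpa using card_lt_card h1
  have hsymm : ∀ {x y}, LevelAdj E κ t x y → LevelAdj E κ t y x := fun h =>
    ⟨hE.symm h.1, h.2.2, h.2.1⟩
  unfold visitComponent
  refine wp_seq (wp_store (by simp [hu]; omega) (by simp) (by simp) ?_)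
  refine wp_seq (wp_store (by simp [htail]; omega) (by simp) (by simp) ?_)
  refine wp_seq (wp_assign (by simp) ?_)
  simp only [Expr.eval_var, Expr.eval_add, Expr.eval_ofNat, State.setCell_reg, hu, htail]
  refine wp_loop (fun T τ => BFSInv E κ t u V₀ (τ.reg .head) (τ.reg .tail) (τ.reg .flag)
      (τ.arr .queue) (visitedSet d (τ.arr .visited)) (fun q y => E (τ.arr .queue q) y) ∧
      T ≤ ∑ q ∈ Ico #V₀ (τ.reg .head),
        (10 + 10 * (f (τ.arr .queue q + 1) - f (τ.arr .queue q))))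
    (fun τ => d - τ.reg .head) ?_ ?_ ?_ ?_
  · simp only [State.setReg_reg_same, ne_eq, reduceCtorEq, not_false_eq_true, State.setReg_reg_ne,
      State.setCell_reg, hhead, hflag, State.setReg_arr, State.setCell_arr_same,
      State.setCell_arr_ne, visitedSet_update _ hud, hV₀]
    refine ⟨⟨subset_insert _ _, mem_insert_self _ _, fun x hx hx' => ?_, le_rfl, by omega,
      (card_insert_of_notMem huV).symm, fun x => ?_, ?_, fun q h1 h2 => by omega,
      by simp; intros; omega⟩, by simp⟩
    · rw [(mem_insert.1 hx).resolve_right hx']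
      exact mem_levelComp_self u
    · rw [exists_update_iff le_rfl]
      constructor
      · rintro ⟨hx, hx'⟩
        exact .inr ((mem_insert.1 hx).resolve_right hx').symm
      · rintro (⟨q, h1, h2, -⟩ | rfl)
        · omega
        · exact ⟨mem_insert_self _ _, huV⟩
    · exact injOn_update (by simp) (by rintro ⟨e, h1, h2, -⟩; omega)
  · rintro T τ hF ⟨hI, hT⟩
    simp
  · rintro T τ hF ⟨hI, hT⟩ hlt
    have hlt : τ.reg .head < τ.reg .tail := by simpa using hlt
    have hfτ : τ.arr .eoff = f := (hF.2 .eoff (by decide)).trans (by simp [hf])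
    have hgτ : τ.arr .eadj = g := (hF.2 .eadj (by decide)).trans (by simp [hg])
    have hκτ : τ.arr .ecore = κ := (hF.2 .ecore (by decide)).trans (by simp [hκ])
    have htτ : τ.reg .t = t := (hF.1 .t (by decide)).trans (by simp [ht])
    have htd := hI.card.trans_le (hcard _)
    generalize hh : τ.reg .head = h at *
    generalize hx : τ.arr .queue h = x at *
    have hxV := (hI.new x).2 ⟨h, hI.le, hlt, hx⟩
    have hxd : x < d := (mem_visitedSet.1 hxV.1).1
    have hxc := hI.comp x hxV.1 hxV.2
    have hxt := levelComp_level hut hxc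
    have hfd : f (x + 1) ≤ f d := hL.src_le hxd le_rfl
    refine wp_seq (wp_assign (by simp [hh]; omega) (wp_seq (wp_assign (by simp) ?_)))
    simp only [Expr.eval_get, Expr.eval_var, Expr.eval_add, Expr.eval_ofNat, hh, hx, ne_eq,
      reduceCtorEq, not_false_eq_true, State.setReg_reg_ne]
    -- The queue entry at `h` is half processed: only the neighbours before place `e` of its list
    -- count as treated.
    refine wp_forRange (fun e T τ₁ => T ≤ 1 + 8 * (e - f x) ∧ τ₁.reg .head = h + 1 ∧
      τ₁.arr .queue h = x ∧ (∀ q, #V₀ ≤ q → q < h → τ₁.arr .queue q = τ.arr .queue q) ∧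
      BFSInv E κ t u V₀ (τ₁.reg .head) (τ₁.reg .tail) (τ₁.reg .flag)
        (τ₁.arr .queue) (visitedSet d (τ₁.arr .visited))
        (fun q y => if q = h then ∃ e', f x ≤ e' ∧ e' < e ∧ g e' = y else E (τ.arr .queue q) y))
      (f x) (f (x + 1)) (by simp; omega) (by simp [hfτ]) (hL.mono x hxd) ?_ (by decide) ?_ ?_ ?_
    · intro e T₁ τ₁ _ _ _ hF₁ _
      have h1 : τ₁.reg .x = x := (hF₁.1 .x (by decide)).trans (by simp)
      have h2 : τ₁.arr .eoff = f := (hF₁.2 .eoff (by decide)).trans (by simp [hfτ])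
      simp [h1, h2]
      omega
    · simp only [State.setReg_reg_same, ne_eq, reduceCtorEq, not_false_eq_true,
        State.setReg_reg_ne, State.setReg_arr]
      refine ⟨by omega, trivial, hx, fun _ _ _ => trivial, hI.sub, hI.mem, hI.comp,
        hI.le.trans (Nat.le_succ h), hlt, hI.card, hI.new, hI.inj, fun q h1 h2 y => ?_, ?_⟩
      · split_ifs with h3
        · rintro ⟨e', h4, h5, -⟩
          omega
        · exact hI.adj q h1 (by omega) y
      · rw [hI.flag]
        constructor
        · intro h1 q h2 h3 y
          split_ifs with h4
          · rintro ⟨e', h4, h5, -⟩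
            omega
          · exact h1 q h2 (by omega) y
        · intro h1 q h2 h3 y
          have := h1 q h2 (by omega) y
          rwa [if_neg h3.ne] at this
    · rintro e T₁ τ₁ he₁ he₂ he hF₁ ⟨hT₁, hh₁, hqh, hq, hI₁⟩
      have h2 : τ₁.arr .eadj = g := (hF₁.2 .eadj (by decide)).trans (by simp [hgτ])
      have h3 : τ₁.arr .ecore = κ := (hF₁.2 .ecore (by decide)).trans (by simp [hκτ])
      have h4 : τ₁.reg .t = t := (hF₁.1 .t (by decide)).trans (by simp [htτ])
      have hxy : E x (g e) := hL.rel hxd he₁ he₂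
      have hyd := hE.lt' hxy
      have hN : ∀ q y, (if q = h then ∃ e', f x ≤ e' ∧ e' < e + 1 ∧ g e' = y
          else E (τ.arr .queue q) y) ↔ (if q = h then ∃ e', f x ≤ e' ∧ e' < e ∧ g e' = y
          else E (τ.arr .queue q) y) ∨ q = h ∧ y = g e := by
        intro q y
        split_ifs with h5
        · rw [exists_lt_succ_iff he₁]
          simp [h5, eq_comm]
        · simp [h5]
      have htd₁ := hI₁.card.trans_le (hcard _)
      refine wp_seq (wp_assign (by simp [he]; omega) ?_)
      simp only [Expr.eval_get, Expr.eval_var, he, h2]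
      generalize g e = y at *
      refine wp_branch (by simp; omega) ?_ ?_
      · intro hy
        have hy : κ y = t := by simpa [h3, h4] using hy
        have hflag' : ∀ V : Finset ℕ, y ∈ V → visitedSet d (τ₁.arr .visited) ⊆ V →
            (∀ q, #V₀ ≤ q → q < τ₁.reg .head → ∀ z, ((if q = h then
              ∃ e', f x ≤ e' ∧ e' < e + 1 ∧ g e' = z else E (τ.arr .queue q) z)) → κ z = t → z ∈ V) ∧
            (τ₁.reg .flag = 1 ↔ ∀ q, #V₀ ≤ q → q < τ₁.reg .head → ∀ z, ((if q = h then
              ∃ e', f x ≤ e' ∧ e' < e + 1 ∧ g e' = z else E (τ.arr .queue q) z)) → κ z ≤ t) := by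
          intro V hyV hV
          constructor
          · intro q h5 h6 z hz hzt
            rcases (hN q z).1 hz with hz | ⟨-, rfl⟩
            · exact hV (hI₁.adj q h5 h6 z hz hzt)
            · exact hyV
          · rw [hI₁.flag]
            refine forall_congr' fun q => forall_congr' fun _ => forall_congr' fun _ =>
              forall_congr' fun z => ?_
            rw [hN, or_imp, iff_self_and]
            rintro - ⟨-, rfl⟩
            exact hy.le
        have hLA : LevelAdj E κ t x y := ⟨hxy, hxt, hy⟩
        refine wp_branch (by simp; omega) ?_ ?_
        · intro hvis
          have hvis : y ∉ visitedSet d (τ₁.arr .visited) := fun h =>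
            (mem_visitedSet.1 h).2 (by simpa using hvis)
          have hcard₁ := card_insert_of_notMem hvis
          have := hcard (Function.update (τ₁.arr .visited) y 1)
          rw [visitedSet_update _ hyd, hcard₁] at this
          have htail₁ := hI₁.card
          refine wp_seq (wp_store (by simp; omega) (by simp) (by simp) ?_)
          refine wp_seq (wp_assign (by simp) (wp_store (by simp; omega) (by simp) (by simp) ?_))
          simp only [Expr.eval_var, Expr.eval_add, Expr.eval_ofNat, State.setReg_reg_same,
            ne_eq, reduceCtorEq, not_false_eq_true, State.setReg_reg_ne, State.setReg_arr,
            State.setCell_reg, State.setCell_arr_same, State.setCell_arr_ne,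
            visitedSet_update _ hyd]
          have hle := hI₁.head_le
          have hV₀le := hI₁.le
          refine ⟨by omega, hh₁, ?_, fun q h5 h6 => ?_, hI₁.sub.trans (subset_insert _ _),
            mem_insert_of_mem hI₁.mem, fun z hz hz' => ?_, hI₁.le, by omega, by omega, fun z => ?_,
            injOn_update hI₁.inj ?_, (hflag' _ (mem_insert_self _ _) (subset_insert _ _)).1,
            (hflag' _ (mem_insert_self _ _) (subset_insert _ _)).2⟩
          · rw [Function.update_of_ne (by omega), hqh]
          · rw [Function.update_of_ne (by omega), hq q h5 h6]
          · rcases mem_insert.1 hz with rfl | hz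
            · exact Relation.ReflTransGen.tail hxc hLA
            · exact hI₁.comp z hz hz'
          · rw [exists_update_iff (by omega), ← hI₁.new, mem_insert]
            constructor
            · rintro ⟨rfl | h5, h6⟩
              · exact .inr rfl
              · exact .inl ⟨h5, h6⟩
            · rintro (⟨h5, h6⟩ | rfl)
              · exact ⟨.inr h5, h6⟩
              · exact ⟨.inl rfl, fun h => hvis (hI₁.sub h)⟩
          · rw [← hI₁.new]
            exact fun h => hvis h.1
        · intro hvis
          have hvis : y ∈ visitedSet d (τ₁.arr .visited) :=
            mem_visitedSet.2 ⟨hyd, by simpa using hvis⟩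
          refine wp_skip ?_
          simp only [ne_eq, reduceCtorEq, not_false_eq_true, State.setReg_reg_ne, State.setReg_arr]
          obtain ⟨h5, h6⟩ := hflag' _ hvis subset_rfl
          exact ⟨by omega, hh₁, hqh, hq, hI₁.sub, hI₁.mem, hI₁.comp, hI₁.le, hI₁.head_le, hI₁.card,
            hI₁.new, hI₁.inj, h5, h6⟩
      · intro hy
        have hy : κ y ≠ t := by simpa [h3, h4] using hy
        have hadj' : ∀ q, #V₀ ≤ q → q < τ₁.reg .head → ∀ z, ((if q = h then
            ∃ e', f x ≤ e' ∧ e' < e + 1 ∧ g e' = z else E (τ.arr .queue q) z)) → κ z = t →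
            z ∈ visitedSet d (τ₁.arr .visited) := by
          intro q h5 h6 z hz hzt
          rcases (hN q z).1 hz with hz | ⟨-, rfl⟩
          · exact hI₁.adj q h5 h6 z hz hzt
          · exact absurd hzt hy
        refine wp_branch (by simp; omega) ?_ ?_
        · intro hlt
          have hlt : t < κ y := by simpa [h3, h4] using hlt
          refine wp_assign (by simp) ?_
          simp only [ne_eq, reduceCtorEq, not_false_eq_true, State.setReg_reg_ne, State.setReg_arr,
            Expr.eval_ofNat, State.setReg_reg_same]
          refine ⟨by omega, hh₁, hqh, hq, hI₁.sub, hI₁.mem, hI₁.comp, hI₁.le, hI₁.head_le,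
            hI₁.card, hI₁.new, hI₁.inj, hadj', ?_⟩
          simp only [zero_ne_one, false_iff]
          intro h5
          have := h5 h hI.le (by omega) y ((hN h y).2 (.inr ⟨rfl, rfl⟩))
          omega
        · intro hlt
          have hlt : κ y ≤ t := by simpa [h3, h4] using hlt
          refine wp_skip ?_
          simp only [ne_eq, reduceCtorEq, not_false_eq_true, State.setReg_reg_ne, State.setReg_arr]
          refine ⟨by omega, hh₁, hqh, hq, hI₁.sub, hI₁.mem, hI₁.comp, hI₁.le, hI₁.head_le,
            hI₁.card, hI₁.new, hI₁.inj, hadj', ?_⟩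
          rw [hI₁.flag]
          refine forall_congr' fun q => forall_congr' fun _ => forall_congr' fun _ =>
              forall_congr' fun z => ?_
          rw [hN, or_imp, iff_self_and]
          rintro - ⟨-, rfl⟩
          exact hlt
    · rintro T₁ τ₁ - hF₁ ⟨hT₁, hh₁, hqh, hq, hI₁⟩
      have hle := hI.le
      have hN : ∀ q, #V₀ ≤ q → q < h + 1 → ∀ y, E (τ₁.arr .queue q) y ↔
          if q = h then ∃ e', f x ≤ e' ∧ e' < f (x + 1) ∧ g e' = y else E (τ.arr .queue q) y := by
        intro q h1 h2 y
        split_ifs with h3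
        · rw [h3, hqh, hL.mem x hxd]
        · rw [hq q h1 (by omega)]
      have hadj := hI₁.adj
      have hflag := hI₁.flag
      simp only [hh₁] at hadj hflag ⊢
      refine ⟨⟨⟨hI₁.sub, hI₁.mem, hI₁.comp, by omega, hh₁ ▸ hI₁.head_le, hI₁.card, hI₁.new, hI₁.inj,
        fun q h1 h2 y hy => hadj q h1 h2 y ((hN q h1 h2 y).1 hy), ?_⟩, ?_⟩, by omega⟩
      · rw [hflag]
        refine forall_congr' fun q => forall_congr' fun h1 => forall_congr' fun h2 =>
              forall_congr' fun z => ?_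
        rw [hN q h1 h2 z]
      · rw [sum_Ico_succ_top hle, hqh, sum_congr rfl fun q h1 => by
          rw [hq q (mem_Ico.1 h1).1 (mem_Ico.1 h1).2]]
        omega
  · rintro T τ hF ⟨hI, hT⟩ hge
    have hge : τ.reg .tail ≤ τ.reg .head := by simpa using hge
    have heq : τ.reg .head = τ.reg .tail := le_antisymm hI.head_le hge
    have hadj := hI.adj
    have hflag := hI.flag
    rw [heq] at hadj hflag hT
    -- With the queue exhausted, the new vertices contain `u` and are closed under adjacency in the
    -- level: a neighbour in `V₀` would force its partner into `V₀` by symmetry.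
    have hcomp : levelComp E κ t u ⊆ {x | x ∈ visitedSet d (τ.arr .visited) ∧ x ∉ V₀} := by
      refine levelComp_subset ⟨hI.mem, huV⟩ fun x hx y hxy => ⟨?_, fun hy => hx.2 ?_⟩
      · obtain ⟨q, h1, h2, rfl⟩ := (hI.new x).1 hx
        exact hadj q h1 h2 y hxy.1 hxy.2.2
      · exact hcl y hy x (hsymm hxy)
    have hiff : ∀ x, (x ∈ visitedSet d (τ.arr .visited) ∧ x ∉ V₀) ↔ x ∈ levelComp E κ t u :=
      fun x => ⟨fun h => hI.comp x h.1 h.2, fun h => hcomp h⟩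
    refine ⟨?_, fun x => ?_, heq.trans hI.card, hI.card, ?_⟩
    · have himg : visitedSet d (τ.arr .visited) \ V₀ =
          (Ico #V₀ (τ.reg .tail)).image (τ.arr .queue) := by
        ext x
        rw [mem_sdiff, hI.new]
        simp [and_assoc]
      rw [himg, sum_image (by simpa using hI.inj)]
      omega
    · rw [← hiff]
      have := @hI.sub x
      tauto
    · rw [hflag]
      constructor
      · intro h1 y hy z hyz
        obtain ⟨q, h2, h3, rfl⟩ := (hI.new y).1 ((hiff y).2 hy)
        exact h1 q h2 h3 z hyz
      · intro h1 q h2 h3 z hz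
        exact h1 _ ((hiff _).1 ((hI.new _).2 ⟨q, h2, h3, rfl⟩)) z hz

/-- Sequencing is nested to the right, so the four commands of the search are no subterm of the
program. Time and touched cells do not depend on the bracketing. -/
theorem wp_seq_four {K : ℕ} {c₁ c₂ c₃ c₄ c₅ : Cmd} {Q : ℕ → State → Prop} {σ : State}
    (h : wp K (.seq c₁ (.seq c₂ (.seq c₃ c₄)))
      (fun T τ => wp K c₅ (fun T' ρ => Q (T + T') ρ) τ) σ) :
    wp K (.seq c₁ (.seq c₂ (.seq c₃ (.seq c₄ c₅)))) Q σ := by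
  obtain ⟨T, M, τ, hE, hM, T', M', ρ, hE', hM', hQ⟩ := h
  obtain _ | _ | _ | ⟨h₁, hE⟩ := hE
  obtain _ | _ | _ | ⟨h₂, hE⟩ := hE
  obtain _ | _ | _ | ⟨h₃, h₄⟩ := hE
  refine ⟨_, _, _, .seq h₁ (.seq h₂ (.seq h₃ (.seq h₄ hE'))), ?_, ?_⟩
  · simp only [ok_union] at hM ⊢
    tauto
  · simpa only [add_assoc] using hQ

section Levels

variable {α : Type*} {E : α → α → Prop} {κ : α → ℕ} {t : ℕ}

theorem topComps_finite (E : α → α → Prop) (κ : α → ℕ) (t : ℕ) {D : Set α} (hD : D.Finite) :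
    (topComps E κ t D).Finite := by
  refine (hD.image (levelComp E κ t)).subset ?_
  rintro s ⟨u, hu, -, rfl, -⟩
  exact ⟨u, hu, rfl⟩

theorem topComps_eq_empty {D : Set α} (hD : ∀ x ∈ D, κ x ≠ t) : topComps E κ t D = ∅ := by
  rw [Set.eq_empty_iff_forall_notMem]
  rintro s ⟨u, hu, h, -⟩
  exact hD u hu h

theorem topComps_congr {D D' : Set α} (h : ∀ x, κ x = t → (x ∈ D ↔ x ∈ D')) :
    topComps E κ t D = topComps E κ t D' := by
  ext s
  refine exists_congr fun u => ?_
  constructor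
  · rintro ⟨h1, h2, h3⟩
    exact ⟨(h u h2).1 h1, h2, h3⟩
  · rintro ⟨h1, h2, h3⟩
    exact ⟨(h u h2).2 h1, h2, h3⟩

/-- The set `V` is a union of components as far as the level is concerned, so the component of `u`
is not among those met by `V`; adding it raises the count by one exactly when it has no edge
upwards. -/
theorem ncard_topComps_union [DecidableEq α] (hE : ∀ {x y}, E x y → E y x) {V V' : Finset α} {u : α}
    (hu : κ u = t) (huV : u ∉ V) (hcl : ∀ x ∈ V, ∀ y, LevelAdj E κ t x y → y ∈ V)
    (hV' : ∀ x, x ∈ V' ↔ x ∈ V ∨ x ∈ levelComp E κ t u) :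
    (IsTop E κ t (levelComp E κ t u) →
      (topComps E κ t (V' : Set α)).ncard = (topComps E κ t (V : Set α)).ncard + 1) ∧
    (¬ IsTop E κ t (levelComp E κ t u) →
      (topComps E κ t (V' : Set α)).ncard = (topComps E κ t (V : Set α)).ncard) := by
  have key : ∀ s, s ∈ topComps E κ t (V' : Set α) ↔ s ∈ topComps E κ t (V : Set α) ∨
      s = levelComp E κ t u ∧ IsTop E κ t (levelComp E κ t u) := by
    intro s
    constructor
    · rintro ⟨v, hv, hvt, rfl, hs⟩
      rcases (hV' v).1 hv with h | h
      · exact .inl ⟨v, h, hvt, rfl, hs⟩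
      · rw [levelComp_eq hE h] at hs ⊢
        exact .inr ⟨rfl, hs⟩
    · rintro (⟨v, hv, h⟩ | ⟨rfl, h⟩)
      · exact ⟨v, (hV' v).2 (.inl hv), h⟩
      · exact ⟨u, (hV' u).2 (.inr (mem_levelComp_self u)), hu, rfl, h⟩
  constructor
  · intro h
    have hins : topComps E κ t (V' : Set α) =
        insert (levelComp E κ t u) (topComps E κ t (V : Set α)) := by
      ext s
      rw [key, Set.mem_insert_iff]
      tauto
    rw [hins, Set.ncard_insert_of_notMem _ (topComps_finite E κ t V.finite_toSet)]
    rintro ⟨v, hv, hvt, hvu, -⟩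
    refine huV (levelComp_subset (s := (V : Set α)) hv hcl ?_)
    rw [hvu]
    exact mem_levelComp_self u
  · intro h
    congr 1
    ext s
    rw [key]
    tauto

end Levels

/-- The levels are searched in ascending order from 1, each from the block of the sorted order that
holds its vertices. A vertex is marked at its own level only, so all searches together cost linear
time. -/
theorem wp_discriminativeDecomposition {K d : ℕ} {E : ℕ → ℕ → Prop} [DecidableRel E] {f : ℕ → ℕ}
    {σ : State} (hd : σ.reg .d = d) (hf : σ.arr .eoff = f)
    (hL : Lists d f (σ.arr .eadj) E) (hE : IsGraph d E) (hK : d < K) (hK' : f d ≤ K) :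
    wp K discriminativeDecomposition (fun T τ => T ≤ 150 * d + 30 * f d + 150 ∧
      ∃ κ, (∀ x < d, HasCoreness E x (κ x)) ∧ (∀ x < d, κ x ≤ τ.reg .tmax) ∧ τ.reg .tmax ≤ d ∧
        ∀ a, 1 ≤ a → a ≤ τ.reg .tmax → τ.arr .c a = (topComps E κ a (Set.Iio d)).ncard) σ := by
  unfold discriminativeDecomposition
  refine wp_seq ((wp_coreDecomposition (R := E) (by simp) (by simp) (by simp) (by simp)
    (by rwa [hd, hf]) (by rwa [hd]) (by rwa [hd]) (by rwa [hd, hf])).mono ?_)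
  rw [hd, hf]
  rintro T₁ σ₁ hF₁ ⟨hT₁, hcore⟩
  have hd₁ : σ₁.reg .d = d := (hF₁.1 .d (by decide)).trans hd
  have hf₁ : σ₁.arr .eoff = f := (hF₁.2 .eoff (by decide)).trans hf
  have hg₁ : σ₁.arr .eadj = σ.arr .eadj := (hF₁.2 .eadj (by decide))
  generalize hκ₁ : σ₁.arr .ecore = κ at *
  have hκd : ∀ x < d, κ x < d := by
    intro x hx
    have h1 := (hcore x hx).le_card (range d) fun y hy => mem_range.2 (hE.lt' hy)
    have h2 : #{y ∈ range d | E x y} < #(range d) := card_lt_card <| by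
      rw [ssubset_iff_of_subset (filter_subset _ _)]
      exact ⟨x, by simpa using hx, by simp [hE.irrefl x]⟩
    rw [card_range] at h2
    omega
  refine wp_seq (wp_assign (by simp) ?_)
  -- The strict bound `tmax < d` matters because the bin sort controls `bin` and `cnt` below `d`
  -- only. If `tmax = 0`, no level is searched.
  refine wp_seq (wp_forRange (fun i T τ => T ≤ 1 + 5 * i ∧
    (∀ j < i, τ.arr .visited j = 0 ∧ κ j ≤ τ.reg .tmax) ∧
    (τ.reg .tmax = 0 ∨ τ.reg .tmax < d)) 0 d
    (by simp) (by simp) (Nat.zero_le _) ?_ (by decide) (by simp) ?_ ?_)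
  · intro i T τ _ _ hi hF _
    simp [hF.1 .d (by decide), hd₁]
  · rintro i T τ - hid hi hF ⟨hT, hP, hP'⟩
    have h1 : τ.arr .ecore = κ := (hF.2 .ecore (by decide)).trans (by simp [hκ₁])
    have h2 := hκd i hid
    refine wp_seq (wp_store (by simp [hi]; omega) (by simp) (by simp) ?_)
    have key : ∀ j < i + 1, Function.update (τ.arr .visited) i 0 j = 0 := by
      intro j hj
      rw [Function.update_apply]
      split_ifs with h
      · rfl
      · exact (hP j (by omega)).1
    refine wp_branch (by simp [hi]; omega) ?_ ?_
    · intro hlt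
      have hlt : τ.reg .tmax < κ i := by simpa [hi, h1] using hlt
      refine wp_assign (by simp [hi]; omega) ?_
      simp only [Expr.eval_get, Expr.eval_var, Expr.eval_ofNat, State.setCell_reg, hi, ne_eq,
        reduceCtorEq, not_false_eq_true, State.setCell_arr_ne, h1, State.setReg_arr,
        State.setCell_arr_same, State.setReg_reg_ne, State.setReg_reg_same]
      refine ⟨by omega, fun j hj => ⟨key j hj, ?_⟩, .inr h2⟩
      rcases Nat.lt_succ_iff_lt_or_eq.1 hj with hj | rfl
      · exact (hP j hj).2.trans hlt.le
      · exact le_rfl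
    · intro hlt
      have hlt : κ i ≤ τ.reg .tmax := by simpa [hi, h1] using hlt
      refine wp_skip ?_
      simp only [Expr.eval_var, Expr.eval_ofNat, State.setCell_reg, hi, ne_eq,
        reduceCtorEq, not_false_eq_true, State.setReg_arr,
        State.setCell_arr_same, State.setReg_reg_ne]
      refine ⟨by omega, fun j hj => ⟨key j hj, ?_⟩, hP'⟩
      rcases Nat.lt_succ_iff_lt_or_eq.1 hj with hj | rfl
      · exact (hP j hj).2
      · exact hlt
  rintro T₂ σ₂ - hF₂ ⟨hT₂, hvis₂, htm₂⟩
  have hd₂ : σ₂.reg .d = d := (hF₂.1 .d (by decide)).trans (by simp [hd₁])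
  have hf₂ : σ₂.arr .eoff = f := (hF₂.2 .eoff (by decide)).trans (by simp [hf₁])
  have hg₂ : σ₂.arr .eadj = σ.arr .eadj := (hF₂.2 .eadj (by decide)).trans (by simp [hg₁])
  have hκ₂ : σ₂.arr .ecore = κ := (hF₂.2 .ecore (by decide)).trans (by simp [hκ₁])
  generalize htm : σ₂.reg .tmax = tm at *
  refine wp_seq ((wp_binSort (by simp) (by simp) (by simp) (by omega)
    (by simpa [hd₂, hκ₂] using hκd)).mono ?_)
  rw [hd₂, hκ₂]
  rintro T₃ σ₃ hF₃ ⟨hT₃, hc₃, hb₃, pos, hpos, hord, hiff⟩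
  have hd₃ : σ₃.reg .d = d := (hF₃.1 .d (by decide)).trans hd₂
  have htm₃ : σ₃.reg .tmax = tm := (hF₃.1 .tmax (by decide)).trans htm
  have hf₃ : σ₃.arr .eoff = f := (hF₃.2 .eoff (by decide)).trans hf₂
  have hg₃ : σ₃.arr .eadj = σ.arr .eadj := (hF₃.2 .eadj (by decide)).trans hg₂
  have hκ₃ : σ₃.arr .ecore = κ := (hF₃.2 .ecore (by decide)).trans hκ₂
  have hv₃ : ∀ x < d, σ₃.arr .visited x = 0 := by
    rw [hF₃.2 .visited (by decide)]
    exact fun x hx => (hvis₂ x hx).1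
  generalize hord₃ : σ₃.arr .eord = ord at *
  generalize hbin₃ : σ₃.arr .bin = bin at *
  generalize hcnt₃ : σ₃.arr .cnt = cnt at *
  -- The boundaries of the blocks, defined for every level; the array `bin` agrees with them only
  -- below `d`, while `t + 1` may equal `d`.
  obtain ⟨B, hB⟩ : ∃ B : ℕ → ℕ, ∀ a, B a = #{v ∈ range d | κ v < a} := ⟨_, fun _ => rfl⟩
  have hBs : ∀ a < d, B (a + 1) = bin a + cnt a := fun a ha => by
    rw [hB, hb₃ a ha, hc₃ a ha, card_filter_lt_succ d κ a]
  have hBd : ∀ a, B a ≤ d := fun a => by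
    rw [hB]
    exact (card_filter_le _ _).trans_eq (card_range d)
  simp only [← hB] at hiff hb₃
  refine wp_seq (wp_assign (by simp) (wp_seq (wp_assign (by simp) ?_)))
  simp only [Expr.eval_ofNat]
  refine wp_forRange (fun t T τ =>
    T ≤ 1 + 10 * (t - 1) + 20 * B t +
      ∑ x ∈ visitedSet d (τ.arr .visited), (10 + 10 * (f (x + 1) - f x)) ∧
    (∀ x, x ∈ visitedSet d (τ.arr .visited) ↔ x < d ∧ 1 ≤ κ x ∧ κ x < t) ∧
    τ.reg .head = #(visitedSet d (τ.arr .visited)) ∧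
    τ.reg .tail = #(visitedSet d (τ.arr .visited)) ∧
    ∀ a, 1 ≤ a → a < t → τ.arr .c a = (topComps E κ a (Set.Iio d)).ncard) 1 (tm + 1)
    (by simp) (by simp) (by omega) ?_ (by decide) ?_ ?_ ?_
  · intro t T τ _ _ _ hF _
    simp [hF.1 .tmax (by decide), htm₃]
  · have : visitedSet d (σ₃.arr .visited) = ∅ := by
      rw [eq_empty_iff_forall_notMem]
      intro x hx
      obtain ⟨h1, h2⟩ := mem_visitedSet.1 hx
      exact h2 (hv₃ x h1)
    simp only [State.setReg_arr, this, notMem_empty, false_iff, ne_eq, reduceCtorEq,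
      not_false_eq_true, State.setReg_reg_ne, State.setReg_reg_same, card_empty]
    exact ⟨by omega, fun x => by omega, trivial, trivial, fun a => by omega⟩
  · rintro t T τ ht₁ ht₂ ht hF ⟨hT, hV, hhead, htail, hc⟩
    have htd : t < d := by omega
    have hfτ : τ.arr .eoff = f := (hF.2 .eoff (by decide)).trans (by simp [hf₃])
    have hgτ : τ.arr .eadj = σ.arr .eadj := (hF.2 .eadj (by decide)).trans (by simp [hg₃])
    have hκτ : τ.arr .ecore = κ := (hF.2 .ecore (by decide)).trans (by simp [hκ₃])
    have hordτ : τ.arr .eord = ord := (hF.2 .eord (by decide)).trans (by simp [hord₃])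
    have hbinτ : τ.arr .bin = bin := (hF.2 .bin (by decide)).trans (by simp [hbin₃])
    have hcntτ : τ.arr .cnt = cnt := (hF.2 .cnt (by decide)).trans (by simp [hcnt₃])
    have hBt : bin t = B t := hb₃ t htd
    have hBt' := hBs t htd
    have hBd' := hBd (t + 1)
    generalize hV₁ : visitedSet d (τ.arr .visited) = V₁ at *
    refine wp_seq (wp_store (by simp [ht]; omega) (by simp) (by simp) ?_)
    simp only [Expr.eval_var, Expr.eval_ofNat, ht]
    -- The charge for the previously marked vertices stands on the left, so that costs are compared
    -- without subtraction.
    refine wp_forRange (fun q T τ₁ =>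
      (T + ∑ x ∈ V₁, (10 + 10 * (f (x + 1) - f x)) ≤ 1 + 20 * (q - B t) +
        ∑ x ∈ visitedSet d (τ₁.arr .visited), (10 + 10 * (f (x + 1) - f x))) ∧
      V₁ ⊆ visitedSet d (τ₁.arr .visited) ∧
      (∀ x ∈ visitedSet d (τ₁.arr .visited), x ∉ V₁ → κ x = t) ∧
      (∀ q', B t ≤ q' → q' < q → ord q' ∈ visitedSet d (τ₁.arr .visited)) ∧
      (∀ x ∈ visitedSet d (τ₁.arr .visited), ∀ y, LevelAdj E κ t x y →
        y ∈ visitedSet d (τ₁.arr .visited)) ∧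
      τ₁.reg .head = #(visitedSet d (τ₁.arr .visited)) ∧
      τ₁.reg .tail = #(visitedSet d (τ₁.arr .visited)) ∧
      τ₁.arr .c t = (topComps E κ t (visitedSet d (τ₁.arr .visited) : Set ℕ)).ncard ∧
      ∀ a, a ≠ t → τ₁.arr .c a = τ.arr .c a) (B t) (B (t + 1))
      (by simp [ht]; omega) (by simp [ht, hbinτ, hBt]) (by omega) ?_ (by decide) ?_ ?_ ?_
    · intro q T₁ τ₁ _ _ _ hF₁ _
      have h1 : τ₁.reg .t = t := (hF₁.1 .t (by decide)).trans (by simp [ht])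
      have h2 : τ₁.arr .bin = bin := (hF₁.2 .bin (by decide)).trans (by simp [hbinτ])
      have h3 : τ₁.arr .cnt = cnt := (hF₁.2 .cnt (by decide)).trans (by simp [hcntτ])
      simp [h1, h2, h3, hBt']
      omega
    · simp only [State.setReg_arr, ne_eq, reduceCtorEq, not_false_eq_true, State.setReg_reg_ne,
        State.setCell_arr_ne, State.setCell_reg, State.setCell_arr_same, Function.update_self, hV₁]
      refine ⟨by omega, subset_rfl, fun x h h' => absurd h h', fun q' h1 h2 => by omega,
        fun x hx y hxy => ?_, hhead, htail, ?_, fun a ha => Function.update_of_ne ha ..⟩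
      · have := ((hV x).1 hx).2.2
        have := hxy.2.1
        omega
      · rw [topComps_eq_empty, Set.ncard_empty]
        intro x hx
        exact ((hV x).1 hx).2.2.ne
    · rintro q T₁ τ₁ hq₁ hq₂ hq hF₁ ⟨hT₁, hsub, hlev, hprev, hcl, hhead₁, htail₁, hct, hca⟩
      have h1 : τ₁.reg .t = t := (hF₁.1 .t (by decide)).trans (by simp [ht])
      have h2 : τ₁.arr .eoff = f := (hF₁.2 .eoff (by decide)).trans (by simp [hfτ])
      have h3 : τ₁.arr .eadj = σ.arr .eadj := (hF₁.2 .eadj (by decide)).trans (by simp [hgτ])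
      have h4 : τ₁.arr .ecore = κ := (hF₁.2 .ecore (by decide)).trans (by simp [hκτ])
      have h5 : τ₁.arr .eord = ord := (hF₁.2 .eord (by decide)).trans (by simp [hordτ])
      obtain ⟨h6, h7⟩ := hord q (by omega)
      have h8 := hiff _ h6 t
      have h9 := hiff _ h6 (t + 1)
      rw [h7] at h8 h9
      -- Place `q` lies between the boundaries of levels `t` and `t + 1`.
      have h10 : κ (ord q) = t := by omega
      refine wp_seq (wp_assign (by simp [hq]; omega) (wp_seq (wp_assign (by simp) ?_)))
      simp only [Expr.eval_get, Expr.eval_var, Expr.eval_ofNat, hq, h5]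
      refine wp_branch (by simp; omega) ?_ ?_
      · intro hvis
        have hvis : ord q ∉ visitedSet d (τ₁.arr .visited) := fun h =>
          (mem_visitedSet.1 h).2 (by simpa using hvis)
        refine wp_seq_four ((wp_visitComponent (E := E) (κ := κ) (f := f) (t := t) (u := ord q)
          (d := d) (by simp [h2]) rfl (by simp [h4]) (by simp [h1]) (by simp) h6 h10 rfl
          (by simpa using hvis) (by simp [hhead₁]) (by simp [htail₁]) (by simp) (by simpa using hcl)
          (by simpa [h3] using hL) hE hK hK').mono ?_)
        simp only [State.setReg_arr]
        rintro T₂ τ₂ hF₂ ⟨hT₂, hmem, hhead₂, htail₂, hflag⟩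
        have h11 : τ₂.reg .t = t := (hF₂.1 .t (by decide)).trans (by simp [h1])
        have h12 : τ₂.arr .c = τ₁.arr .c := hF₂.2 .c (by decide)
        have h13 : visitedSet d (τ₁.arr .visited) ⊆ visitedSet d (τ₂.arr .visited) :=
          fun x hx => (hmem x).2 (.inl hx)
        have h14 := sum_sdiff (f := fun x => 10 + 10 * (f (x + 1) - f x)) h13
        obtain ⟨h15, h16⟩ := ncard_topComps_union hE.symm h10 hvis hcl hmem
        have hlev' : ∀ x ∈ visitedSet d (τ₂.arr .visited), x ∉ V₁ → κ x = t := by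
          intro x hx hx'
          rcases (hmem x).1 hx with hx | hx
          · exact hlev x hx hx'
          · exact levelComp_level h10 hx
        have hprev' : ∀ q', B t ≤ q' → q' < q + 1 →
            ord q' ∈ visitedSet d (τ₂.arr .visited) := by
          intro q' h17 h18
          rcases Nat.lt_succ_iff_lt_or_eq.1 h18 with h18 | rfl
          · exact h13 (hprev q' h17 h18)
          · exact (hmem _).2 (.inr (mem_levelComp_self _))
        have hcl' : ∀ x ∈ visitedSet d (τ₂.arr .visited), ∀ y, LevelAdj E κ t x y →
            y ∈ visitedSet d (τ₂.arr .visited) := by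
          intro x hx y hxy
          rcases (hmem x).1 hx with hx | hx
          · exact h13 (hcl x hx y hxy)
          · exact (hmem y).2 (.inr (Relation.ReflTransGen.tail hx hxy))
        refine wp_branch (by simp) ?_ ?_
        · intro hfl
          have hfl : τ₂.reg .flag = 1 := by simpa using hfl
          refine wp_store (by simp [h11]; omega) (by simp) (by simp [h11]; omega) ?_
          simp only [Expr.eval_get, Expr.eval_var, Expr.eval_add, Expr.eval_ofNat, h11, ne_eq,
            reduceCtorEq, not_false_eq_true, State.setReg_reg_ne, State.setCell_arr_ne,
            State.setCell_reg, State.setCell_arr_same, h12]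
          refine ⟨by omega, hsub.trans h13, hlev', hprev', hcl', hhead₂, htail₂, ?_, fun a ha => ?_⟩
          · rw [Function.update_self, h15 (hflag.1 hfl), hct]
          · rw [Function.update_of_ne ha, hca a ha]
        · intro hfl
          have hfl : ¬ τ₂.reg .flag = 1 := by simpa using hfl
          refine wp_skip ?_
          simp only [ne_eq, reduceCtorEq, not_false_eq_true, State.setReg_reg_ne, h12]
          refine ⟨by omega, hsub.trans h13, hlev', hprev', hcl', hhead₂, htail₂, ?_, hca⟩
          rw [h16 fun h => hfl (hflag.2 h), hct]
      · intro hvis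
        have hvis : ord q ∈ visitedSet d (τ₁.arr .visited) :=
          mem_visitedSet.2 ⟨h6, by simpa using hvis⟩
        refine wp_skip ?_
        simp only [ne_eq, reduceCtorEq, not_false_eq_true, State.setReg_reg_ne, State.setReg_arr,]
        refine ⟨by omega, hsub, hlev, fun q' h17 h18 => ?_, hcl, hhead₁, htail₁, hct, hca⟩
        rcases Nat.lt_succ_iff_lt_or_eq.1 h18 with h18 | rfl
        · exact hprev q' h17 h18
        · exact hvis
    · rintro T₁ τ₁ - hF₁ ⟨hT₁, hsub, hlev, hprev, hcl, hhead₁, htail₁, hct, hca⟩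
      have hall : ∀ x < d, κ x = t → x ∈ visitedSet d (τ₁.arr .visited) := by
        intro x hx hxt
        have h1 := hiff x hx t
        have h2 := hiff x hx (t + 1)
        have h3 := hprev (pos x) (by omega) (by omega)
        rwa [(hpos x hx).2] at h3
      simp only [State.setReg_arr, ne_eq, reduceCtorEq, not_false_eq_true, State.setReg_reg_ne]
      refine ⟨by omega, fun x => ⟨fun hx => ?_, ?_⟩, hhead₁, htail₁, fun a ha₁ ha₂ => ?_⟩
      · refine ⟨(mem_visitedSet.1 hx).1, ?_⟩
        by_cases hx' : x ∈ V₁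
        · have := (hV x).1 hx'
          omega
        · have := hlev x hx hx'
          omega
      · rintro ⟨h1, h2, h3⟩
        rcases Nat.lt_succ_iff_lt_or_eq.1 h3 with h3 | h3
        · exact hsub ((hV x).2 ⟨h1, h2, h3⟩)
        · exact hall x h1 h3
      · rcases Nat.lt_succ_iff_lt_or_eq.1 ha₂ with ha₂ | rfl
        · rw [hca a ha₂.ne, hc a ha₁ ha₂]
        · rw [hct]
          congr 1
          refine topComps_congr fun x hx => ?_
          rw [mem_coe, Set.mem_Iio]
          exact ⟨fun h => (mem_visitedSet.1 h).1, fun h => hall x h hx⟩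
  · rintro T τ - hF ⟨hT, hV, -, -, hc⟩
    have h1 : τ.reg .tmax = tm := (hF.1 .tmax (by decide)).trans (by simp [htm₃])
    have h2 : ∑ x ∈ visitedSet d (τ.arr .visited), (10 + 10 * (f (x + 1) - f x)) ≤
        10 * d + 10 * f d := by
      refine (sum_le_sum_of_subset (filter_subset _ _)).trans ?_
      rw [sum_add_distrib, ← mul_sum, ← hL.sum_degree hE.lt', sum_const, card_range, smul_eq_mul,
        mul_comm d]
      refine Nat.add_le_add_left (Nat.mul_le_mul_left _ (sum_le_sum fun x hx => ?_)) _
      rw [hL.degree hE.lt' (mem_range.1 hx)]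
    have h3 := hBd (tm + 1)
    rw [h1]
    exact ⟨by omega, κ, hcore, fun x hx => (hvis₂ x hx).2, by omega,
      fun a ha₁ ha₂ => hc a ha₁ (by omega)⟩

/-! ## The scores and their upper bounds -/

/-- The largest `s ≤ tm` with `s ≤ b s + ⋯ + b tm` is `s`, or there is none and `s = 0`. -/
def IsHIndex (b : ℕ → ℕ) (tm s : ℕ) : Prop :=
  (s = 0 ∨ s ≤ ∑ i ∈ Icc s tm, b i) ∧ ∀ r, s < r → r ≤ tm → ∑ i ∈ Icc r tm, b i < r

theorem wp_computeScore {K M v : ℕ} {σ : State} {R : ℕ → ℕ → Prop} [DecidableRel R] {f a o : ℕ → ℕ}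
    {d : ℕ} (hv : σ.reg .v = v) (hvM : v < M) (hf : σ.arr .off = f) (ho : σ.arr .ooff = o)
    (ha : ∀ i, σ.arr .adj (f v + i) = a i) (hd : f (v + 1) - f v = d)
    (hL : Lists M f (σ.arr .adj) R) (hR : IsGraph M R)
    (hO : Lists M o (σ.arr .oadj) (Oriented R f)) (hoM : o M ≤ f M)
    (hloc : ∀ u < M, σ.arr .loc u = 0) (hK : M < K) (hK' : 2 * f M ≤ K) :
    wp K computeScore (fun T τ =>
      T ≤ 200 * d + 100 * ∑ i ∈ range d, (o (a i + 1) - o (a i)) + 200 ∧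
      (∀ u < M, τ.arr .loc u = 0) ∧
      ∃ κ tm, (∀ i < d, HasCoreness (egoRel d a R) i (κ i)) ∧ (∀ i < d, κ i ≤ tm) ∧ tm ≤ d ∧
        IsHIndex (fun r => (topComps (egoRel d a R) κ r (Set.Iio d)).ncard) tm (τ.reg .h)) σ := by
  have hdM : d ≤ M := by
    rw [← hd, ← hL.degree hR.lt' hvM]
    exact (card_filter_le _ _).trans_eq (card_range M)
  have hWM : ∑ i ∈ range d, (o (a i + 1) - o (a i)) ≤ f M := by
    refine (EgoData.sum_le (h := σ.arr .oadj) (S := Oriented R f)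
      ⟨hO, fun h => hR.lt' h.1, fun i hi => ?_, fun i hi j hj h => ?_⟩).trans hoM
    · rw [← ha]
      exact hR.lt' (hL.rel hvM (by omega) (by omega))
    · rw [← ha, ← ha] at h
      have := hL.inj v hvM ⟨by omega, by omega⟩ ⟨by omega, by omega⟩ h
      omega
  unfold computeScore
  refine wp_seq ((wp_extractEgo hv hvM hf ho ha hd hL hR hO hoM hloc hK hK').mono ?_)
  rintro T₁ σ₁ hF₁ ⟨hT₁, hd₁, hL₁, hW₁, hloc₁⟩
  refine wp_seq ((wp_discriminativeDecomposition hd₁ rfl hL₁ hR.egoRel (by omega)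
    (by omega)).mono ?_)
  rintro T₂ σ₂ hF₂ ⟨hT₂, κ, hκ, hκtm, htmd, hc⟩
  have hloc₂ : σ₂.arr .loc = σ₁.arr .loc := hF₂.2 .loc (by decide)
  generalize htm : σ₂.reg .tmax = tm at *
  generalize hb : (fun r => (topComps (egoRel d a R) κ r (Set.Iio d)).ncard) = b
  have hc' : ∀ a, 1 ≤ a → a ≤ tm → σ₂.arr .c a = b a := fun a h1 h2 => by
    rw [hc a h1 h2, ← hb]
  refine wp_seq (wp_assign (by simp) (wp_seq (wp_assign (by simp) ?_)))
  simp only [Expr.eval_ofNat, Expr.eval_var, ne_eq, reduceCtorEq, not_false_eq_true,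
    State.setReg_reg_ne, htm]
  -- While `t` is nonzero, `h` is the partial sum above `t` and all larger candidates have failed;
  -- once `t` is zero, `h` is the answer.
  refine wp_loop (fun T τ => τ.reg .t ≤ tm ∧ T ≤ 5 * (tm - τ.reg .t) ∧
      (τ.reg .t ≠ 0 → τ.reg .h = ∑ i ∈ Icc (τ.reg .t + 1) tm, b i ∧
        ∀ r, τ.reg .t < r → r ≤ tm → ∑ i ∈ Icc r tm, b i < r) ∧
      (τ.reg .t = 0 → IsHIndex b tm (τ.reg .h)))
    (fun τ => τ.reg .t) ?_ ?_ ?_ ?_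
  · simp only [State.setReg_reg_same, ne_eq, reduceCtorEq, not_false_eq_true, State.setReg_reg_ne]
    refine ⟨le_rfl, by omega, fun _ => ⟨by simp, fun r h1 h2 => by omega⟩, ?_⟩
    rintro rfl
    exact ⟨.inl rfl, fun r h1 h2 => by omega⟩
  · rintro T τ hF -
    simp
  · rintro T τ hF ⟨ht, hT, h1, -⟩ hpos
    have hcτ : τ.arr .c = σ₂.arr .c := (hF.2 .c (by decide)).trans (by simp)
    generalize hτt : τ.reg .t = t at *
    have hpos : 0 < t := by simpa [hτt] using hpos
    obtain ⟨hh, hr⟩ := h1 hpos.ne'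
    refine wp_seq (wp_assign (by simp [hτt]; omega) ?_)
    have hsum : τ.reg .h + b t = ∑ i ∈ Icc t tm, b i := by
      rw [hh, add_comm, ← sum_insert (f := b) (by simp)]
      congr 1
      ext i
      simp only [mem_insert, mem_Icc]
      omega
    simp only [Expr.eval_get, Expr.eval_add, Expr.eval_var, hτt, hcτ, hc' t hpos ht, hsum]
    refine wp_branch (by simp) ?_ ?_
    · intro hle
      have hle : t ≤ ∑ i ∈ Icc t tm, b i := by simpa [hτt] using hle
      refine wp_seq (wp_assign (by simp) (wp_assign (by simp) ?_))
      simp only [Expr.eval_var, Expr.eval_ofNat, State.setReg_reg_same, ne_eq, reduceCtorEq,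
        not_false_eq_true, State.setReg_reg_ne, hτt]
      exact ⟨⟨by omega, by omega, fun h => absurd trivial h, fun _ => ⟨.inr hle, hr⟩⟩, hpos⟩
    · intro hle
      have hle : ∑ i ∈ Icc t tm, b i < t := by simpa [hτt] using hle
      refine wp_assign (by simp) ?_
      simp only [Expr.eval_var, Expr.eval_sub, Expr.eval_ofNat, State.setReg_reg_same, ne_eq,
        reduceCtorEq, not_false_eq_true, State.setReg_reg_ne, hτt]
      have hr' : ∀ r, t - 1 < r → r ≤ tm → ∑ i ∈ Icc r tm, b i < r := by
        intro r h1 h2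
        rcases eq_or_ne r t with rfl | hne
        · exact hle
        · exact hr r (by omega) h2
      refine ⟨⟨by omega, by omega, fun _ => ⟨by rw [Nat.sub_add_cancel hpos], hr'⟩, fun h => ?_⟩,
        by omega⟩
      -- If the last candidate 1 fails, the sum is 0, so the accumulated `h` is already the right
      -- answer 0.
      have h1 : t = 1 := by omega
      subst h1
      have h0 : ∑ i ∈ Icc 1 tm, b i = 0 := by omega
      rw [h0]
      exact ⟨.inl rfl, hr'⟩
  · rintro T τ hF ⟨ht, hT, -, h2⟩ hpos
    have hpos : τ.reg .t = 0 := by simpa using hpos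
    have h3 : τ.arr .loc = σ₁.arr .loc := (hF.2 .loc (by decide)).trans (by simp [hloc₂])
    refine ⟨by omega, by rwa [h3], κ, tm, hκ, hκtm, htmd, ?_⟩
    rw [hb]
    exact h2 hpos

theorem card_filter_le_eq_add (s : Finset ℕ) (b : ℕ → ℕ) (x : ℕ) :
    #{e ∈ s | x ≤ b e} = #{e ∈ s | x < b e} + #{e ∈ s | b e = x} := by
  rw [← card_union_of_disjoint]
  · congr 1
    ext v
    rw [mem_union, mem_filter, mem_filter, mem_filter, ← and_or_left, le_iff_lt_or_eq,
      eq_comm (a := x)]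
  · rw [disjoint_filter]
    exact fun v _ h h' => h.ne' h'

/-- Two properties of the bounds suffice: no admissible `x` exceeds them, and they are below the
number of vertices, as the bin sort needs. Counting by value and summing downwards takes time linear
in the degree. -/
theorem wp_upperBounds {K : ℕ} {M : ℕ} {σ : State} {R : ℕ → ℕ → Prop} [DecidableRel R]
    {f g φ : ℕ → ℕ} (hn : σ.reg .n = M) (hf : σ.arr .off = f) (hg : σ.arr .adj = g)
    (hφ : σ.arr .core = φ) (hL : Lists M f g R) (hR : IsGraph M R)
    (hcore : ∀ x < M, HasCoreness R x (φ x)) (hK : M < K) (hK' : f M ≤ K) :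
    wp K upperBounds (fun T τ => T ≤ 20 * M + 30 * f M + 20 ∧
      ∀ v < M, τ.arr .hhat v < M ∧ ∀ x,
        x * (x + 1) ≤ #{e ∈ Ico (f v) (f (v + 1)) | x ≤ min (φ (g e) - 1) (φ v)} →
        x ≤ τ.arr .hhat v) σ := by
  unfold upperBounds
  refine wp_forRange (fun v T τ => T ≤ 1 + 20 * v + 30 * f v ∧
      ∀ v' < v, τ.arr .hhat v' < M ∧ ∀ x,
        x * (x + 1) ≤ #{e ∈ Ico (f v') (f (v' + 1)) | x ≤ min (φ (g e) - 1) (φ v')} →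
        x ≤ τ.arr .hhat v') 0 M (by simp) (by simp) (Nat.zero_le _) ?_ (by decide) (by simp) ?_ ?_
  · intro v T τ _ _ _ hF _
    simp [hF.1 .n (by decide), hn]
  · rintro v T τ - hvM hv hF ⟨hT, hP⟩
    have hfτ : τ.arr .off = f := (hF.2 .off (by decide)).trans hf
    have hgτ : τ.arr .adj = g := (hF.2 .adj (by decide)).trans hg
    have hφτ : τ.arr .core = φ := (hF.2 .core (by decide)).trans hφ
    have hfv := hL.mono v hvM
    have hfM : f (v + 1) ≤ f M := hL.src_le hvM le_rfl
    -- The coreness is at most the degree, so every truncated value fits into the `d + 1` counters.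
    have hφd : φ v ≤ f (v + 1) - f v := by
      rw [← hL.degree hR.lt' hvM]
      exact (hcore v hvM).le_card (range M) fun y hy => mem_range.2 (hR.lt' hy)
    have hdM : f (v + 1) - f v < M := by
      rw [← hL.degree hR.lt' hvM]
      have h1 : #{y ∈ range M | R v y} < #(range M) := card_lt_card <| by
        rw [ssubset_iff_of_subset (filter_subset _ _)]
        exact ⟨v, by simpa using hvM, by simp [hR.irrefl v]⟩
      simpa using h1
    generalize hd : f (v + 1) - f v = d at *
    refine wp_seq (wp_assign (by simp [hv]; omega) ?_)
    simp only [Expr.eval_get, Expr.eval_add, Expr.eval_sub, Expr.eval_ofNat, Expr.eval_var, hv, hfτ,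
      hd]
    refine wp_seq (wp_forRange (fun i T τ => T ≤ 1 + 3 * i ∧ ∀ a < i, τ.arr .cnt a = 0) 0 (d + 1)
      (by simp) (by simp) (Nat.zero_le _) ?_ (by decide) (by simp) ?_ ?_)
    · intro i T τ₁ _ _ _ hF₁ _
      simp [hF₁.1 .d (by decide)]
    · rintro i T τ₁ - hid hi hF₁ ⟨hT₁, hP₁⟩
      refine wp_store (by simp; omega) (by simp) (by simp) ?_
      simp only [Expr.eval_var, hi, Expr.eval_ofNat, State.setReg_arr, State.setCell_arr_same]
      refine ⟨by omega, fun a ha => ?_⟩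
      rw [Function.update_apply]
      split_ifs with h
      · rfl
      · exact hP₁ a (by omega)
    rintro T₁ τ₁ - hF₁ ⟨hT₁, hcnt₁⟩
    have hd₁ : τ₁.reg .d = d := (hF₁.1 .d (by decide)).trans (by simp)
    have hv₁ : τ₁.reg .v = v := (hF₁.1 .v (by decide)).trans (by simp [hv])
    have hf₁ : τ₁.arr .off = f := (hF₁.2 .off (by decide)).trans (by simp [hfτ])
    have hg₁ : τ₁.arr .adj = g := (hF₁.2 .adj (by decide)).trans (by simp [hgτ])
    have hφ₁ : τ₁.arr .core = φ := (hF₁.2 .core (by decide)).trans (by simp [hφτ])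
    have hh₁ : τ₁.arr .hhat = τ.arr .hhat := (hF₁.2 .hhat (by decide)).trans (by simp)
    generalize hb : (fun e => min (φ (g e) - 1) (φ v)) = b
    have hbd : ∀ e, b e ≤ d := fun e => by
      rw [← hb]
      exact (min_le_right _ _).trans hφd
    refine wp_seq (wp_forRange (fun e T τ => T ≤ 1 + 7 * (e - f v) ∧
      ∀ a ≤ d, τ.arr .cnt a = #{e' ∈ Ico (f v) e | b e' = a}) (f v) (f (v + 1))
      (by simp [hv₁]; omega) (by simp [hv₁, hf₁]) hfv ?_ (by decide) ?_ ?_ ?_)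
    · intro i T τ₂ _ _ _ hF₂ _
      have h1 : τ₂.reg .v = v := (hF₂.1 .v (by decide)).trans hv₁
      have h2 : τ₂.arr .off = f := (hF₂.2 .off (by decide)).trans hf₁
      simp [h1, h2]
      omega
    · refine ⟨by omega, fun a ha => ?_⟩
      simpa using hcnt₁ a (by omega)
    · rintro e T₂ τ₂ he₁ he₂ he hF₂ ⟨hT₂, hP₂⟩
      have h1 : τ₂.reg .v = v := (hF₂.1 .v (by decide)).trans hv₁
      have h2 : τ₂.arr .adj = g := (hF₂.2 .adj (by decide)).trans hg₁
      have h3 : τ₂.arr .core = φ := (hF₂.2 .core (by decide)).trans hφ₁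
      have h4 := hR.lt' (hL.rel hvM he₁ he₂)
      have h5 := hbd e
      have key : ∀ a ≤ d, Function.update (τ₂.arr .cnt) (b e) (τ₂.arr .cnt (b e) + 1) a =
          #{e' ∈ Ico (f v) (e + 1) | b e' = a} := by
        intro a ha
        rw [Nat.Ico_succ_right_eq_insert_Ico he₁, filter_insert, Function.update_apply]
        split_ifs with h6 h7 h7
        · rw [card_insert_of_notMem (by simp), h6, hP₂ _ h5]
        · exact absurd h6.symm h7
        · exact absurd h7.symm h6
        · exact hP₂ a ha
      refine wp_seq (wp_assign (by simp [he, h2]; omega) ?_)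
      simp only [Expr.eval_get, Expr.eval_sub, Expr.eval_ofNat, Expr.eval_var, he, h2, h3]
      refine wp_seq (wp_branch (by simp [h1]; omega) ?_ ?_)
      · intro hlt
        have hlt : φ v < φ (g e) - 1 := by simpa [h1, h3] using hlt
        have hbe : b e = φ v := by simp [← hb, hlt.le]
        refine wp_assign (by simp [h1]; omega) ?_
        simp only [Expr.eval_get, Expr.eval_var, ne_eq, reduceCtorEq, not_false_eq_true,
          State.setReg_reg_ne, State.setReg_arr, h1, h3, ← hbe]
        refine wp_store (by simp; omega) (by simp) (by simp; omega) ?_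
        simp only [Expr.eval_get, Expr.eval_add, Expr.eval_ofNat, Expr.eval_var,
          State.setReg_reg_same, State.setReg_arr, State.setCell_arr_same]
        exact ⟨by omega, key⟩
      · intro hlt
        have hlt : φ (g e) - 1 ≤ φ v := by simpa [h1, h3] using hlt
        have hbe : b e = φ (g e) - 1 := by simp [← hb, hlt]
        refine wp_skip ?_
        simp only [← hbe]
        refine wp_store (by simp; omega) (by simp) (by simp; omega) ?_
        simp only [Expr.eval_get, Expr.eval_add, Expr.eval_ofNat, Expr.eval_var,
          State.setReg_reg_same, State.setReg_arr, State.setCell_arr_same]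
        exact ⟨by omega, key⟩
    rintro T₂ τ₂ - hF₂ ⟨hT₂, hcnt₂⟩
    have hd₂ : τ₂.reg .d = d := (hF₂.1 .d (by decide)).trans hd₁
    have hv₂ : τ₂.reg .v = v := (hF₂.1 .v (by decide)).trans hv₁
    have hh₂ : τ₂.arr .hhat = τ.arr .hhat := (hF₂.2 .hhat (by decide)).trans hh₁
    refine wp_seq (wp_store (by simp [hv₂]; omega) (by simp) (by simp) (wp_seq (wp_assign (by simp)
      (wp_seq (wp_assign (by simp) ?_)))))
    simp only [Expr.eval_var, Expr.eval_ofNat, hv₂, State.setCell_reg, ne_eq, reduceCtorEq,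
      not_false_eq_true, State.setReg_reg_ne, hd₂]
    set I := Ico (f v) (f (v + 1)) with hI
    have hcard : #I = d := by rw [hI, Nat.card_Ico, hd]
    refine wp_loop (fun T τ₃ => τ₃.reg .x ≤ d ∧ T ≤ 6 * (d - τ₃.reg .x) ∧
      τ₃.arr .hhat v ≤ d ∧ (∀ v', v' ≠ v → τ₃.arr .hhat v' = τ.arr .hhat v') ∧
      (τ₃.reg .x ≠ 0 → τ₃.reg .s = #{e ∈ I | τ₃.reg .x < b e} ∧
        ∀ x, τ₃.reg .x < x → ¬ x * (x + 1) ≤ #{e ∈ I | x ≤ b e}) ∧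
      (τ₃.reg .x = 0 → ∀ x, x * (x + 1) ≤ #{e ∈ I | x ≤ b e} → x ≤ τ₃.arr .hhat v))
      (fun τ => τ.reg .x) ?_ ?_ ?_ ?_
    · simp only [State.setReg_reg_same, ne_eq, reduceCtorEq, not_false_eq_true,
        State.setReg_reg_ne, State.setReg_arr, State.setCell_arr_same, Function.update_self, hh₂]
      -- Starting the descent at `d` is enough: a larger `x` would need more than `d` neighbours.
      have hx : ∀ x, d < x → ¬ x * (x + 1) ≤ #{e ∈ I | x ≤ b e} := by
        intro x hx h
        have h1 := card_filter_le I (fun e => x ≤ b e)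
        have h2 := Nat.le_mul_of_pos_right x (Nat.succ_pos x)
        simp only [Nat.succ_eq_add_one] at h2
        omega
      refine ⟨le_rfl, by omega, Nat.zero_le _, fun v' h => Function.update_of_ne h .., fun _ =>
        ⟨?_, hx⟩, fun h x hx' => ?_⟩
      · rw [eq_comm, card_eq_zero, filter_eq_empty_iff]
        exact fun e _ => (hbd e).not_gt
      · by_contra! h1
        exact hx x (by omega) hx'
    · rintro T₃ τ₃ hF₃ _
      simp
    · rintro T₃ τ₃ hF₃ ⟨hxd, hT₃, hh, hh', h1, -⟩ hpos
      have hv₃ : τ₃.reg .v = v := (hF₃.1 .v (by decide)).trans (by simp [hv₂])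
      have hc₃ : τ₃.arr .cnt = τ₂.arr .cnt := (hF₃.2 .cnt (by decide)).trans (by simp)
      generalize hx : τ₃.reg .x = x at *
      have hpos : 0 < x := by simpa [hx] using hpos
      obtain ⟨hs, hgt⟩ := h1 hpos.ne'
      refine wp_seq (wp_assign (by simp [hx]; omega) ?_)
      simp only [Expr.eval_get, Expr.eval_add, Expr.eval_var, hx, hs, hc₃, hcnt₂ x hxd,
        ← card_filter_le_eq_add]
      refine wp_branch (by simp) ?_ ?_
      · intro hle
        have hle : x * (x + 1) ≤ #{e ∈ I | x ≤ b e} := by simpa [hx] using hle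
        refine wp_seq (wp_store (by simp [hv₃]; omega) (by simp) (by simp) (wp_assign (by simp) ?_))
        simp only [State.setReg_reg_same, ne_eq, reduceCtorEq, not_false_eq_true, Expr.eval_var,
          State.setReg_reg_ne, State.setReg_arr, State.setCell_arr_same, Function.update_self, hx,
          hv₃, Expr.eval_ofNat]
        refine ⟨⟨by omega, by omega, hxd, fun v' h => ?_, fun h => absurd trivial h,
          fun _ y hy => ?_⟩, hpos⟩
        · rw [Function.update_of_ne h, hh' v' h]
        · by_contra! h
          exact hgt y h hy
      · intro hle
        have hle : ¬ x * (x + 1) ≤ #{e ∈ I | x ≤ b e} := by simpa [hx] using hle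
        refine wp_assign (by simp) ?_
        simp only [State.setReg_reg_same, ne_eq, reduceCtorEq, not_false_eq_true, Expr.eval_var,
          Expr.eval_sub, State.setReg_reg_ne, State.setReg_arr, hx, Expr.eval_ofNat]
        have hgt' : ∀ y, x - 1 < y → ¬ y * (y + 1) ≤ #{e ∈ I | y ≤ b e} := by
          intro y hy
          rcases eq_or_ne y x with rfl | hne
          · exact hle
          · exact hgt y (by omega)
        refine ⟨⟨by omega, by omega, hh, hh', fun _ => ⟨?_, hgt'⟩, fun h y hy => ?_⟩, by omega⟩
        · congr 1
          refine filter_congr fun e _ => ?_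
          omega
        · by_contra! h'
          exact hgt' y (by omega) hy
    · rintro T₃ τ₃ hF₃ ⟨hxd, hT₃, hh, hh', -, h1⟩ hpos
      have hpos : τ₃.reg .x = 0 := by simpa using hpos
      refine ⟨by omega, fun v' hv' => ?_⟩
      rcases eq_or_ne v' v with rfl | hne
      · subst hb
        exact ⟨hh.trans_lt hdM, h1 hpos⟩
      · rw [State.setReg_arr, hh' v' hne]
        exact hP v' (by omega)
  · rintro T τ - hF ⟨hT, hP⟩
    exact ⟨by omega, hP⟩

/-! ## The search -/

/-- Following `next` from `p` runs through the elements of `s`, where `u + 1` points to `u` and `0`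
to nothing. -/
inductive LinkedList (next : ℕ → ℕ) : ℕ → Finset ℕ → Prop
  | nil : LinkedList next 0 ∅
  | cons {u : ℕ} {s : Finset ℕ} :
      u ∉ s → LinkedList next (next u) s → LinkedList next (u + 1) (insert u s)

namespace LinkedList

variable {next next' : ℕ → ℕ} {p : ℕ} {s : Finset ℕ}

theorem congr (h : LinkedList next p s) (hn : ∀ u ∈ s, next' u = next u) :
    LinkedList next' p s := by
  induction h with
  | nil => exact .nil
  | cons hu _ ih =>
    refine .cons hu ?_
    rw [hn _ (mem_insert_self ..)]
    exact ih fun w hw => hn w (mem_insert_of_mem hw)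

theorem eq_zero_iff (h : LinkedList next p s) : p = 0 ↔ s = ∅ := by
  cases h with
  | nil => simp
  | cons => simp

theorem exists_of_ne_zero (h : LinkedList next p s) (hp : p ≠ 0) :
    ∃ u ∈ s, p = u + 1 ∧ LinkedList next (next u) (s.erase u) := by
  cases h with
  | nil => exact absurd rfl hp
  | cons hu h => exact ⟨_, mem_insert_self .., rfl, by rwa [erase_insert hu]⟩

end LinkedList

/-- The arrays `first`, `next`, `mem` represent the set `S` of numbers below `N` with the scores
`sc`. -/
structure Buckets (N : ℕ) (sc : ℕ → ℕ) (S : Finset ℕ) (first next mem : ℕ → ℕ) : Prop where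
  mem_iff : ∀ v < N, mem v = 1 ↔ v ∈ S
  list : ∀ a < N, LinkedList next (first a) {u ∈ S | sc u = a}

namespace Buckets

variable {N : ℕ} {sc : ℕ → ℕ} {S : Finset ℕ} {first next mem : ℕ → ℕ}

theorem insert (h : Buckets N sc S first next mem) {v : ℕ} (hv : v ∉ S) :
    Buckets N sc (insert v S) (Function.update first (sc v) (v + 1))
      (Function.update next v (first (sc v))) (Function.update mem v 1) where
  mem_iff w hw := by
    rcases eq_or_ne w v with rfl | hne
    · simp
    · simp [hne, h.mem_iff w hw]
  list a ha := by
    have key : ∀ u ∈ ({u ∈ S | sc u = a} : Finset ℕ),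
        Function.update next v (first (sc v)) u = next u := fun u hu =>
      Function.update_of_ne (by rintro rfl; exact hv (mem_filter.1 hu).1) _ _
    rw [filter_insert]
    rcases eq_or_ne (sc v) a with rfl | hne
    · rw [if_pos rfl, Function.update_self]
      refine .cons (fun h => hv (mem_filter.1 h).1) ?_
      rw [Function.update_self]
      exact (h.list _ ha).congr key
    · rw [if_neg hne, Function.update_of_ne hne.symm]
      exact (h.list a ha).congr key

theorem erase_first (h : Buckets N sc S first next mem) {a : ℕ} (ha : a < N) (hp : first a ≠ 0) :
    ∃ u ∈ S, sc u = a ∧ first a = u + 1 ∧ Buckets N sc (S.erase u)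
      (Function.update first a (next u)) next (Function.update mem u 0) := by
  obtain ⟨u, hu, hf, hl⟩ := (h.list a ha).exists_of_ne_zero hp
  obtain ⟨huS, rfl⟩ := mem_filter.1 hu
  refine ⟨u, huS, rfl, hf, fun w hw => ?_, fun b hb => ?_⟩
  · rcases eq_or_ne w u with rfl | hne
    · simp
    · simp [hne, h.mem_iff w hw]
  · rw [filter_erase]
    rcases eq_or_ne b (sc u) with rfl | hne
    · rwa [Function.update_self]
    · rw [Function.update_of_ne hne, erase_eq_of_notMem]
      · exact h.list b hb
      · exact fun h => hne (mem_filter.1 h).2.symm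

end Buckets

/-- The set `S` consists of `k` elements of `P` with the highest scores, or of all elements of `P`
if it has fewer than `k`; `mn` is the least of their scores. -/
structure Selected (N k : ℕ) (sc : ℕ → ℕ) (P S : Finset ℕ) (mn : ℕ) : Prop where
  subset : S ⊆ P
  card_le : #S ≤ k
  eq : #S < k → S = P
  least : (S = ∅ ∧ mn = N) ∨ ∃ u ∈ S, sc u = mn
  le : ∀ u ∈ S, mn ≤ sc u
  ge : ∀ w ∈ P, w ∉ S → sc w ≤ mn

namespace Selected

variable {N k : ℕ} {sc : ℕ → ℕ} {P S : Finset ℕ} {mn v : ℕ}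

theorem mn_le (h : Selected N k sc P S mn) (hP : ∀ u ∈ P, sc u < N) : mn ≤ N := by
  rcases h.least with ⟨-, h⟩ | ⟨u, hu, rfl⟩
  · exact h.le
  · exact (hP u (h.subset hu)).le

/-- Below size `k` nothing has been discarded, so the condition on omitted elements is vacuous. The
initial value `N` of `mn` exceeds every score, so the minimum becomes the score of the first vertex.
-/
theorem add (h : Selected N k sc P S mn) (hk : #S < k) (hv : v ∉ P) (hvN : sc v < N) :
    Selected N k sc (insert v P) (insert v S) (min mn (sc v)) where
  subset := insert_subset_insert _ h.subset
  card_le := by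
    have := card_insert_le v S
    omega
  eq _ := by rw [h.eq hk]
  least := by
    right
    rcases le_total (sc v) mn with hle | hle
    · exact ⟨v, mem_insert_self .., by rw [min_eq_right hle]⟩
    · rcases h.least with ⟨-, hN⟩ | ⟨u, hu, hun⟩
      · omega
      · exact ⟨u, mem_insert_of_mem hu, by rw [min_eq_left hle, hun]⟩
  le u hu := by
    rcases mem_insert.1 hu with rfl | hu
    · exact min_le_right ..
    · exact (min_le_left ..).trans (h.le u hu)
  ge w hw hwS := by
    rw [h.eq hk] at hwS
    exact absurd hw hwS

theorem pass (h : Selected N k sc P S mn) (hk : #S = k) (hle : sc v ≤ mn) :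
    Selected N k sc (insert v P) S mn where
  subset := h.subset.trans (subset_insert ..)
  card_le := h.card_le
  eq hlt := absurd hk hlt.ne
  least := h.least
  le := h.le
  ge w hw hwS := by
    rcases mem_insert.1 hw with rfl | hw
    · exact hle
    · exact h.ge w hw hwS

/-- The discarded vertex has the old least score, and the least score does not fall; hence all
omitted vertices still have at most the new least score. -/
theorem replace (h : Selected N k sc P S mn) (hk : #S = k) (hv : v ∉ P) (hlt : mn < sc v) {u : ℕ}
    (hu : u ∈ S) (hun : sc u = mn) {mn' : ℕ} (hmn : mn ≤ mn')
    (hex : ∃ w ∈ insert v (S.erase u), sc w = mn')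
    (hle : ∀ w ∈ insert v (S.erase u), mn' ≤ sc w) :
    Selected N k sc (insert v P) (insert v (S.erase u)) mn' where
  subset := insert_subset_insert _ ((erase_subset ..).trans h.subset)
  card_le := by
    refine (card_insert_le ..).trans ?_
    rw [card_erase_of_mem hu]
    have := card_pos.2 ⟨u, hu⟩
    omega
  eq hlt' := by
    have hv' : v ∉ S.erase u := fun h' => hv (h.subset (mem_of_mem_erase h'))
    rw [card_insert_of_notMem hv', card_erase_of_mem hu] at hlt'
    omega
  least := .inr hex
  le := hle
  ge w hw hwS := by
    rw [mem_insert, mem_erase, not_or, not_and'] at hwS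
    rcases mem_insert.1 hw with rfl | hw
    · exact absurd rfl hwS.1
    · by_cases hwS' : w ∈ S
      · rw [not_not.1 (hwS.2 hwS'), hun]
        exact hmn
      · exact (h.ge w hw hwS').trans hmn

end Selected


theorem wp_insertVertex {K v s : ℕ} {σ : State} (hv : σ.reg .v = v) (hs : σ.reg .h = s)
    (hvK : v < K) (hsK : s < K) :
    wp K insertVertex (fun T τ => T = 3 ∧
      τ.arr .first = Function.update (σ.arr .first) s (v + 1) ∧
      τ.arr .next = Function.update (σ.arr .next) v (σ.arr .first s) ∧
      τ.arr .mem = Function.update (σ.arr .mem) v 1) σ := by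
  unfold insertVertex
  refine wp_seq (wp_store (by simpa [hv]) (by simp) (by simp [hs, hsK]) ?_)
  refine wp_seq (wp_store (by simpa [hs]) (by simp) (by simp) ?_)
  refine wp_store (by simpa [hv]) (by simp) (by simp) ?_
  simp [hv, hs]

/-- A nonempty bucket at `b` stops the search for the new least score, and the cost is proportional
to the increase. -/
theorem wp_advance {K m b : ℕ} {σ : State} (hm : σ.reg .mn = m) (hmb : m ≤ b)
    (hb : σ.arr .first b ≠ 0) (hbK : b < K) :
    wp K (.loop (.eq (Arr.first Var.mn) 0) (.assign .mn (Var.mn + (1 : Expr))))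
      (fun T τ => m ≤ τ.reg .mn ∧ τ.reg .mn ≤ b ∧ T = 2 * (τ.reg .mn - m) + 1 ∧
        (∀ a, m ≤ a → a < τ.reg .mn → σ.arr .first a = 0) ∧ σ.arr .first (τ.reg .mn) ≠ 0) σ := by
  refine wp_loop (fun T τ => m ≤ τ.reg .mn ∧ τ.reg .mn ≤ b ∧ T = 2 * (τ.reg .mn - m) ∧
    (∀ a, m ≤ a → a < τ.reg .mn → σ.arr .first a = 0)) (fun τ => b - τ.reg .mn) ?_ ?_ ?_ ?_
  · exact ⟨hm.ge, hm.trans_le hmb, by omega, fun a _ _ => by omega⟩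
  · rintro T τ - ⟨-, h, -⟩
    simp
    omega
  · rintro T τ hF ⟨h1, h2, h3, h4⟩ hpos
    have hf : τ.arr .first = σ.arr .first := hF.2 .first (by decide)
    have hpos : σ.arr .first (τ.reg .mn) = 0 := by simpa [hf] using hpos
    have hne : τ.reg .mn ≠ b := by
      rintro h
      exact hb (h ▸ hpos)
    refine wp_assign (by simp) ?_
    simp only [State.setReg_reg_same, Expr.eval_add, Expr.eval_var, Expr.eval_ofNat]
    refine ⟨⟨by omega, by omega, by omega, fun a h5 h6 => ?_⟩, by omega⟩
    rcases eq_or_ne a (τ.reg .mn) with rfl | hne'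
    · exact hpos
    · exact h4 a h5 (by omega)
  · rintro T τ hF ⟨h1, h2, h3, h4⟩ hpos
    have hf : τ.arr .first = σ.arr .first := hF.2 .first (by decide)
    exact ⟨h1, h2, by omega, h4, by simpa [hf] using hpos⟩

section

open Var Arr Test Cmd

local infix:50 " ≔ " => Cmd.assign
local infixr:40 " ;; " => Cmd.seq

/-- The loop of the search over the vertices in descending order of their upper bounds. -/
abbrev searchLoop : Cmd :=
  loop (lt 0 r)
    (r ≔ r - 1 ;;
     v ≔ ord r ;;
     branch (and (eq size k) (le (hhat v) mn))
      (r ≔ 0)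
      (computeScore ;;
       branch (lt size k)
        (insertVertex ;;
         branch (lt h mn) (mn ≔ h) skip ;;
         size ≔ size + 1)
        (branch (lt mn h)
          (u ≔ first mn - 1 ;;
           store first mn (next u) ;;
           store mem u 0 ;;
           insertVertex ;;
           loop (eq (first mn) 0) (mn ≔ mn + 1))
          skip)))

end

/-! ### The search loop and its amortised cost -/

theorem wp_searchLoop {K N k : ℕ} {σ : State} {sc hh cost pos ord : ℕ → ℕ}
    (hk : σ.reg .k = k) (hr : σ.reg .r = N) (hmn : σ.reg .mn = N) (hsize : σ.reg .size = 0)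
    (hhh : σ.arr .hhat = hh) (hord : σ.arr .ord = ord)
    (hB : Buckets N sc ∅ (σ.arr .first) (σ.arr .next) (σ.arr .mem))
    (hloc : ∀ u < N, σ.arr .loc u = 0)
    (hkN : k ≤ N) (hK : N < K) (hhN : ∀ v < N, hh v < N) (hsc : ∀ v < N, sc v ≤ hh v)
    (hpos : ∀ v < N, pos v < N ∧ ord (pos v) = v) (hpos' : ∀ q < N, ord q < N ∧ pos (ord q) = q)
    (hmono : ∀ v < N, ∀ w < N, pos v ≤ pos w → hh v ≤ hh w)
    (hcs : ∀ τ : State, τ.reg .v < N → τ.arr .off = σ.arr .off → τ.arr .adj = σ.arr .adj →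
      τ.arr .ooff = σ.arr .ooff → τ.arr .oadj = σ.arr .oadj → (∀ u < N, τ.arr .loc u = 0) →
      wp K computeScore (fun T τ' => T ≤ cost (τ.reg .v) ∧ (∀ u < N, τ'.arr .loc u = 0) ∧
        τ'.reg .h = sc (τ.reg .v)) τ) :
    wp K searchLoop (fun T τ => T ≤ ∑ v ∈ range N, (cost v + 20) + 2 * N + 10 ∧
      ∃ S ⊆ range N, #S = k ∧ (∀ v < N, τ.arr .mem v = 1 ↔ v ∈ S) ∧
        ∀ u ∈ S, ∀ w < N, w ∉ S → sc w ≤ sc u) σ := by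
  have hscN : ∀ v < N, sc v < N := fun v hv => (hsc v hv).trans_lt (hhN v hv)
  have hP : ∀ r, ∀ u ∈ ({w ∈ range N | r ≤ pos w} : Finset ℕ), sc u < N := fun r u hu =>
    hscN u (by simpa using (mem_filter.1 hu).1)
  unfold searchLoop
  -- The first alternative describes a running search that has treated the places from `r` on, the
  -- second a search ended by the early stop. As long as the answer is not full, `mn` may fall and
  -- is not charged; afterwards it only rises, and `2 * mn` pays for all its steps.
  refine wp_loop (fun T τ => (∀ u < N, τ.arr .loc u = 0) ∧ ∃ P ⊆ range N, ∃ S,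
      Selected N k sc P S (τ.reg .mn) ∧ #S = τ.reg .size ∧
      Buckets N sc S (τ.arr .first) (τ.arr .next) (τ.arr .mem) ∧
      ((P = {w ∈ range N | τ.reg .r ≤ pos w} ∧ τ.reg .r ≤ N ∧
          T ≤ ∑ v ∈ P, (cost v + 20) + (if #S < k then 0 else 2 * τ.reg .mn)) ∨
        (τ.reg .r = 0 ∧ #S = k ∧ (∀ w < N, w ∉ S → sc w ≤ τ.reg .mn) ∧
          T ≤ ∑ v ∈ range N, (cost v + 20) + 2 * N + 9)))
    (fun τ => τ.reg .r) ?_ ?_ ?_ ?_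
  · refine ⟨hloc, ∅, empty_subset _, ∅, ⟨subset_rfl, by simp, by simp, .inl ⟨rfl, hmn⟩, by simp,
      by simp⟩, by simp [hsize], hB, .inl ⟨?_, hr.le, by simp⟩⟩
    rw [eq_comm, filter_eq_empty_iff]
    intro w hw
    have := (hpos w (by simpa using hw)).1
    omega
  · simp
  · rintro T τ hF ⟨hloc, P, hPN, S, hS, hSs, hB, H⟩ hpos0
    have hpos0 : 0 < τ.reg .r := by simpa using hpos0
    obtain ⟨hPr, hrN, hT⟩ : P = {w ∈ range N | τ.reg .r ≤ pos w} ∧ τ.reg .r ≤ N ∧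
        T ≤ ∑ v ∈ P, (cost v + 20) + (if #S < k then 0 else 2 * τ.reg .mn) := by
      rcases H with H | H
      · exact H
      · omega
    clear H
    have hmnN := hS.mn_le (fun u hu => hscN u (by simpa using hPN hu))
    have hk₁ : τ.reg .k = k := (hF.1 .k (by decide)).trans hk
    have hh₁ : τ.arr .hhat = hh := (hF.2 .hhat (by decide)).trans hhh
    have ho₁ : τ.arr .ord = ord := (hF.2 .ord (by decide)).trans hord
    obtain ⟨r, hr⟩ : ∃ r, τ.reg .r = r + 1 := ⟨τ.reg .r - 1, by omega⟩
    rw [hr] at hPr hrN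
    obtain ⟨hvN, hpv⟩ := hpos' r hrN
    set v := ord r with hv
    have hvP : v ∉ P := by simp [hPr, hpv]
    have hP' : insert v P = {w ∈ range N | r ≤ pos w} := by
      ext w
      simp only [hPr, mem_insert, mem_filter, mem_range]
      constructor
      · rintro (rfl | ⟨h1, h2⟩)
        · exact ⟨hvN, hpv.ge⟩
        · exact ⟨h1, by omega⟩
      · rintro ⟨h1, h2⟩
        rcases h2.eq_or_lt with h3 | h3
        · left
          rw [hv, h3, (hpos w h1).2]
        · exact .inr ⟨h1, h3⟩
    have hP'N : insert v P ⊆ range N := by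
      rw [hP']
      exact filter_subset ..
    have hsum : ∑ w ∈ insert v P, (cost w + 20) = cost v + 20 + ∑ w ∈ P, (cost w + 20) :=
      sum_insert hvP
    refine wp_seq (wp_assign (by simp) ?_)
    simp only [Expr.eval_sub, Expr.eval_var, Expr.eval_ofNat, hr, Nat.add_sub_cancel]
    refine wp_seq (wp_assign (by simp; omega) ?_)
    simp only [Expr.eval_get, Expr.eval_var, State.setReg_reg_same, State.setReg_arr, ho₁, ← hv]
    refine wp_branch (by simp; omega) ?_ ?_
    · intro hbr
      obtain ⟨hsk, hle⟩ : #S = k ∧ hh v ≤ τ.reg .mn := by simpa [hk₁, hh₁, ← hSs] using hbr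
      refine wp_assign (by simp) ?_
      simp only [State.setReg_arr, ne_eq, reduceCtorEq, not_false_eq_true, State.setReg_reg_ne,
        State.setReg_reg_same, Expr.eval_ofNat]
      refine ⟨⟨hloc, P, hPN, S, hS, hSs, hB, .inr ⟨trivial, hsk, fun w hw hwS => ?_, ?_⟩⟩,
        by omega⟩
      -- An untreated vertex precedes or equals `v` in the sorted order, so its score is at most its
      -- bound, at most that of `v`, at most `mn`.
      · by_cases hwP : w ∈ P
        · exact hS.ge w hwP hwS
        · have : pos w < r + 1 := by simpa [hPr, hw] using hwP
          exact (hsc w hw).trans ((hmono w hw v hvN (by omega)).trans hle)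
      · have := sum_le_sum_of_subset (f := fun v => cost v + 20) hPN
        rw [if_neg (by omega)] at hT
        omega
    · intro hbr
      replace hbr : #S = k → ¬ hh v ≤ τ.reg .mn := by simpa [hk₁, hh₁, ← hSs] using hbr
      refine wp_seq ((hcs _ ?_ ?_ ?_ ?_ ?_ ?_).mono ?_)
      · simpa using hvN
      · simpa using hF.2 .off (by decide)
      · simpa using hF.2 .adj (by decide)
      · simpa using hF.2 .ooff (by decide)
      · simpa using hF.2 .oadj (by decide)
      · exact hloc
      rintro T₂ τ₂ hF₂ ⟨hT₂, hloc₂, hh₂⟩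
      simp only [State.setReg_reg_same] at hT₂ hh₂
      have hk₂ : τ₂.reg .k = k := (hF₂.1 .k (by decide)).trans (by simpa using hk₁)
      have hr₂ : τ₂.reg .r = r := (hF₂.1 .r (by decide)).trans (by simp)
      have hv₂ : τ₂.reg .v = v := (hF₂.1 .v (by decide)).trans (by simp)
      have hmn₂ : τ₂.reg .mn = τ.reg .mn := (hF₂.1 .mn (by decide)).trans (by simp)
      have hs₂ : τ₂.reg .size = #S := (hF₂.1 .size (by decide)).trans (by simp [hSs])
      have hfi₂ : τ₂.arr .first = τ.arr .first := (hF₂.2 .first (by decide)).trans (by simp)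
      have hne₂ : τ₂.arr .next = τ.arr .next := (hF₂.2 .next (by decide)).trans (by simp)
      have hme₂ : τ₂.arr .mem = τ.arr .mem := (hF₂.2 .mem (by decide)).trans (by simp)
      have hsvN := hscN v hvN
      rw [← hfi₂, ← hne₂, ← hme₂] at hB
      generalize τ.reg .mn = mn at *
      clear hF hF₂
      have hvS : v ∉ S := fun h => hvP (hS.subset h)
      refine wp_branch (by simp) ?_ ?_
      · intro hlt
        have hlt : #S < k := by simpa [hk₂, hs₂] using hlt
        rw [if_pos hlt] at hT
        refine wp_seq ((wp_insertVertex hv₂ hh₂ (by omega) (by omega)).mono ?_)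
        rintro T₃ τ₃ hF₃ ⟨rfl, hfi₃, hne₃, hme₃⟩
        have hr₃ : τ₃.reg .r = r := (hF₃.1 .r (by decide)).trans hr₂
        have hmn₃ : τ₃.reg .mn = mn := (hF₃.1 .mn (by decide)).trans hmn₂
        have hh₃ : τ₃.reg .h = sc v := (hF₃.1 .h (by decide)).trans hh₂
        have hs₃ : τ₃.reg .size = #S := (hF₃.1 .size (by decide)).trans hs₂
        have hloc₃ : τ₃.arr .loc = τ₂.arr .loc := hF₃.2 .loc (by decide)
        refine wp_seq ?_
        have key : wp K (.branch (.lt Var.h Var.mn) (.assign .mn Var.h) .skip) (fun T τ' => T = 2 ∧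
            τ'.reg .mn = min mn (sc v)) τ₃ := by
          refine wp_branch (by simp) ?_ ?_
          · intro h
            have h : sc v < mn := by simpa [hh₃, hmn₃] using h
            exact wp_assign (by simp) ⟨rfl, by simp [hh₃, min_eq_right h.le]⟩
          · intro h
            have h : mn ≤ sc v := by simpa [hh₃, hmn₃] using h
            exact wp_skip ⟨rfl, by simp [hmn₃, min_eq_left h]⟩
        refine key.mono ?_
        rintro T₄ τ₄ hF₄ ⟨rfl, hmn₄⟩
        have hr₄ : τ₄.reg .r = r := (hF₄.1 .r (by decide)).trans hr₃
        have hs₄ : τ₄.reg .size = #S := (hF₄.1 .size (by decide)).trans hs₃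
        refine wp_assign (by simp) ?_
        simp only [State.setReg_arr, ne_eq, reduceCtorEq, not_false_eq_true, State.setReg_reg_ne,
          State.setReg_reg_same, Expr.eval_ofNat, Expr.eval_add, Expr.eval_var, hs₄, hr₄, hmn₄]
        refine ⟨⟨?_, insert v P, hP'N, insert v S, hS.add hlt hvP hsvN, card_insert_of_notMem hvS,
          ?_, .inl ⟨hP', by omega, ?_⟩⟩, by omega⟩
        · rw [hF₄.2 .loc (by decide), hloc₃]
          exact hloc₂
        · rw [hF₄.2 .first (by decide), hF₄.2 .next (by decide), hF₄.2 .mem (by decide), hfi₃,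
            hne₃, hme₃]
          exact hB.insert hvS
        · rw [hsum]
          omega
      · intro hlt
        have hlt : k ≤ #S := by simpa [hk₂, hs₂] using hlt
        have hSk : #S = k := le_antisymm hS.card_le hlt
        rw [if_neg (by omega)] at hT
        refine wp_branch (by simp) ?_ ?_
        · intro hlt'
          have hlt' : mn < sc v := by simpa [hmn₂, hh₂] using hlt'
          obtain ⟨u', hu', hum'⟩ : ∃ u ∈ S, sc u = mn := by
            -- An empty full answer means `k = 0` and `mn = N`, which no score exceeds; so nothing
            -- is replaced.
            rcases hS.least with ⟨-, h⟩ | h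
            · omega
            · exact h
          have hfm : τ₂.arr .first mn ≠ 0 := by
            rw [ne_eq, (hB.list mn (by omega)).eq_zero_iff, ← ne_eq, ← nonempty_iff_ne_empty]
            exact ⟨u', mem_filter.2 ⟨hu', hum'⟩⟩
          obtain ⟨u, huS, hum, hfu, hB'⟩ := hB.erase_first (by omega) hfm
          have huN : u < N := by simpa using hPN (hS.subset huS)
          refine wp_seq (wp_assign (by simp [hmn₂]; omega) ?_)
          simp only [Expr.eval_get, Expr.eval_sub, Expr.eval_var, Expr.eval_ofNat, hmn₂, hfu,
            Nat.add_sub_cancel]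
          refine wp_seq (wp_store (by simp [hmn₂]; omega) (by simp) (by simp; omega) ?_)
          simp only [Expr.eval_get, Expr.eval_var, State.setReg_reg_same, ne_eq, reduceCtorEq,
            not_false_eq_true, State.setReg_reg_ne, State.setReg_arr, hmn₂]
          refine wp_seq (wp_store (by simp; omega) (by simp) (by simp) ?_)
          simp only [Expr.eval_ofNat, Expr.eval_var, State.setReg_reg_same, State.setCell_reg]
          refine wp_seq ((wp_insertVertex (v := v) (s := sc v) (by simpa using hv₂)
            (by simpa using hh₂) (by omega) (by omega)).mono ?_)
          rintro T₃ τ₃ hF₃ ⟨rfl, hfi₃, hne₃, hme₃⟩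
          simp only [State.setCell_arr_same, ne_eq, reduceCtorEq, not_false_eq_true,
            State.setCell_arr_ne, State.setReg_arr] at hfi₃ hne₃ hme₃
          have hr₃ : τ₃.reg .r = r := (hF₃.1 .r (by decide)).trans (by simpa using hr₂)
          have hmn₃ : τ₃.reg .mn = mn := (hF₃.1 .mn (by decide)).trans (by simpa using hmn₂)
          have hs₃ : τ₃.reg .size = #S := (hF₃.1 .size (by decide)).trans (by simpa using hs₂)
          have hloc₃ : τ₃.arr .loc = τ₂.arr .loc := (hF₃.2 .loc (by decide)).trans (by simp)
          have hvS' : v ∉ S.erase u := fun h => hvS (mem_of_mem_erase h)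
          replace hB' := hB'.insert hvS'
          rw [← hfi₃, ← hne₃, ← hme₃] at hB'
          -- The bucket of the score of `v` is nonempty, since `v` has just been entered; it bounds
          -- the advance.
          refine (wp_advance hmn₃ hlt'.le (by simp [hfi₃]) (by omega)).mono ?_
          rintro T₄ τ₄ hF₄ ⟨h1, h2, rfl, h3, h4⟩
          simp only [hF₄.1 .r (by decide), hF₄.1 .size (by decide), hF₄.2 .loc (by decide),
            hF₄.2 .first (by decide), hF₄.2 .next (by decide), hF₄.2 .mem (by decide), hr₃, hs₃,
            hloc₃]
          generalize τ₄.reg .mn = mn' at *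
          have hcard : #(insert v (S.erase u)) = #S := by
            rw [card_insert_of_notMem hvS', card_erase_add_one huS]
          refine ⟨⟨hloc₂, insert v P, hP'N, insert v (S.erase u),
            hS.replace hSk hvP hlt' huS hum h1 ?_ ?_, hcard, hB', .inl ⟨hP', by omega, ?_⟩⟩,
            by omega⟩
          · rw [ne_eq, (hB'.list mn' (by omega)).eq_zero_iff, ← ne_eq, ← nonempty_iff_ne_empty] at h4
            obtain ⟨w, hw⟩ := h4
            exact ⟨w, (mem_filter.1 hw).1, (mem_filter.1 hw).2⟩
          · intro w hw
            by_contra! hlt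
            have hwm : mn ≤ sc w := by
              rcases mem_insert.1 hw with rfl | hw
              · exact hlt'.le
              · exact hS.le w (mem_of_mem_erase hw)
            have := (hB'.list (sc w) (by omega)).eq_zero_iff.1 (h3 _ hwm hlt)
            exact notMem_empty w (this ▸ mem_filter.2 ⟨hw, rfl⟩)
          · rw [hsum, hcard, if_neg (by omega)]
            omega
        · intro hle
          have hle : sc v ≤ mn := by simpa [hmn₂, hh₂] using hle
          refine wp_skip ?_
          simp only [hr₂, hmn₂, hs₂]
          refine ⟨⟨hloc₂, insert v P, hP'N, S, hS.pass hSk hle, rfl, hB,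
            .inl ⟨hP', by omega, ?_⟩⟩, by omega⟩
          rw [hsum, if_neg (by omega)]
          omega
  · rintro T τ hF ⟨-, P, hPN, S, hS, hSs, hB, H⟩ hneg
    have hr0 : τ.reg .r = 0 := by simpa using hneg
    have hmnN := hS.mn_le (fun u hu => hscN u (by simpa using hPN hu))
    have key : #S = k ∧ (∀ w < N, w ∉ S → sc w ≤ τ.reg .mn) ∧
        T ≤ ∑ v ∈ range N, (cost v + 20) + 2 * N + 9 := by
      rcases H with ⟨hP, -, hT⟩ | ⟨-, H⟩
      · have hPN : P = range N := by
          rw [hP, hr0]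
          simp
        subst hPN
        refine ⟨?_, fun w hw hwS => hS.ge w (by simpa using hw) hwS, ?_⟩
        · by_contra hne
          have hlt : #S < k := lt_of_le_of_ne hS.card_le hne
          rw [hS.eq hlt, card_range] at hlt
          omega
        · split_ifs at hT <;> omega
      · exact H
    exact ⟨by omega, S, hS.subset.trans hPN, key.1, hB.mem_iff,
      fun u hu w hw hwS => (key.2.1 w hw hwS).trans (hS.le u hu)⟩

/-- The whole search, for a function `sc` of the scores. -/
theorem wp_topKSearch {K N k : ℕ} {σ : State} {R : ℕ → ℕ → Prop} [DecidableRel R] {f g sc : ℕ → ℕ}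
    [DecidableRel (Oriented R f)]
    (hn : σ.reg .n = N) (hk : σ.reg .k = k) (hf : σ.arr .off = f) (hg : σ.arr .adj = g)
    (hL : Lists N f g R) (hR : IsGraph N R) (hkN : k ≤ N) (hK : N < K) (hK' : 2 * f N ≤ K)
    (hscore : ∀ v < N, ∀ κ tm s,
      (∀ i < f (v + 1) - f v,
        HasCoreness (egoRel (f (v + 1) - f v) (fun i => g (f v + i)) R) i (κ i)) →
      (∀ i < f (v + 1) - f v, κ i ≤ tm) → tm ≤ f (v + 1) - f v →
      IsHIndex (fun r => (topComps (egoRel (f (v + 1) - f v) (fun i => g (f v + i)) R) κ r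
        (Set.Iio (f (v + 1) - f v))).ncard) tm s → s = sc v)
    (hbound : ∀ φ : ℕ → ℕ, (∀ x < N, HasCoreness R x (φ x)) → ∀ v < N, sc v * (sc v + 1) ≤
      #{e ∈ Ico (f v) (f (v + 1)) | sc v ≤ min (φ (g e) - 1) (φ v)}) :
    wp K topKSearch (fun T τ =>
      T ≤ 400 * N + 400 * f N + 200 + 100 * ∑ v ∈ range N, ∑ e ∈ Ico (f v) (f (v + 1)),
        #{w ∈ range N | Oriented R f (g e) w} ∧
      ∃ S ⊆ range N, #S = k ∧ (∀ v < N, τ.arr .mem v = 1 ↔ v ∈ S) ∧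
        ∀ u ∈ S, ∀ w < N, w ∉ S → sc w ≤ sc u) σ := by
  subst hn
  unfold topKSearch
  refine wp_seq ((wp_coreDecomposition (R := R) (by decide) (by decide) (by decide) (by decide)
    (by rwa [hf, hg]) hR hK (by rw [hf]; omega)).mono ?_)
  rintro T₁ σ₁ hF₁ ⟨hT₁, hcore⟩
  rw [hf] at hT₁
  have hn₁ : σ₁.reg .n = σ.reg .n := hF₁.1 .n (by decide)
  generalize σ.reg .n = N at *
  have hk₁ : σ₁.reg .k = k := (hF₁.1 .k (by decide)).trans hk
  have hf₁ : σ₁.arr .off = f := (hF₁.2 .off (by decide)).trans hf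
  have hg₁ : σ₁.arr .adj = g := (hF₁.2 .adj (by decide)).trans hg
  refine wp_seq ((wp_upperBounds hn₁ hf₁ hg₁ rfl hL hR hcore hK (by omega)).mono ?_)
  rintro T₂ σ₂ hF₂ ⟨hT₂, hhat⟩
  have hn₂ : σ₂.reg .n = N := (hF₂.1 .n (by decide)).trans hn₁
  have hk₂ : σ₂.reg .k = k := (hF₂.1 .k (by decide)).trans hk₁
  have hf₂ : σ₂.arr .off = f := (hF₂.2 .off (by decide)).trans hf₁
  have hg₂ : σ₂.arr .adj = g := (hF₂.2 .adj (by decide)).trans hg₁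
  refine wp_seq ((wp_binSort (by decide) (by decide) (by decide) (by omega)
    (by rw [hn₂]; exact fun v hv => (hhat v hv).1)).mono ?_)
  rintro T₃ σ₃ hF₃ ⟨hT₃, hsort⟩
  rw [hn₂] at hT₃ hsort
  have hn₃ : σ₃.reg .n = N := (hF₃.1 .n (by decide)).trans hn₂
  have hk₃ : σ₃.reg .k = k := (hF₃.1 .k (by decide)).trans hk₂
  have hf₃ : σ₃.arr .off = f := (hF₃.2 .off (by decide)).trans hf₂
  have hg₃ : σ₃.arr .adj = g := (hF₃.2 .adj (by decide)).trans hg₂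
  have hh₃ : σ₃.arr .hhat = σ₂.arr .hhat := hF₃.2 .hhat (by decide)
  refine wp_seq ((wp_orientEdges (R := R) (by rwa [hn₃, hf₃, hg₃]) (by rwa [hn₃]) (by omega)
    (by rw [hn₃, hf₃]; omega)).mono ?_)
  rintro T₄ σ₄ hF₄ ⟨hT₄, hO, hoM⟩
  rw [hn₃, hf₃] at hT₄ hO hoM
  have hn₄ : σ₄.reg .n = N := (hF₄.1 .n (by decide)).trans hn₃
  have hk₄ : σ₄.reg .k = k := (hF₄.1 .k (by decide)).trans hk₃
  have hf₄ : σ₄.arr .off = f := (hF₄.2 .off (by decide)).trans hf₃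
  have hg₄ : σ₄.arr .adj = g := (hF₄.2 .adj (by decide)).trans hg₃
  have hh₄ : σ₄.arr .hhat = σ₂.arr .hhat := (hF₄.2 .hhat (by decide)).trans hh₃
  have ho₄ : σ₄.arr .ord = σ₃.arr .ord := hF₄.2 .ord (by decide)
  refine wp_seq (wp_forRange (fun i T τ => T = 1 + 5 * i ∧ ∀ u < i, τ.arr .loc u = 0 ∧
    τ.arr .first u = 0 ∧ τ.arr .mem u = 0) 0 N (by simp) (by simp) (Nat.zero_le _) ?_ (by decide)
    (by simp) ?_ ?_)
  · intro i T τ _ _ _ hF _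
    simp [hF.1 .n (by decide), hn₄]
  · rintro i T τ - hi hτ - ⟨hT, h⟩
    refine wp_seq (wp_store (by simp; omega) (by simp) (by simp) ?_)
    refine wp_seq (wp_store (by simp; omega) (by simp) (by simp) ?_)
    refine wp_store (by simp; omega) (by simp) (by simp) ?_
    refine ⟨by omega, fun u hu => ?_⟩
    rcases eq_or_ne u i with rfl | hne
    · simp [hτ]
    · have := h u (by omega)
      simp [hτ, hne, this]
  rintro T₅ σ₅ - hF₅ ⟨rfl, h0⟩
  have hn₅ : σ₅.reg .n = N := (hF₅.1 .n (by decide)).trans hn₄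
  have hk₅ : σ₅.reg .k = k := (hF₅.1 .k (by decide)).trans hk₄
  have hf₅ : σ₅.arr .off = f := (hF₅.2 .off (by decide)).trans hf₄
  have hg₅ : σ₅.arr .adj = g := (hF₅.2 .adj (by decide)).trans hg₄
  have hh₅ : σ₅.arr .hhat = σ₂.arr .hhat := (hF₅.2 .hhat (by decide)).trans hh₄
  have ho₅ : σ₅.arr .ord = σ₃.arr .ord := (hF₅.2 .ord (by decide)).trans ho₄
  have hoo₅ : σ₅.arr .ooff = σ₄.arr .ooff := hF₅.2 .ooff (by decide)
  have hoa₅ : σ₅.arr .oadj = σ₄.arr .oadj := hF₅.2 .oadj (by decide)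
  refine wp_seq (wp_assign (by simp) (wp_seq (wp_assign (by simp) (wp_seq (wp_assign (by simp)
    ?_)))))
  obtain ⟨pos, hpos, hpos', hlt⟩ := hsort.perm
  generalize σ₄.arr .ooff = o at *
  set W : ℕ → ℕ := fun v =>
    ∑ i ∈ range (f (v + 1) - f v), (o (g (f v + i) + 1) - o (g (f v + i))) with hW
  refine (wp_searchLoop (N := N) (k := k) (sc := sc) (hh := σ₂.arr .hhat) (pos := pos)
    (ord := σ₃.arr .ord)
    (cost := fun v => 200 * (f (v + 1) - f v) + 100 * W v + 200) ?_ ?_ ?_ ?_ ?_ ?_ ?_ ?_ hkN hK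
    (fun v hv => (hhat v hv).1)
    (fun v hv => (hhat v hv).2 _ (hbound _ hcore v hv)) hpos hpos' ?_ ?_).mono ?_
  · simpa using hk₅
  · simpa using hn₅
  · simpa using hn₅
  · simp
  · simpa using hh₅
  · simpa using ho₅
  · refine ⟨fun v hv => ?_, fun a ha => ?_⟩
    · simp [(h0 v hv).2.2]
    · simp only [State.setReg_arr, (h0 a ha).2.1, filter_empty]
      exact .nil
  · exact fun u hu => (h0 u hu).1
  -- Ascending order of the bounds along the sorted places, read off from the block boundaries of
  -- the bin sort.
  · intro v hv w hw hvw
    by_contra! h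
    have h1 := (hlt w hw (σ₂.arr .hhat v)).2 h
    have h2 := (hlt v hv (σ₂.arr .hhat v)).1 (hvw.trans_lt h1)
    exact h2.false
  · intro τ hv hf' hg' ho' hoa' hloc
    simp only [State.setReg_arr, hf₅, hg₅, hoo₅, hoa₅] at hf' hg' ho' hoa'
    refine (wp_computeScore (R := R) rfl hv hf' ho'
      (a := fun i => g (f (τ.reg .v) + i)) (fun i => by rw [hg']) rfl (by rwa [hg']) hR
      (by rwa [hoa']) hoM hloc hK hK').mono ?_
    rintro T τ' - ⟨hT, hloc', κ, tm, h1, h2, h3, h4⟩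
    exact ⟨hT, hloc', hscore _ hv κ tm _ h1 h2 h3 h4⟩
  · rintro T τ - ⟨hT, hS⟩
    refine ⟨?_, hS⟩
    have hsum : ∑ v ∈ range N, (f (v + 1) - f v) = f N := by
      rw [← hL.sum_degree hR.lt']
      exact sum_congr rfl fun v hv => (hL.degree hR.lt' (by simpa using hv)).symm
    have hWsum : ∑ v ∈ range N, ∑ e ∈ Ico (f v) (f (v + 1)),
        #{w ∈ range N | Oriented R f (g e) w} = ∑ v ∈ range N, W v := by
      refine sum_congr rfl fun v hv => ?_
      rw [sum_Ico_eq_sum_range]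
      refine sum_congr rfl fun i hi => ?_
      have hv : v < N := by simpa using hv
      have hi : i < f (v + 1) - f v := by simpa using hi
      exact hO.degree (fun h => hR.lt' h.1) (hR.lt' (hL.rel hv (by omega) (by omega)))
    rw [hWsum]
    simp only [sum_add_distrib, ← mul_sum, hsum, sum_const, card_range, smul_eq_mul] at hT
    omega

/-! ## Discriminative cores and components of equal coreness -/

section Cores

variable {W : Type*} {H : SimpleGraph W}

theorem coreness_le {K : H.Subgraph} {v : W} (hv : v ∈ K.verts) :
    coreness K ≤ (K.neighborSet v).ncard := Nat.sInf_le ⟨v, hv, rfl⟩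

theorem le_coreness {K : H.Subgraph} {t : ℕ} (hne : K.verts.Nonempty)
    (h : ∀ v ∈ K.verts, t ≤ (K.neighborSet v).ncard) : t ≤ coreness K := by
  obtain ⟨v, hv⟩ := hne
  refine le_csInf ⟨_, v, hv, rfl⟩ ?_
  rintro _ ⟨w, hw, rfl⟩
  exact h w hw

/-- The vertices that are reachable from `u` through vertices of coreness at least `t`. -/
abbrev upComp (H : SimpleGraph W) (κ : W → ℕ) (t : ℕ) (u : W) : Set W :=
  levelComp H.Adj (fun x => min (κ x) t) t u

/-- The subgraph induced by `upComp H κ t u`. -/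
abbrev upCore (H : SimpleGraph W) (κ : W → ℕ) (t : ℕ) (u : W) : H.Subgraph :=
  (⊤ : H.Subgraph).induce (upComp H κ t u)

variable {κ : W → ℕ} {t : ℕ}

theorem upComp_closed {u x y : W} (hx : x ∈ upComp H κ t u) (h : H.Adj x y) (htx : t ≤ κ x)
    (hty : t ≤ κ y) : y ∈ upComp H κ t u :=
  Relation.ReflTransGen.tail hx ⟨h, min_eq_right htx, min_eq_right hty⟩

/-- Truncating the coreness at `t` turns "at least `t`" into "exactly `t`", so the facts on
components of one level apply to the upper sets as well. -/
theorem le_of_mem_upComp {u x : W} (hu : t ≤ κ u) (hx : x ∈ upComp H κ t u) : t ≤ κ x :=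
  min_eq_right_iff.1 (levelComp_level (κ := fun x => min (κ x) t) (min_eq_right hu) hx)

theorem upComp_anti {s u : W} {r : ℕ} (hrt : r ≤ t) (hs : s ∈ upComp H κ r u) :
    upComp H κ t s ⊆ upComp H κ r u := by
  refine levelComp_subset hs fun x hx y hxy => upComp_closed hx hxy.1 ?_ ?_
  · exact hrt.trans (min_eq_right_iff.1 hxy.2.1)
  · exact hrt.trans (min_eq_right_iff.1 hxy.2.2)

theorem upCore_connected (u : W) : (upCore H κ t u).Connected := by
  rw [← SimpleGraph.connected_induce_iff]
  rw [SimpleGraph.connected_iff_exists_forall_reachable]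
  refine ⟨⟨u, mem_levelComp_self u⟩, ?_⟩
  rintro ⟨y, hy⟩
  have key : ∀ y (h : Relation.ReflTransGen (LevelAdj H.Adj (fun x => min (κ x) t) t) u y),
      (H.induce (upComp H κ t u)).Reachable ⟨u, mem_levelComp_self u⟩ ⟨y, h⟩ := by
    intro y h
    induction h with
    | refl => rfl
    | tail h h' ih =>
      refine ih.trans (SimpleGraph.Adj.reachable ?_)
      exact h'.1
  exact key y hy

section Finite

variable [Finite W] [DecidableRel H.Adj]

theorem le_of_forall_le_ncard (hκ : ∀ x, HasCoreness H.Adj x (κ x)) {K : H.Subgraph}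
    (h : ∀ v ∈ K.verts, t ≤ (K.neighborSet v).ncard) {v : W} (hv : v ∈ K.verts) : t ≤ κ v := by
  refine (hκ v t).2 ⟨K.verts.toFinite.toFinset, by simpa using hv, fun w hw => ?_⟩
  refine (h w (by simpa using hw)).trans ?_
  rw [← Set.ncard_coe_finset]
  refine Set.ncard_le_ncard (fun z hz => ?_) (Set.toFinite _)
  have hz : K.Adj w z := hz
  simpa using ⟨K.edge_vert hz.symm, K.adj_sub hz⟩

/-- All members of a `t`-core through `v` have coreness at least `t`, so the neighbours of `v` in it
belong to the same component. -/
theorem le_ncard_upCore (hκ : ∀ x, HasCoreness H.Adj x (κ x)) {u v : W} (hu : t ≤ κ u)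
    (hv : v ∈ upComp H κ t u) : t ≤ ((upCore H κ t u).neighborSet v).ncard := by
  obtain ⟨S, hvS, hS⟩ := (hκ v t).1 (le_of_mem_upComp hu hv)
  refine (hS v hvS).trans ?_
  rw [← Set.ncard_coe_finset]
  refine Set.ncard_le_ncard (fun z hz => ?_) (Set.toFinite _)
  obtain ⟨hzS, hvz⟩ := by simpa using hz
  simp only [SimpleGraph.Subgraph.mem_neighborSet, SimpleGraph.Subgraph.induce_adj,
    SimpleGraph.Subgraph.top_adj]
  exact ⟨hv, upComp_closed hv hvz (le_of_mem_upComp hu hv) ((hκ z t).2 ⟨S, hzS, hS⟩), hvz⟩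

theorem isConnectedCore_upCore (hκ : ∀ x, HasCoreness H.Adj x (κ x)) {u : W} (hu : t ≤ κ u) :
    IsConnectedCore t (upCore H κ t u) :=
  ⟨upCore_connected u, fun _ hv => le_ncard_upCore hκ hu hv⟩

/-- The vertices of a connected `t`-core have coreness at least `t`, and a path inside it never
leaves the component. -/
theorem le_upCore (hκ : ∀ x, HasCoreness H.Adj x (κ x)) {K : H.Subgraph}
    (hK : IsConnectedCore t K) {u : W} (hu : u ∈ K.verts) : K ≤ upCore H κ t u := by
  have hsub : K.verts ⊆ upComp H κ t u := by
    intro y hy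
    have h := hK.1.preconnected ⟨u, hu⟩ ⟨y, hy⟩
    rw [SimpleGraph.reachable_iff_reflTransGen] at h
    refine Relation.ReflTransGen.lift (r := K.coe.Adj) (fun x => x.1) (fun a b hab => ?_) _ _ h
    exact ⟨K.adj_sub hab, min_eq_right (le_of_forall_le_ncard hκ hK.2 a.2),
      min_eq_right (le_of_forall_le_ncard hκ hK.2 b.2)⟩
  refine ⟨hsub, fun x y hxy => ?_⟩
  exact ⟨hsub (K.edge_vert hxy), hsub (K.edge_vert hxy.symm), K.adj_sub hxy⟩

theorem maximal_upCore (hκ : ∀ x, HasCoreness H.Adj x (κ x)) {u : W} (hu : t ≤ κ u) :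
    Maximal (IsConnectedCore t) (upCore H κ t u) :=
  ⟨isConnectedCore_upCore hκ hu, fun _ hK hle =>
    le_upCore hκ hK (hle.1 (mem_levelComp_self u))⟩

/-- Maximality makes a discriminative core of coreness `t` a full component of the vertices of
coreness at least `t`; the absence of denser subgraphs says that coreness `t` is never exceeded in
it. -/
theorem isDiscriminativeCore_iff (hκ : ∀ x, HasCoreness H.Adj x (κ x)) (K : H.Subgraph) :
    IsDiscriminativeCore K ∧ coreness K = t ↔
      ∃ s ∈ topComps H.Adj κ t Set.univ, (⊤ : H.Subgraph).induce s = K := by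
  constructor
  · rintro ⟨⟨hmax, hno⟩, rfl⟩
    obtain ⟨u, hu⟩ := hmax.1.1.nonempty
    have huκ := le_of_forall_le_ncard hκ hmax.1.2 hu
    have hK : K = upCore H κ (coreness K) u :=
      hmax.eq_of_le (isConnectedCore_upCore hκ huκ) (le_upCore hκ hmax.1 hu)
    generalize coreness K = t at *
    subst hK
    -- A vertex of coreness above `t` would bring its whole `(t + 1)`-core into the component, a
    -- subgraph of larger coreness.
    have hle : ∀ x ∈ upComp H κ t u, κ x = t := by
      intro x hx
      refine le_antisymm ?_ (le_of_mem_upComp huκ hx)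
      by_contra! hlt
      refine hno (upCore H κ (t + 1) x) ⟨x, mem_levelComp_self x⟩ ?_ ?_
      · exact SimpleGraph.Subgraph.induce_mono_right (upComp_anti (Nat.le_succ t) hx)
      · exact le_coreness ⟨x, mem_levelComp_self x⟩ fun v hv => le_ncard_upCore hκ hlt hv
    have heq : levelComp H.Adj κ t u = upComp H κ t u := by
      refine Set.Subset.antisymm ?_ ?_
      · exact levelComp_subset (mem_levelComp_self u) fun x hx y hxy =>
          upComp_closed hx hxy.1 hxy.2.1.ge hxy.2.2.ge
      · refine (levelComp_subset (s := levelComp H.Adj κ t u ∩ upComp H κ t u)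
          ⟨mem_levelComp_self u, mem_levelComp_self u⟩ fun x hx y hxy => ?_).trans
          Set.inter_subset_left
        have hy := upComp_closed hx.2 hxy.1 (min_eq_right_iff.1 hxy.2.1)
          (min_eq_right_iff.1 hxy.2.2)
        exact ⟨Relation.ReflTransGen.tail hx.1 ⟨hxy.1, hle x hx.2, hle y hy⟩, hy⟩
    refine ⟨upComp H κ t u, ⟨u, Set.mem_univ u, hle u (mem_levelComp_self u), heq, ?_⟩, rfl⟩
    intro y hy z hyz
    by_contra! hlt
    exact hlt.ne' (hle z (upComp_closed hy hyz (hle y hy).ge hlt.le))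
  · rintro ⟨_, ⟨u, -, rfl, rfl, htop⟩, rfl⟩
    -- Without edges to a larger coreness, walking through coreness at least `κ u` never leaves
    -- coreness exactly `κ u`.
    have heq : levelComp H.Adj κ (κ u) u = upComp H κ (κ u) u := by
      refine Set.Subset.antisymm ?_ ?_
      · exact levelComp_subset (mem_levelComp_self u) fun x hx y hxy =>
          upComp_closed hx hxy.1 hxy.2.1.ge hxy.2.2.ge
      · refine levelComp_subset (mem_levelComp_self u) fun x hx y hxy => ?_
        have h1 := htop x hx y hxy.1
        exact Relation.ReflTransGen.tail hx ⟨hxy.1, levelComp_level rfl hx,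
          le_antisymm h1 (min_eq_right_iff.1 hxy.2.2)⟩
    have hlev : ∀ x ∈ upComp H κ (κ u) u, κ x = κ u := fun x hx =>
      levelComp_level rfl (heq ▸ hx)
    rw [heq]
    have hc : coreness (upCore H κ (κ u) u) = κ u := by
      refine le_antisymm ?_ ?_
      · exact le_of_forall_le_ncard hκ (fun v hv => coreness_le hv) (mem_levelComp_self u)
      · exact le_coreness ⟨u, mem_levelComp_self u⟩ fun v hv => le_ncard_upCore hκ le_rfl hv
    refine ⟨⟨?_, ?_⟩, hc⟩
    · rw [hc]
      exact maximal_upCore hκ le_rfl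
    · rintro H' ⟨w, hw⟩ hle
      rw [hc, not_lt]
      exact (le_of_forall_le_ncard hκ (fun v hv => coreness_le hv) hw).trans
        (hlev w (hle.1 hw)).le

theorem ncard_isDiscriminativeCore (hκ : ∀ x, HasCoreness H.Adj x (κ x)) (t : ℕ) :
    {K : H.Subgraph | IsDiscriminativeCore K ∧ coreness K = t}.ncard =
      (topComps H.Adj κ t Set.univ).ncard := by
  rw [← Set.ncard_image_of_injective (topComps H.Adj κ t Set.univ)
    (f := fun s => (⊤ : H.Subgraph).induce s)
    fun s s' h => congrArg SimpleGraph.Subgraph.verts h]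
  congr 1
  ext K
  exact isDiscriminativeCore_iff hκ K

end Finite

end Cores

/-! ## Transport along an embedding -/

section Embedding

variable {α β : Type*} {E : α → α → Prop} {E' : β → β → Prop} {ψ : α → β}

/-- No edge of `E'` leaves the image, so core sets pull back and push forward along `ψ`. The same
observation underlies the two lemmas on components below. -/
theorem HasCoreness.of_embedding [DecidableRel E] [DecidableRel E'] (hψ : Function.Injective ψ)
    (hE : ∀ x y, E' (ψ x) (ψ y) ↔ E x y) (hE' : ∀ x y, E' (ψ x) y → y ∈ Set.range ψ)
    {x : α} {a : ℕ} (h : HasCoreness E' (ψ x) a) : HasCoreness E x a := by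
  classical
  intro t
  rw [h t]
  constructor
  · rintro ⟨W, hx, hW⟩
    refine ⟨W.preimage ψ hψ.injOn, by simpa using hx, fun w hw => ?_⟩
    refine (hW (ψ w) (by simpa using hw)).trans ?_
    rw [← card_image_of_injective _ hψ]
    refine card_le_card fun y hy => ?_
    obtain ⟨hyW, hwy⟩ := mem_filter.1 hy
    obtain ⟨z, rfl⟩ := hE' w y hwy
    simpa using ⟨z, ⟨hyW, (hE _ _).1 hwy⟩, rfl⟩
  · rintro ⟨W, hx, hW⟩
    refine ⟨W.image ψ, mem_image_of_mem _ hx, fun w hw => ?_⟩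
    obtain ⟨w, hw', rfl⟩ := mem_image.1 hw
    refine (hW w hw').trans ?_
    rw [← card_image_of_injective _ hψ]
    refine card_le_card fun y hy => ?_
    obtain ⟨z, hz, rfl⟩ := mem_image.1 hy
    obtain ⟨hzW, hwz⟩ := mem_filter.1 hz
    exact mem_filter.2 ⟨mem_image_of_mem _ hzW, (hE _ _).2 hwz⟩

theorem levelComp_embedding (hE : ∀ x y, E' (ψ x) (ψ y) ↔ E x y)
    (hE' : ∀ x y, E' (ψ x) y → y ∈ Set.range ψ) (κ : β → ℕ) (t : ℕ) (x : α) :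
    levelComp E' κ t (ψ x) = ψ '' levelComp E (fun x => κ (ψ x)) t x := by
  refine Set.Subset.antisymm ?_ ?_
  · refine levelComp_subset ⟨x, mem_levelComp_self x, rfl⟩ ?_
    rintro _ ⟨y, hy, rfl⟩ z hz
    obtain ⟨z, rfl⟩ := hE' y z hz.1
    exact ⟨z, Relation.ReflTransGen.tail hy ⟨(hE _ _).1 hz.1, hz.2⟩, rfl⟩
  · rintro _ ⟨y, hy, rfl⟩
    exact Relation.ReflTransGen.lift ψ (fun _ _ h => ⟨(hE _ _).2 h.1, h.2⟩) _ _ hy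

theorem ncard_topComps_embedding (hψ : Function.Injective ψ)
    (hE : ∀ x y, E' (ψ x) (ψ y) ↔ E x y)
    (hE' : ∀ x y, E' (ψ x) y → y ∈ Set.range ψ) (κ : β → ℕ) (t : ℕ) :
    (topComps E' κ t (Set.range ψ)).ncard =
      (topComps E (fun x => κ (ψ x)) t Set.univ).ncard := by
  rw [← Set.ncard_image_of_injective _ hψ.image_injective]
  congr 1
  have htop : ∀ s : Set α, IsTop E' κ t (ψ '' s) ↔ IsTop E (fun x => κ (ψ x)) t s := by
    intro s
    constructor
    · exact fun h y hy z hyz => h (ψ y) ⟨y, hy, rfl⟩ (ψ z) ((hE _ _).2 hyz)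
    · rintro h _ ⟨y, hy, rfl⟩ z hyz
      obtain ⟨z, rfl⟩ := hE' y z hyz
      exact h y hy z ((hE _ _).1 hyz)
  ext s
  constructor
  · rintro ⟨_, ⟨u, rfl⟩, hu, rfl, hs⟩
    rw [levelComp_embedding hE hE'] at hs ⊢
    exact ⟨_, ⟨u, Set.mem_univ u, hu, rfl, (htop _).1 hs⟩, rfl⟩
  · rintro ⟨_, ⟨u, -, hu, rfl, hs⟩, rfl⟩
    refine ⟨ψ u, ⟨u, rfl⟩, hu, levelComp_embedding hE hE' κ t u, (htop _).2 hs⟩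

end Embedding

/-! ## The scores in terms of labels -/

theorem exists_hasCoreness {α : Type*} {E : α → α → Prop} [DecidableRel E] {x : α} (s : Finset α)
    (hs : ∀ y, E x y → y ∈ s) : ∃ a, HasCoreness E x a := by
  classical
  refine ⟨Nat.findGreatest (fun t => ∃ W : Finset α, x ∈ W ∧ IsCoreSet E t W) #s, fun t => ?_⟩
  constructor
  · intro h
    obtain ⟨W, hx, hW⟩ := Nat.findGreatest_spec (m := 0)
      (P := fun t => ∃ W : Finset α, x ∈ W ∧ IsCoreSet E t W) (Nat.zero_le #s)
      ⟨{x}, mem_singleton_self x, fun _ _ => Nat.zero_le _⟩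
    exact ⟨W, hx, hW.anti h⟩
  · rintro ⟨W, hx, hW⟩
    refine Nat.le_findGreatest ?_ ⟨W, hx, hW⟩
    exact (hW x hx).trans (card_le_card fun y hy => hs y (mem_filter.1 hy).2)

/-- Take an `r`-core through a vertex `u` of such a component. The neighbours of `u` in it have
coreness at least `r`, and at most `r` because the component has no edge upwards; together with `u`
they give `r + 1` vertices of the component. Distinct components are disjoint. -/
theorem ncard_topComps_mul_le {d r : ℕ} {E : ℕ → ℕ → Prop} [DecidableRel E] {κ : ℕ → ℕ}
    (hE : IsGraph d E) (hκ : ∀ i < d, HasCoreness E i (κ i)) :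
    (topComps E κ r (Set.Iio d)).ncard * (r + 1) ≤ #{i ∈ range d | κ i = r} := by
  classical
  have hfin := topComps_finite E κ r (Set.finite_Iio d)
  rw [Set.ncard_eq_toFinset_card _ hfin]
  have hcard : ∀ s ∈ hfin.toFinset, r + 1 ≤ #{i ∈ range d | i ∈ s} := by
    intro s hs
    obtain ⟨u, hud, hu, rfl, htop⟩ := hfin.mem_toFinset.1 hs
    obtain ⟨W, huW, hW⟩ := (hκ u hud r).1 hu.ge
    have hu' : u ∉ ({z ∈ W | E u z} : Finset ℕ) := fun h => hE.irrefl u (mem_filter.1 h).2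
    refine (Nat.succ_le_succ (hW u huW)).trans ?_
    rw [Nat.succ_eq_add_one, ← card_insert_of_notMem hu']
    refine card_le_card fun z hz => ?_
    rcases mem_insert.1 hz with rfl | hz
    · exact mem_filter.2 ⟨by simpa using hud, mem_levelComp_self z⟩
    · obtain ⟨hzW, huz⟩ := mem_filter.1 hz
      have hzd := hE.lt' huz
      refine mem_filter.2 ⟨by simpa using hzd, .single ⟨huz, hu, le_antisymm ?_ ?_⟩⟩
      · exact htop u (mem_levelComp_self u) z huz
      · exact (hκ z hzd r).2 ⟨W, hzW, hW⟩
  refine (card_nsmul_le_sum _ _ _ hcard).trans ?_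
  rw [← card_biUnion]
  · refine card_le_card fun i hi => ?_
    obtain ⟨s, hs, hi⟩ := mem_biUnion.1 hi
    obtain ⟨u, -, hu, rfl, -⟩ := hfin.mem_toFinset.1 hs
    obtain ⟨hid, hi⟩ := mem_filter.1 hi
    exact mem_filter.2 ⟨hid, levelComp_level hu hi⟩
  · intro s hs s' hs' hne
    obtain ⟨u, -, hu, rfl, -⟩ := hfin.mem_toFinset.1 hs
    obtain ⟨u', -, hu', rfl, -⟩ := hfin.mem_toFinset.1 hs'
    rw [Function.onFun, disjoint_left]
    intro i hi hi'
    exact hne ((levelComp_eq hE.symm (mem_filter.1 hi).2).symm.trans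
      (levelComp_eq hE.symm (mem_filter.1 hi').2))

/-- The adjacency of labels. -/
def labelAdj {N : ℕ} (G : SimpleGraph (Fin N)) (x y : ℕ) : Prop :=
  ∃ (hx : x < N) (hy : y < N), G.Adj ⟨x, hx⟩ ⟨y, hy⟩

section

variable {N : ℕ} (G : SimpleGraph (Fin N))

theorem isGraph_labelAdj : IsGraph N (labelAdj G) where
  symm := fun ⟨hx, hy, h⟩ => ⟨hy, hx, h.symm⟩
  irrefl := fun _ ⟨_, _, h⟩ => G.loopless.irrefl _ h
  lt := fun ⟨hx, _, _⟩ => hx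

variable {G} [DecidableRel (labelAdj G)] {f g : ℕ → ℕ}

/-- Sending each neighbour of `v` to its place in the list identifies the ego-network with the
labelled graph on which the program works. -/
theorem diversityVector_eq (hL : Lists N f g (labelAdj G)) (v : Fin N) {κ : ℕ → ℕ}
    (hκ : ∀ i < f (v + 1) - f v,
      HasCoreness (egoRel (f (v + 1) - f v) (fun i => g (f v + i)) (labelAdj G)) i (κ i)) (r : ℕ) :
    diversityVector G v r = (topComps (egoRel (f (v + 1) - f v) (fun i => g (f v + i)) (labelAdj G))
      κ r (Set.Iio (f (v + 1) - f v))).ncard := by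
  classical
  have hex : ∀ u : G.neighborSet v, ∃ i < f (v + 1) - f v, g (f v + i) = u := by
    rintro ⟨u, hu⟩
    obtain ⟨e, h1, h2, h3⟩ := (hL.mem v v.2 u).1 ⟨v.2, u.2, hu⟩
    exact ⟨e - f v, by omega, by rwa [Nat.add_sub_cancel' h1]⟩
  choose ψ hψd hψ using hex
  have hinj : Function.Injective ψ := by
    intro u u' h
    have := hψ u'
    rw [← h, hψ] at this
    exact Subtype.ext (Fin.ext this)
  have hrange : Set.range ψ = Set.Iio (f (v + 1) - f v) := by
    ext i
    constructor
    · rintro ⟨u, rfl⟩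
      exact hψd u
    · intro hi
      have hi : i < f (v + 1) - f v := hi
      obtain ⟨_, h1, h2⟩ := hL.rel v.2 (e := f v + i) (by omega) (by omega)
      refine ⟨⟨⟨_, h1⟩, h2⟩, ?_⟩
      have h3 := hψ ⟨⟨_, h1⟩, h2⟩
      have h4 := hψd ⟨⟨_, h1⟩, h2⟩
      have h5 := hL.inj v v.2 ⟨by omega, by omega⟩ ⟨by omega, by omega⟩ h3
      omega
  have hE : ∀ x y, egoRel (f (v + 1) - f v) (fun i => g (f v + i)) (labelAdj G) (ψ x) (ψ y) ↔
      (egoNetwork G v).Adj x y := by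
    intro x y
    simp only [egoRel, hψ, hψd, true_and, labelAdj, Fin.is_lt, Fin.eta, exists_true_left,
      SimpleGraph.comap_adj, Function.Embedding.subtype_apply]
  have hE' : ∀ x y, egoRel (f (v + 1) - f v) (fun i => g (f v + i)) (labelAdj G) (ψ x) y →
      y ∈ Set.range ψ := by
    intro x y h
    rw [hrange]
    exact h.2.1
  rw [← hrange, ncard_topComps_embedding hinj hE hE', diversityVector, ncard_isDiscriminativeCore]
  exact fun x => (hκ _ (hψd x)).of_embedding hinj hE hE'

/-- No coreness exceeds `tm`, so the sums up to the number of vertices may be cut at `tm`, and the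
computed index is the greatest element of the defining set. -/
theorem eq_score (hL : Lists N f g (labelAdj G)) (v : Fin N) {κ : ℕ → ℕ} {tm s : ℕ}
    (hκ : ∀ i < f (v + 1) - f v,
      HasCoreness (egoRel (f (v + 1) - f v) (fun i => g (f v + i)) (labelAdj G)) i (κ i))
    (hle : ∀ i < f (v + 1) - f v, κ i ≤ tm) (htm : tm ≤ f (v + 1) - f v)
    (hs : IsHIndex (fun r => (topComps (egoRel (f (v + 1) - f v) (fun i => g (f v + i))
      (labelAdj G)) κ r (Set.Iio (f (v + 1) - f v))).ncard) tm s) : s = score G v := by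
  have hN : tm ≤ N := by
    refine htm.trans ?_
    rw [← hL.degree (isGraph_labelAdj G).lt' v.2]
    exact (card_filter_le _ _).trans_eq (card_range N)
  simp only [← diversityVector_eq hL v hκ] at hs
  have h0 : ∀ r, tm < r → diversityVector G v r = 0 := by
    intro r hr
    rw [diversityVector_eq hL v hκ, topComps_eq_empty, Set.ncard_empty]
    intro x hx
    have := hle x hx
    omega
  have hsum : ∀ r, ∑ i ∈ Icc r (Fintype.card (Fin N)), diversityVector G v i =
      ∑ i ∈ Icc r tm, diversityVector G v i := by
    intro r
    rw [Fintype.card_fin]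
    refine (sum_subset (Icc_subset_Icc le_rfl hN) fun i hi hi' => h0 i ?_).symm
    simp only [mem_Icc] at hi hi'
    omega
  rw [score]
  simp only [hsum]
  refine (IsGreatest.csSup_eq ⟨?_, ?_⟩).symm
  · rcases hs.1 with rfl | h
    · exact Nat.zero_le _
    · exact h
  · intro r (hr : r ≤ _)
    by_contra! hlt
    by_cases hrt : r ≤ tm
    · exact absurd hr (hs.2 r hlt hrt).not_ge
    · rw [Icc_eq_empty (by omega), sum_empty] at hr
      omega

/-- Adjoin `v` to a `c`-core of its ego-network. Every old vertex gains the neighbour `v`, and `v`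
is adjacent to all of them, of which there are at least `c + 1`. -/
theorem HasCoreness.of_ego {R : ℕ → ℕ → Prop} [DecidableRel R] {a : ℕ → ℕ} {d v i p q c : ℕ}
    (hR : IsGraph N R) (ha : Set.InjOn a (Set.Iio d)) (hv : ∀ j < d, R v (a j)) (hi : i < d)
    (hc : HasCoreness (egoRel d a R) i c) (hp : HasCoreness R (a i) p) (hq : HasCoreness R v q) :
    c + 1 ≤ p ∧ c + 1 ≤ q := by
  obtain ⟨W, hiW, hW⟩ := (hc c).1 le_rfl
  set W' := {j ∈ W | j < d} with hW'
  have hsub : ∀ j, {z ∈ W | egoRel d a R j z} ⊆ W' := fun j z hz => by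
    obtain ⟨hz, h⟩ := mem_filter.1 hz
    exact mem_filter.2 ⟨hz, h.2.1⟩
  have hinj : Set.InjOn a W' := ha.mono fun z hz => (mem_filter.1 hz).2
  have hcore : IsCoreSet R (c + 1) (insert v (W'.image a)) := by
    intro w hw
    rcases mem_insert.1 hw with rfl | hw
    · have h1 : #(insert i {z ∈ W | egoRel d a R i z}) ≤ #W' :=
        card_le_card (insert_subset (mem_filter.2 ⟨hiW, hi⟩) (hsub i))
      rw [card_insert_of_notMem fun h => hR.irrefl _ (mem_filter.1 h).2.2.2] at h1
      refine (Nat.succ_le_succ (hW i hiW)).trans (h1.trans ?_)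
      rw [← card_image_of_injOn hinj]
      refine card_le_card fun z hz => mem_filter.2 ⟨mem_insert_of_mem hz, ?_⟩
      obtain ⟨j, hj, rfl⟩ := mem_image.1 hz
      exact hv j (mem_filter.1 hj).2
    · obtain ⟨j, hj, rfl⟩ := mem_image.1 hw
      obtain ⟨hjW, hjd⟩ := mem_filter.1 hj
      refine (Nat.succ_le_succ (hW j hjW)).trans ?_
      have hv' : v ∉ ({z ∈ W | egoRel d a R j z} : Finset ℕ).image a := by
        intro h
        obtain ⟨z, hz, rfl⟩ := mem_image.1 h
        exact hR.irrefl _ (hv z (mem_filter.1 hz).2.2.1)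
      rw [← card_image_of_injOn (hinj.mono (hsub j)), Nat.succ_eq_add_one,
        ← card_insert_of_notMem hv']
      refine card_le_card fun z hz => mem_filter.2 ?_
      rcases mem_insert.1 hz with rfl | hz
      · exact ⟨mem_insert_self .., hR.symm (hv j hjd)⟩
      · obtain ⟨l, hl, rfl⟩ := mem_image.1 hz
        exact ⟨mem_insert_of_mem (mem_image_of_mem a (hsub j hl)), (mem_filter.1 hl).2.2.2⟩
  exact ⟨(hp _).2 ⟨_, mem_insert_of_mem (mem_image_of_mem a (mem_filter.2 ⟨hiW, hi⟩)), hcore⟩,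
    (hq _).2 ⟨_, mem_insert_self .., hcore⟩⟩

/-- A score `s` provides at least `s` cores of coreness at least `s`, each with at least `s + 1`
private vertices of its own coreness. By `HasCoreness.of_ego` all these neighbours, and `v` itself,
have coreness at least `s + 1` in the whole graph. -/
theorem score_mul_le (hL : Lists N f g (labelAdj G)) {φ : ℕ → ℕ}
    (hφ : ∀ x < N, HasCoreness (labelAdj G) x (φ x)) (v : Fin N) :
    score G v * (score G v + 1) ≤
      #{e ∈ Ico (f v) (f (v + 1)) | score G v ≤ min (φ (g e) - 1) (φ v)} := by
  classical
  set d := f (v + 1) - f v with hd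
  set a : ℕ → ℕ := fun i => g (f v + i) with ha
  have hego := (isGraph_labelAdj G).egoRel (d := d) (a := a)
  have hex : ∀ i, ∃ c, HasCoreness (egoRel d a (labelAdj G)) i c := fun i =>
    exists_hasCoreness (range d) fun y hy => by simpa using hego.lt' hy
  choose κ hκ using hex
  have hsc : score G v ∈ {r | r ≤ ∑ i ∈ Icc r (Fintype.card (Fin N)), diversityVector G v i} := by
    refine Nat.sSup_mem ⟨0, Nat.zero_le _⟩
      ⟨∑ i ∈ Icc 0 (Fintype.card (Fin N)), diversityVector G v i, fun r (hr : r ≤ _) => ?_⟩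
    exact hr.trans (sum_le_sum_of_subset (Icc_subset_Icc (Nat.zero_le r) le_rfl))
  rw [Set.mem_ofPred_eq] at hsc
  generalize score G v = s at *
  calc s * (s + 1) ≤ (∑ i ∈ Icc s (Fintype.card (Fin N)), diversityVector G v i) * (s + 1) :=
        Nat.mul_le_mul_right _ hsc
    _ = ∑ i ∈ Icc s (Fintype.card (Fin N)), diversityVector G v i * (s + 1) := sum_mul ..
    _ ≤ ∑ r ∈ Icc s (Fintype.card (Fin N)), #{i ∈ range d | κ i = r} := by
        refine sum_le_sum fun r hr => ?_
        rw [diversityVector_eq hL v fun i _ => hκ i]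
        refine le_trans (Nat.mul_le_mul_left _ ?_) (ncard_topComps_mul_le hego fun i _ => hκ i)
        exact Nat.succ_le_succ (mem_Icc.1 hr).1
    _ = #{i ∈ range d | κ i ∈ Icc s (Fintype.card (Fin N))} :=
        sum_card_fiberwise_eq_card_filter ..
    _ ≤ _ := by
        refine card_le_card_of_injOn (fun i => f v + i) (fun i hi => ?_)
          fun _ _ _ _ h => Nat.add_left_cancel h
        obtain ⟨hid, hi⟩ := mem_filter.1 hi
        have hid : i < d := by simpa using hid
        have hrel : ∀ j < d, labelAdj G v (a j) := fun j hj =>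
          hL.rel v.2 (by omega) (by omega)
        have hsi : s ≤ κ i := (mem_Icc.1 hi).1
        have := HasCoreness.of_ego (isGraph_labelAdj G) (a := a) (d := d) (fun x hx y hy h => by
            have hx : x < d := hx
            have hy : y < d := hy
            have := hL.inj v v.2 (x₁ := f v + x) (x₂ := f v + y) ⟨by omega, by omega⟩
              ⟨by omega, by omega⟩ h
            omega) hrel hid (hκ i)
          (hφ _ ((isGraph_labelAdj G).lt' (hrel i hid))) (hφ v v.2)
        have h1 : κ i + 1 ≤ φ (g (f v + i)) := this.1
        simp only [mem_coe, mem_filter, mem_Ico]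
        omega

end

/-! ## Forest covers -/

section Forests

variable {V : Type*}

/-- The edges of `G` are covered by `a` forests. -/
def ForestCover (a : ℕ) (G : SimpleGraph V) : Prop :=
  ∃ F : Fin a → SimpleGraph V, (∀ i, (F i).IsAcyclic) ∧ G ≤ ⨆ i, F i

/-- Overlaps may be discarded, since a subgraph of a forest is a forest; edge-disjointness is thus
free. -/
theorem ForestCover.exists_decomposition {a : ℕ} {G : SimpleGraph V} (h : ForestCover a G) :
    ∃ F : Fin a → SimpleGraph V,
      (∀ i, (F i).IsAcyclic) ∧ Pairwise (fun i j => Disjoint (F i) (F j)) ∧ ⨆ i, F i = G := by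
  obtain ⟨F, hF, hG⟩ := h
  refine ⟨disjointed fun i => F i ⊓ G, fun i => (hF i).anti ?_, disjoint_disjointed _, ?_⟩
  · exact (disjointed_le _ i).trans inf_le_left
  · rw [iSup_disjointed, ← iSup_inf_eq, inf_eq_right.2 hG]

theorem arboricity_le {a : ℕ} {G : SimpleGraph V} (h : ForestCover a G) : arboricity G ≤ a :=
  Nat.sInf_le h.exists_decomposition

/-- Some cover is needed for the infimum to be attained; over the empty set it would be 0. -/
theorem ForestCover.arboricity {a : ℕ} {G : SimpleGraph V} (h : ForestCover a G) :
    ForestCover (arboricity G) G := by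
  obtain ⟨F, h1, -, h2⟩ := Nat.sInf_mem (⟨a, h.exists_decomposition⟩ :
    {a | ∃ F : Fin a → SimpleGraph V, (∀ i, (F i).IsAcyclic) ∧
      Pairwise (fun i j => Disjoint (F i) (F j)) ∧ ⨆ i, F i = G}.Nonempty)
  exact ⟨F, h1, h2.ge⟩

theorem ForestCover.mono {a : ℕ} {G H : SimpleGraph V} (h : ForestCover a H) (hGH : G ≤ H) :
    ForestCover a G := by
  obtain ⟨F, h1, h2⟩ := h
  exact ⟨F, h1, hGH.trans h2⟩

theorem ForestCover.bot (a : ℕ) : ForestCover a (⊥ : SimpleGraph V) :=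
  ⟨fun _ => ⊥, fun _ => SimpleGraph.isAcyclic_bot, bot_le⟩

theorem ForestCover.sup {a : ℕ} {G T : SimpleGraph V} (h : ForestCover a G) (hT : T.IsAcyclic) :
    ForestCover (a + 1) (G ⊔ T) := by
  obtain ⟨F, h1, h2⟩ := h
  refine ⟨Fin.cons T F, Fin.cases hT h1, sup_le (h2.trans (iSup_le fun i => ?_)) ?_⟩
  · exact le_iSup_of_le i.succ (by simp)
  · exact le_iSup_of_le 0 (by simp)

/-- A set closed under adjacency that contains one end and not the other separates the ends, so the
new edge closes no cycle. -/
theorem sup_edge_isAcyclic {F : SimpleGraph V} (hF : F.IsAcyclic) {C : Set V}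
    (hC : ∀ x y, F.Adj x y → x ∈ C → y ∈ C) {p q : V} (hp : p ∈ C) (hq : q ∉ C) :
    (F ⊔ SimpleGraph.edge p q).IsAcyclic := by
  refine hF.sup_edge_of_not_reachable fun h => hq ?_
  rw [SimpleGraph.reachable_iff_reflTransGen] at h
  induction h with
  | refl => exact hp
  | tail _ h ih => exact hC _ _ h (by_contra fun h => by simp_all)

/-- The star with the centre `x` and the leaves `N`. -/
def star (x : V) (N : Finset V) : SimpleGraph V :=
  SimpleGraph.fromRel fun p q => p = x ∧ q ∈ N

theorem star_adj {x p q : V} {N : Finset V} :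
    (star x N).Adj p q ↔ p ≠ q ∧ ((p = x ∧ q ∈ N) ∨ (q = x ∧ p ∈ N)) := Iff.rfl

theorem sup_star_isAcyclic [DecidableEq V] {F : SimpleGraph V} (hF : F.IsAcyclic) {x : V}
    {N : Finset V} (hx : x ∉ N) (hN : ∀ w ∈ N, ∀ y, ¬ F.Adj w y) : (F ⊔ star x N).IsAcyclic := by
  induction N using Finset.induction_on with
  | empty =>
    convert! hF
    refine sup_eq_left.2 fun p q h => ?_
    simp [star_adj] at h
  | insert w N hw ih =>
    rw [mem_insert, not_or] at hx
    have h := sup_edge_isAcyclic (C := {w}) (p := w) (q := x)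
      (ih hx.2 fun y hy => hN y (mem_insert_of_mem hy)) ?_ rfl (by simpa using hx.1)
    · refine h.anti fun p q hpq => ?_
      rcases hpq with hpq | hpq
      · exact .inl (.inl hpq)
      · rw [star_adj] at hpq
        simp only [mem_insert, SimpleGraph.sup_adj, star_adj, SimpleGraph.edge_adj] at hpq ⊢
        tauto
    · rintro y z (hyz | hyz) rfl
      · exact absurd hyz (hN y (mem_insert_self ..) z)
      · rw [star_adj] at hyz
        rcases hyz.2 with ⟨rfl, -⟩ | ⟨-, h⟩
        · exact absurd rfl hx.1
        · exact absurd h hw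

/-- At most `a` new edges meet the so far isolated vertex `x`; each goes to a forest of its own, in
which `x` becomes a leaf. -/
theorem ForestCover.sup_star [DecidableEq V] {a : ℕ} {H : SimpleGraph V} (h : ForestCover a H)
    {x : V} {N : Finset V} (hx : ∀ y, ¬ H.Adj x y) (hN : #N ≤ a) :
    ForestCover a (H ⊔ star x N) := by
  classical
  obtain ⟨F, hF, hH⟩ := h
  obtain ⟨e⟩ : Nonempty (N ↪ Fin a) := by
    rw [Function.Embedding.nonempty_iff_card_le]
    simpa using hN
  -- Forests that receive no edge get the default end `x`, for which the added edge is empty.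
  have hex : ∀ i, ∃ w, ∀ y : N, e y = i → (y : V) = w := by
    intro i
    by_cases h : ∃ y, e y = i
    · obtain ⟨y, rfl⟩ := h
      exact ⟨y, fun z hz => by rw [e.injective hz]⟩
    · exact ⟨x, fun y hy => absurd ⟨y, hy⟩ h⟩
  choose t ht using hex
  refine ⟨fun i => F i ⊓ H ⊔ SimpleGraph.edge x (t i), fun i => ?_, sup_le ?_ ?_⟩
  · have hi : (F i ⊓ H).IsAcyclic := (hF i).anti inf_le_left
    by_cases htx : t i = x
    · simpa [htx] using hi
    · refine sup_edge_isAcyclic (C := {x}) hi ?_ rfl htx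
      rintro y z hyz rfl
      exact absurd hyz.2 (hx z)
  · calc H ≤ (⨆ i, F i) ⊓ H := le_inf hH le_rfl
      _ = ⨆ i, F i ⊓ H := iSup_inf_eq ..
      _ ≤ _ := iSup_mono fun i => le_sup_left
  · intro p q hpq
    rw [star_adj] at hpq
    rw [SimpleGraph.iSup_adj]
    rcases hpq with ⟨hne, ⟨rfl, hq⟩ | ⟨rfl, hp⟩⟩
    · refine ⟨e ⟨q, hq⟩, .inr ?_⟩
      rw [SimpleGraph.edge_adj, ← ht _ ⟨q, hq⟩ rfl]
      simpa using hne
    · refine ⟨e ⟨p, hp⟩, .inr ?_⟩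
      rw [SimpleGraph.edge_adj, ← ht _ ⟨p, hp⟩ rfl]
      simpa using hne

/-- The edges of `G` that join vertices of `U`. -/
def within (G : SimpleGraph V) (U : Finset V) : SimpleGraph V where
  Adj x y := G.Adj x y ∧ x ∈ U ∧ y ∈ U
  symm := ⟨fun _ _ h => ⟨h.1.symm, h.2.2, h.2.1⟩⟩
  loopless := ⟨fun _ h => G.loopless.irrefl _ h.1⟩

/-- Vertices with at most `a` neighbours are peeled off and later reinserted by
`ForestCover.sup_star`, until the remaining set is an `(a + 1)`-core. -/
theorem forestCover_within [DecidableEq V] {G : SimpleGraph V} [DecidableRel G.Adj] {a : ℕ}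
    (h : ∀ W, IsCoreSet G.Adj (a + 1) W → ForestCover a (within G W)) (U : Finset V) :
    ForestCover a (within G U) := by
  induction U using Finset.strongInduction with
  | H U ih =>
    by_cases hU : IsCoreSet G.Adj (a + 1) U
    · exact h U hU
    · simp only [IsCoreSet, not_forall, not_le] at hU
      obtain ⟨v, hv, hlt⟩ := hU
      refine ((ih (U.erase v) (erase_ssubset hv)).sup_star (x := v) (N := {z ∈ U | G.Adj v z})
        (fun y hy => notMem_erase v U hy.2.1) (by omega)).mono ?_
      intro p q ⟨hpq, hp, hq⟩
      rw [SimpleGraph.sup_adj, star_adj, mem_filter, mem_filter]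
      rcases eq_or_ne p v with rfl | hpv
      · exact .inr ⟨hpq.ne, .inl ⟨rfl, hq, hpq⟩⟩
      · rcases eq_or_ne q v with rfl | hqv
        · exact .inr ⟨hpq.ne, .inr ⟨rfl, hp, hpq.symm⟩⟩
        · exact .inl ⟨hpq, mem_erase.2 ⟨hpv, hp⟩, mem_erase.2 ⟨hqv, hq⟩⟩

theorem forestCover_of_coreSets [Fintype V] [DecidableEq V] {G : SimpleGraph V}
    [DecidableRel G.Adj] {a : ℕ}
    (h : ∀ W, IsCoreSet G.Adj (a + 1) W → ForestCover a (within G W)) : ForestCover a G :=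
  (forestCover_within h univ).mono fun _ _ h => ⟨h, mem_univ _, mem_univ _⟩

theorem forestCover_maxDegree [Fintype V] [DecidableEq V] (G : SimpleGraph V)
    [DecidableRel G.Adj] : ForestCover G.maxDegree G := by
  refine forestCover_of_coreSets fun W hW => (ForestCover.bot _).mono fun p q hpq => ?_
  have h1 := hW p hpq.2.1
  have h2 : #{z ∈ W | G.Adj p z} ≤ G.degree p :=
    card_le_card fun z hz => by simpa using (mem_filter.1 hz).2
  have h3 := G.degree_le_maxDegree p
  omega

/-- Two vertices `u`, `v` are removed and the rest is halved. The old forests take the edges from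
`u` to one half and from `v` to the other; the new forest is a double star with the edge `uv` and
the remaining edges. -/
theorem forestCover_complete [DecidableEq V] (a : ℕ) (S : Finset V) (hS : #S ≤ 2 * a) :
    ForestCover a (within ⊤ S) := by
  induction a generalizing S with
  | zero =>
    refine (ForestCover.bot _).mono fun p q hpq => ?_
    have := card_pos.2 ⟨p, hpq.2.1⟩
    omega
  | succ a ih =>
    by_cases h1 : #S ≤ 1
    · refine (ForestCover.bot _).mono fun p q hpq => ?_
      exact absurd (card_le_one.1 h1 p hpq.2.1 q hpq.2.2) hpq.1
    obtain ⟨u, hu, v, hv, huv⟩ := one_lt_card.1 (not_le.1 h1)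
    set R := (S.erase u).erase v with hR
    have hRc : #R + 2 = #S := by
      rw [hR, card_erase_of_mem (mem_erase.2 ⟨huv.symm, hv⟩), card_erase_of_mem hu]
      omega
    obtain ⟨Y, hYR, hY⟩ := exists_subset_card_eq (s := R) (n := #R / 2) (by omega)
    have hZ : #(R \ Y) = #R - #R / 2 := by rw [card_sdiff_of_subset hYR, hY]
    have huR : u ∉ R := by simp [hR]
    have hvR : v ∉ R := by simp [hR]
    have hYu : u ∉ Y := fun h => huR (hYR h)
    have hYv : v ∉ Y := fun h => hvR (hYR h)
    have hT : (star u (insert v (R \ Y)) ⊔ star v Y).IsAcyclic := by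
      refine sup_star_isAcyclic ?_ hYv ?_
      · have := sup_star_isAcyclic (F := ⊥) SimpleGraph.isAcyclic_bot (x := u)
          (N := insert v (R \ Y)) (by simp [huv, huR]) (by simp)
        rwa [bot_sup_eq] at this
      · intro y hy z hyz
        rw [star_adj] at hyz
        rcases hyz.2 with ⟨rfl, -⟩ | ⟨-, h⟩
        · exact hYu hy
        · rcases mem_insert.1 h with rfl | h
          · exact hYv hy
          · exact (mem_sdiff.1 h).2 hy
    refine ((((ih R (by omega)).sup_star (x := u) (N := Y) (fun y hy => huR hy.2.1)
      (by omega)).sup_star (x := v) (N := R \ Y) ?_ (by omega)).sup hT).mono ?_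
    · rintro y (hy | hy)
      · exact hvR hy.2.1
      · rw [star_adj] at hy
        rcases hy.2 with ⟨h, -⟩ | ⟨-, h⟩
        · exact huv h.symm
        · exact hYv h
    · intro p q ⟨hpq, hp, hq⟩
      have hpq : p ≠ q := hpq
      have key : ∀ w ∈ S, w = u ∨ w = v ∨ w ∈ R := fun w hw => by
        simp only [hR, mem_erase]
        tauto
      have hmem : ∀ w ∈ R, w ∈ Y ∨ w ∈ R \ Y := fun w hw => by
        rw [mem_sdiff]
        tauto
      simp only [SimpleGraph.sup_adj, star_adj, mem_insert]
      rcases key p hp with h | h | hp' <;> rcases key q hq with h' | h' | hq'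
      · exact absurd (h.trans h'.symm) hpq
      · exact .inr (.inl ⟨hpq, .inl ⟨h, .inl h'⟩⟩)
      · rcases hmem q hq' with h' | h'
        · exact .inl (.inl (.inr ⟨hpq, .inl ⟨h, h'⟩⟩))
        · exact .inr (.inl ⟨hpq, .inl ⟨h, .inr h'⟩⟩)
      · exact .inr (.inl ⟨hpq, .inr ⟨h', .inl h⟩⟩)
      · exact absurd (h.trans h'.symm) hpq
      · rcases hmem q hq' with h' | h'
        · exact .inr (.inr ⟨hpq, .inl ⟨h, h'⟩⟩)
        · exact .inl (.inr ⟨hpq, .inl ⟨h, h'⟩⟩)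
      · rcases hmem p hp' with h | h
        · exact .inl (.inl (.inr ⟨hpq, .inr ⟨h', h⟩⟩))
        · exact .inr (.inl ⟨hpq, .inr ⟨h', .inr h⟩⟩)
      · rcases hmem p hp' with h | h
        · exact .inr (.inr ⟨hpq, .inr ⟨h', h⟩⟩)
        · exact .inl (.inr ⟨hpq, .inr ⟨h', h⟩⟩)
      · exact .inl (.inl (.inl ⟨hpq, hp', hq'⟩))

end Forests

/-! ## The arboricity of graphs with few edges -/

section FewEdges

variable {V : Type*}

theorem sum_card_filter_adj_le [Fintype V] (G : SimpleGraph V) [DecidableRel G.Adj]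
    (W : Finset V) :
    ∑ v ∈ W, #{z ∈ W | G.Adj v z} ≤ ∑ v ∈ W, G.degree v :=
  sum_le_sum fun v _ => card_le_card fun z hz => by simpa using (mem_filter.1 hz).2

theorem sum_degree_le [Fintype V] (G : SimpleGraph V) [DecidableRel G.Adj]
    (W : Finset V) : ∑ v ∈ W, G.degree v ≤ 2 * #G.edgeFinset := by
  rw [← G.sum_degrees_eq_twice_card_edges]
  exact sum_le_sum_of_subset (subset_univ W)

variable [DecidableEq V]

/-- A graph on `2 a + 1` vertices is covered by `a` forests if it has a vertex of degree `a + 1` and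
two further vertices that are not adjacent. -/
theorem forestCover_odd {G : SimpleGraph V} [DecidableRel G.Adj] {a : ℕ} {W : Finset V} {x u v : V}
    (hW : #W = 2 * a + 3) (hx : x ∈ W) (hu : u ∈ W) (hv : v ∈ W) (hxu : x ≠ u) (hxv : x ≠ v)
    (huv : u ≠ v) (hdx : #{z ∈ W | G.Adj x z} = a + 2) (hG : ¬ G.Adj u v) :
    ForestCover (a + 1) (within G W) := by
  set R := ((W.erase x).erase u).erase v with hR
  have hRc : #R = 2 * a := by
    rw [hR, card_erase_of_mem, card_erase_of_mem, card_erase_of_mem hx]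
    · omega
    · exact mem_erase.2 ⟨hxu.symm, hu⟩
    · exact mem_erase.2 ⟨huv.symm, mem_erase.2 ⟨hxv.symm, hv⟩⟩
  -- The old `a` forests cover the complete graph on `R`, the edges from `u` to `Y`, from `v` to
  -- `Z`, and all but two of the edges at `x`. The new forest consists of the stars from `u` to `Z`
  -- and from `v` to `Y`, and the two edges `xp`, `xq`.
  obtain ⟨Y, hYR, hY⟩ := exists_subset_card_eq (s := R) (n := a) (by omega)
  obtain ⟨Z, hZR, hZ, hYZ, hmem⟩ : ∃ Z ⊆ R, #Z = a ∧ (∀ w ∈ Z, w ∉ Y) ∧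
      ∀ w ∈ R, w ∈ Y ∨ w ∈ Z := by
    refine ⟨R \ Y, sdiff_subset, ?_, fun w hw => (mem_sdiff.1 hw).2, fun w hw => ?_⟩
    · rw [card_sdiff_of_subset hYR]
      omega
    · rw [mem_sdiff]
      tauto
  have hxR : x ∉ R := by simp [hR]
  have huR : u ∉ R := by simp [hR]
  have hvR : v ∉ R := by simp [hR]
  have hkey : ∀ w ∈ W, w = x ∨ w = u ∨ w = v ∨ w ∈ R := fun w hw => by
    simp only [hR, mem_erase]
    tauto
  clear_value R
  set N : Finset V := {z ∈ W | G.Adj x z} with hN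
  have hNx : x ∉ N := fun h => G.loopless.irrefl _ (mem_filter.1 h).2
  -- Since `x` has `a + 2` neighbours and each star has `a + 1` vertices, there is a neighbour
  -- outside either star. Choosing `p` in the star at `u` and `q` outside it keeps the new forest
  -- free of cycles.
  obtain ⟨p, hpN, hp⟩ : ∃ p ∈ N, p ∉ insert v Y := by
    refine exists_mem_notMem_of_card_lt_card ?_
    have := card_insert_le v Y
    omega
  obtain ⟨q, hqN, hq⟩ : ∃ q ∈ N, q ∉ insert u Z := by
    refine exists_mem_notMem_of_card_lt_card ?_
    have := card_insert_le u Z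
    omega
  have hpx : p ≠ x := fun h => hNx (h ▸ hpN)
  have hqx : q ≠ x := fun h => hNx (h ▸ hqN)
  rw [mem_insert, not_or] at hp hq
  have hp' : p = u ∨ p ∈ Z := by
    rcases hkey p (mem_filter.1 hpN).1 with h | h | h | h
    · exact absurd h hpx
    · exact .inl h
    · exact absurd h hp.1
    · exact (hmem p h).elim (fun h => absurd h hp.2) .inr
  have hpq : p ≠ q := by
    rintro rfl
    exact hp'.elim hq.1 hq.2
  have hT : (star u Z ⊔ star v Y ⊔ SimpleGraph.edge x p ⊔ SimpleGraph.edge x q).IsAcyclic := by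
    have h1 : (star u Z).IsAcyclic := by
      have := sup_star_isAcyclic (F := ⊥) SimpleGraph.isAcyclic_bot (x := u) (N := Z)
        (fun h => huR (hZR h)) (by simp)
      rwa [bot_sup_eq] at this
    have h2 : (star u Z ⊔ star v Y).IsAcyclic := by
      refine sup_star_isAcyclic h1 (fun h => hvR (hYR h)) fun y hy z hyz => ?_
      rw [star_adj] at hyz
      rcases hyz.2 with ⟨rfl, -⟩ | ⟨-, h⟩
      · exact huR (hYR hy)
      · exact hYZ y h hy
    have hcl : ∀ y z, (star u Z ⊔ star v Y).Adj y z → y ≠ x ∧ z ≠ x ∧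
        (y = u ∨ y ∈ Z → z = u ∨ z ∈ Z) := by
      rintro y z (⟨-, ⟨rfl, h⟩ | ⟨rfl, h⟩⟩ | ⟨-, ⟨rfl, h⟩ | ⟨rfl, h⟩⟩)
      · exact ⟨hxu.symm, fun h' => hxR (h' ▸ hZR h), fun _ => .inr h⟩
      · exact ⟨fun h' => hxR (h' ▸ hZR h), hxu.symm, fun _ => .inl rfl⟩
      · refine ⟨hxv.symm, fun h' => hxR (h' ▸ hYR h), fun h' => ?_⟩
        rcases h' with h' | h'
        · exact absurd h'.symm huv
        · exact absurd (hZR h') hvR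
      · refine ⟨fun h' => hxR (h' ▸ hYR h), hxv.symm, fun h' => ?_⟩
        rcases h' with rfl | h'
        · exact absurd (hYR h) huR
        · exact absurd h (hYZ y h')
    have h3 : (star u Z ⊔ star v Y ⊔ SimpleGraph.edge x p).IsAcyclic := by
      refine sup_edge_isAcyclic (C := {x}) h2 (fun y z hyz hy => ?_) rfl hpx
      exact absurd hy (hcl y z hyz).1
    refine sup_edge_isAcyclic (C := {y | y = x ∨ y = u ∨ y ∈ Z}) h3 ?_ (.inl rfl) ?_
    · rintro y z (hyz | hyz) hy
      · obtain ⟨h1, h2, h3⟩ := hcl y z hyz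
        exact .inr (h3 (hy.resolve_left h1))
      · rw [SimpleGraph.edge_adj] at hyz
        rcases hyz.1 with ⟨rfl, rfl⟩ | ⟨rfl, rfl⟩
        · exact .inr hp'
        · exact .inl rfl
    · rintro (h | h | h)
      · exact hqx h
      · exact hq.1 h
      · exact hq.2 h
  have hN' : #((N.erase p).erase q) ≤ a := by
    rw [card_erase_of_mem (mem_erase.2 ⟨hpq.symm, hqN⟩), card_erase_of_mem hpN]
    omega
  refine (((((forestCover_complete a R (by omega)).sup_star (x := u) (N := Y)
    (fun y hy => huR hy.2.1) (by omega)).sup_star (x := v) (N := Z) ?_ (by omega)).sup_star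
    (x := x) (N := (N.erase p).erase q) ?_ hN').sup hT).mono ?_
  · rintro y (hy | ⟨-, ⟨h, -⟩ | ⟨-, h⟩⟩)
    · exact hvR hy.2.1
    · exact huv h.symm
    · exact hvR (hYR h)
  · rintro y ((hy | ⟨-, ⟨h, -⟩ | ⟨-, h⟩⟩) | ⟨-, ⟨h, -⟩ | ⟨-, h⟩⟩)
    · exact hxR hy.2.1
    · exact hxu h
    · exact hxR (hYR h)
    · exact hxv h
    · exact hxR (hZR h)
  · set T := within ⊤ R ⊔ star u Y ⊔ star v Z ⊔ star x ((N.erase p).erase q) ⊔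
      (star u Z ⊔ star v Y ⊔ SimpleGraph.edge x p ⊔ SimpleGraph.edge x q) with hTdef
    have hTR : ∀ y ∈ R, ∀ z ∈ R, y ≠ z → T.Adj y z := fun y hy z hz hne =>
      .inl (.inl (.inl (.inl ⟨hne, hy, hz⟩)))
    have hTu : ∀ z ∈ R, T.Adj u z := fun z hz => by
      have hne : u ≠ z := fun h => huR (h ▸ hz)
      rcases hmem z hz with h | h
      · exact .inl (.inl (.inl (.inr ⟨hne, .inl ⟨rfl, h⟩⟩)))
      · exact .inr (.inl (.inl (.inl ⟨hne, .inl ⟨rfl, h⟩⟩)))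
    have hTv : ∀ z ∈ R, T.Adj v z := fun z hz => by
      have hne : v ≠ z := fun h => hvR (h ▸ hz)
      rcases hmem z hz with h | h
      · exact .inr (.inl (.inl (.inr ⟨hne, .inl ⟨rfl, h⟩⟩)))
      · exact .inl (.inl (.inr ⟨hne, .inl ⟨rfl, h⟩⟩))
    have hTx : ∀ z ∈ W, G.Adj x z → T.Adj x z := fun z hz hxz => by
      rcases eq_or_ne z p with rfl | hzp
      · exact .inr (.inl (.inr ((SimpleGraph.edge_adj ..).2 ⟨.inl ⟨rfl, rfl⟩, hxz.ne⟩)))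
      rcases eq_or_ne z q with rfl | hzq
      · exact .inr (.inr ((SimpleGraph.edge_adj ..).2 ⟨.inl ⟨rfl, rfl⟩, hxz.ne⟩))
      exact .inl (.inr ⟨hxz.ne, .inl ⟨rfl, mem_erase.2 ⟨hzq, mem_erase.2 ⟨hzp,
        mem_filter.2 ⟨hz, hxz⟩⟩⟩⟩⟩)
    clear_value T
    rintro y z ⟨hyz, hy, hz⟩
    rcases hkey y hy with rfl | hy'
    · exact hTx z hz hyz
    rcases hkey z hz with rfl | hz'
    · exact (hTx y hy hyz.symm).symm
    rcases hy' with rfl | rfl | hy' <;> rcases hz' with rfl | rfl | hz'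
    · exact absurd rfl hyz.ne
    · exact absurd hyz hG
    · exact hTu z hz'
    · exact absurd hyz.symm hG
    · exact absurd rfl hyz.ne
    · exact hTv z hz'
    · exact (hTu y hy').symm
    · exact (hTv y hy').symm
    · exact hTR y hy' z hz' hyz.ne

variable [Fintype V] {G : SimpleGraph V} [DecidableRel G.Adj]

/-- The hypothesis says `m < (a + 1)²`. Counting degrees bounds an `(a + 1)`-core by `2 a + 1`
vertices, and at that size it has a vertex of degree exactly `a + 1` and two further nonadjacent
vertices. -/
theorem forestCover_of_card_le {a : ℕ} (ha : 2 ≤ a) (hm : #G.edgeFinset ≤ a * a + 2 * a) :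
    ForestCover a G := by
  refine forestCover_of_coreSets fun W hW => ?_
  by_cases hW1 : #W ≤ 2 * a
  · exact (forestCover_complete a W hW1).mono fun p q h => ⟨h.1.ne, h.2⟩
  have hsum := (sum_card_filter_adj_le G W).trans (sum_degree_le G W)
  have hW2 : #W * (a + 1) ≤ ∑ v ∈ W, #{z ∈ W | G.Adj v z} := by
    simpa using card_nsmul_le_sum W _ _ hW
  have hWc : #W = 2 * a + 1 := by
    by_contra hne
    have h : 2 * a + 2 ≤ #W := by omega
    have := Nat.mul_le_mul_right (a + 1) h
    nlinarith
  -- Degrees of at least `a + 2` throughout would add up to `(2 a + 1) (a + 2)`, more than `2 m`.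
  obtain ⟨x, hxW, hx⟩ : ∃ x ∈ W, #{z ∈ W | G.Adj x z} < a + 2 := by
    by_contra! h
    have := card_nsmul_le_sum W _ _ h
    rw [hWc, smul_eq_mul] at this
    nlinarith
  have hdx : #{z ∈ W | G.Adj x z} = a + 1 := by
    have := hW x hxW
    omega
  -- Otherwise the other `2 a` vertices form a clique and the degrees add up to at least `2 a (2 a -
  -- 1) + 2 (a + 1)`. This exceeds `2 a² + 4 a` by `2 (a - 1)²`, which is where `a ≥ 2` enters.
  obtain ⟨u, hu, v, hv, huv, hG⟩ : ∃ u ∈ W.erase x, ∃ v ∈ W.erase x, u ≠ v ∧ ¬ G.Adj u v := by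
    by_contra! h
    have h1 : ∀ v ∈ W.erase x, (2 * a - 1) + (if G.Adj x v then 1 else 0) ≤
        #{z ∈ W | G.Adj v z} := by
      intro v hv
      have h2 : #((W.erase x).erase v) = 2 * a - 1 := by
        rw [card_erase_of_mem hv, card_erase_of_mem hxW]
        omega
      have h3 : (W.erase x).erase v ⊆ {z ∈ W | G.Adj v z} := fun z hz => by
        obtain ⟨hz1, hz2⟩ := mem_erase.1 hz
        exact mem_filter.2 ⟨mem_of_mem_erase hz2, h v hv z hz2 hz1.symm⟩
      split_ifs with hxv
      · have h4 : x ∉ (W.erase x).erase v := by simp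
        rw [← h2, ← card_insert_of_notMem h4]
        exact card_le_card (insert_subset (mem_filter.2 ⟨hxW, hxv.symm⟩) h3)
      · rw [← h2]
        exact card_le_card h3
    have h2 := sum_le_sum h1
    rw [sum_add_distrib, sum_const, smul_eq_mul, ← card_filter, card_erase_of_mem hxW, hWc] at h2
    have h3 : #{z ∈ W.erase x | G.Adj x z} = a + 1 := by
      rw [← hdx, filter_erase, erase_eq_of_notMem]
      simp
    rw [h3] at h2
    have h4 := add_sum_erase W (fun v => #{z ∈ W | G.Adj v z}) hxW
    simp only [hdx] at h4
    obtain ⟨b, rfl⟩ : ∃ b, a = b + 2 := ⟨a - 2, by omega⟩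
    simp only [show 2 * (b + 2) - 1 = 2 * b + 3 by omega, Nat.add_sub_cancel] at h2
    nlinarith
  obtain ⟨hux, huW⟩ := mem_erase.1 hu
  obtain ⟨hvx, hvW⟩ := mem_erase.1 hv
  obtain ⟨b, rfl⟩ : ∃ b, a = b + 1 := ⟨a - 1, by omega⟩
  exact forestCover_odd (by omega) hxW huW hvW hux.symm hvx.symm huv hdx hG

/-- A nonempty `2`-core has at least three vertices and at least as many edges, so it uses up all
three edges. No edge leaves it, and connectedness makes it the whole graph. -/
theorem forestCover_one (hG : G.Connected) (hm : #G.edgeFinset ≤ 3)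
    (hne : ¬ (Fintype.card V = 3 ∧ G = ⊤)) : ForestCover 1 G := by
  refine forestCover_of_coreSets fun W hW => ?_
  rcases W.eq_empty_or_nonempty with rfl | ⟨w, hw⟩
  · exact (ForestCover.bot 1).mono fun p q h => absurd h.2.1 (notMem_empty p)
  refine absurd ?_ hne
  have hdeg : ∀ v, #{z ∈ W | G.Adj v z} ≤ G.degree v := fun v =>
    card_le_card fun z hz => by simpa using (mem_filter.1 hz).2
  have hlt : ∀ v, #{z ∈ W | G.Adj v z} ≤ #(W.erase v) := fun v =>
    card_le_card fun z hz => mem_erase.2 ⟨(mem_filter.1 hz).2.ne', (mem_filter.1 hz).1⟩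
  have hsum := sum_degree_le G W
  have h1 : ∀ v ∈ W, 2 ≤ G.degree v := fun v hv => (hW v hv).trans (hdeg v)
  have h2 := card_nsmul_le_sum W _ _ h1
  rw [smul_eq_mul] at h2
  have h3 : #W = 3 := by
    have h4 := (hW w hw).trans (hlt w)
    rw [card_erase_of_mem hw] at h4
    omega
  have hclosed : ∀ v ∈ W, ∀ z, G.Adj v z → z ∈ W := by
    intro v hv z hvz
    by_contra hz
    have h5 : 3 ≤ G.degree v := by
      have h6 : z ∉ ({z ∈ W | G.Adj v z} : Finset V) := fun h => hz (mem_filter.1 h).1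
      refine (Nat.succ_le_succ (hW v hv)).trans ?_
      rw [Nat.succ_eq_add_one, ← card_insert_of_notMem h6]
      refine card_le_card fun y hy => ?_
      rcases mem_insert.1 hy with rfl | hy
      · simpa using hvz
      · simpa using (mem_filter.1 hy).2
    have h6 := add_sum_erase W (fun v => G.degree v) hv
    have h7 := card_nsmul_le_sum (W.erase v) _ _ fun y hy => h1 y (mem_of_mem_erase hy)
    rw [card_erase_of_mem hv, smul_eq_mul] at h7
    omega
  have huniv : W = univ := by
    rw [eq_univ_iff_forall]
    intro z
    have h := hG.preconnected w z
    rw [SimpleGraph.reachable_iff_reflTransGen] at h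
    induction h with
    | refl => exact hw
    | tail _ h ih => exact hclosed _ ih _ h
  subst huniv
  refine ⟨h3, eq_top_iff.2 fun v z hvz => ?_⟩
  have h4 : ({z ∈ univ | G.Adj v z} : Finset V) = univ.erase v := by
    refine eq_of_subset_of_card_le (fun y hy => ?_) ?_
    · exact mem_erase.2 ⟨(mem_filter.1 hy).2.ne', mem_univ y⟩
    · rw [card_erase_of_mem (mem_univ v), h3]
      exact hW v (mem_univ v)
  have h5 : z ∈ ({z ∈ univ | G.Adj v z} : Finset V) := by
    rw [h4]
    exact mem_erase.2 ⟨Ne.symm hvz, mem_univ z⟩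
  exact (mem_filter.1 h5).2

/-- If `m < (a + 1)²`, then `a` forests suffice; the cases `a = 0`, `a = 1` and `a ≥ 2` have
separate reasons. -/
theorem sq_arboricity_le (hG : G.Connected) (hne : ¬ (Fintype.card V = 3 ∧ G = ⊤)) :
    arboricity G * arboricity G ≤ #G.edgeFinset := by
  by_contra! hlt
  have hle : ∀ {a}, ForestCover a G → arboricity G ≤ a := fun h => arboricity_le h
  generalize arboricity G = r at *
  obtain ⟨a, rfl⟩ : ∃ a, r = a + 1 := by
    refine ⟨r - 1, ?_⟩
    rcases r with _ | r
    · omega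
    · omega
  rcases a with _ | _ | a
  · have h0 : #G.edgeFinset = 0 := by omega
    have h1 : G = ⊥ := by simpa using h0
    subst h1
    have := hle (ForestCover.bot 0)
    omega
  · have := hle (forestCover_one hG (by omega) hne)
    omega
  · have := hle (forestCover_of_card_le (a := a + 2) (by omega) (by nlinarith))
    omega

end FewEdges

/-! ## Weighted sums over the edges of a forest -/

section Weights

variable {V : Type*}

/-- Root every component. Adjacent vertices have different distances from the root, and the nearer
neighbour is the penultimate vertex of the unique path, hence unique. -/
theorem exists_parent {F : SimpleGraph V} (hF : F.IsAcyclic) :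
    ∃ par : V → V, ∀ u v, F.Adj u v → u = par v ∨ v = par u := by
  have hex : ∀ v, ∃ p : F.Walk (F.connectedComponentMk v).out v,
      p.IsPath ∧ p.length = F.dist (F.connectedComponentMk v).out v := fun v =>
    SimpleGraph.Reachable.exists_path_of_dist
      (SimpleGraph.ConnectedComponent.exact (Quot.out_eq (F.connectedComponentMk v)))
  have hparent : ∀ v, ∃ w, ∀ u, F.Adj v u →
      F.dist (F.connectedComponentMk v).out u < F.dist (F.connectedComponentMk v).out v →
      u = w := by
    intro v
    obtain ⟨p, hp, hpl⟩ := hex v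
    refine ⟨p.penultimate, fun u huv hlt => ?_⟩
    refine hF.eq_penultimate_of_adj_end hp huv ?_
    by_contra hsupp
    have := hp.concat hsupp huv
    obtain ⟨q, hq, hql⟩ := (p.reachable.trans huv.reachable).exists_path_of_dist
    have heq : q = p.concat huv := congrArg Subtype.val
      ((hF.subsingleton_path _ _).elim ⟨q, hq⟩ ⟨_, this⟩)
    have hlen := congrArg SimpleGraph.Walk.length heq
    rw [SimpleGraph.Walk.length_concat] at hlen
    omega
  choose par hpar using hparent
  refine ⟨par, fun u v huv => ?_⟩
  have hc : F.connectedComponentMk u = F.connectedComponentMk v :=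
    SimpleGraph.ConnectedComponent.sound huv.reachable
  obtain ⟨p, -⟩ := hex u
  rcases lt_or_gt_of_ne (hF.dist_ne_of_adj huv p.reachable) with h | h
  · left
    refine hpar v u huv.symm ?_
    rwa [← hc]
  · right
    exact hpar u v huv h

/-- Each edge is charged to its child. The tail has the smaller weight of the two ends, so the
charge covers it whichever end the child is. -/
theorem sum_forest_le [Fintype V] {F : SimpleGraph V} (hF : F.IsAcyclic) {O : V → V → Prop}
    {wt : V → ℕ} (hO : ∀ {u w}, O u w → ¬ O w u) (hwt : ∀ {u w}, O u w → wt u ≤ wt w)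
    (s : Finset (V × V)) (hs : ∀ x ∈ s, F.Adj x.1 x.2 ∧ O x.1 x.2) :
    ∑ x ∈ s, wt x.1 ≤ ∑ v, wt v := by
  classical
  obtain ⟨par, hpar⟩ := exists_parent hF
  set child : V × V → V := fun x => if x.1 = par x.2 then x.2 else x.1 with hchild
  have hinj : Set.InjOn child s := by
    have key : ∀ x ∈ s, (x.1 = par x.2 ∧ child x = x.2) ∨ (x.2 = par x.1 ∧ child x = x.1) := by
      intro x hx
      by_cases h : x.1 = par x.2
      · exact .inl ⟨h, if_pos h⟩
      · exact .inr ⟨(hpar _ _ (hs x hx).1).resolve_left h, if_neg h⟩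
    -- Edges with the same child have the same parent as well; being reversals of each other is
    -- excluded by the asymmetry of `O`.
    rintro ⟨a, b⟩ hx ⟨a', b'⟩ hy hxy
    have h1 := (hs _ hx).2
    have h2 := (hs _ hy).2
    have k1 := key _ hx
    have k2 := key _ hy
    rw [← hxy] at k2
    generalize child (a, b) = c at k1 k2
    simp only at h1 h2 k1 k2
    rcases k1 with ⟨rfl, rfl⟩ | ⟨rfl, rfl⟩ <;> rcases k2 with ⟨rfl, rfl⟩ | ⟨rfl, rfl⟩
    · rfl
    · exact absurd h2 (hO h1)
    · exact absurd h2 (hO h1)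
    · rfl
  calc ∑ x ∈ s, wt x.1 ≤ ∑ x ∈ s, wt (child x) := by
        refine sum_le_sum fun x hx => ?_
        simp only [hchild]
        split_ifs
        · exact hwt (hs x hx).2
        · exact le_rfl
    _ = ∑ v ∈ s.image child, wt v := (sum_image hinj).symm
    _ ≤ ∑ v, wt v := sum_le_sum_of_subset (subset_univ _)

theorem sum_forestCover_le [Fintype V] {G : SimpleGraph V} {a : ℕ} (hG : ForestCover a G)
    {O : V → V → Prop} {wt : V → ℕ} (hO : ∀ {u w}, O u w → ¬ O w u)
    (hwt : ∀ {u w}, O u w → wt u ≤ wt w) (s : Finset (V × V))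
    (hs : ∀ x ∈ s, G.Adj x.1 x.2 ∧ O x.1 x.2) : ∑ x ∈ s, wt x.1 ≤ a * ∑ v, wt v := by
  classical
  obtain ⟨F, hF, hGF⟩ := hG
  calc ∑ x ∈ s, wt x.1 ≤ ∑ x ∈ s, ∑ i, if (F i).Adj x.1 x.2 then wt x.1 else 0 := by
        refine sum_le_sum fun x hx => ?_
        obtain ⟨i, hi⟩ := SimpleGraph.iSup_adj.1 (hGF (hs x hx).1)
        refine le_trans ?_ (single_le_sum (fun _ _ => Nat.zero_le _) (mem_univ i))
        rw [if_pos hi]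
    _ = ∑ i, ∑ x ∈ s with (F i).Adj x.1 x.2, wt x.1 := by
        rw [sum_comm]
        exact sum_congr rfl fun i _ => (sum_filter ..).symm
    _ ≤ ∑ _i : Fin a, ∑ v, wt v := sum_le_sum fun i _ =>
        sum_forest_le (O := O) (wt := wt) (hF i) hO hwt _ fun x hx =>
          ⟨(mem_filter.1 hx).2, (hs x (mem_filter.1 hx).1).2⟩
    _ = a * ∑ v, wt v := by simp

end Weights

/-! ## The input -/

theorem getD_flatten {α : Type*} (l : List (List α)) (d : α) {x i : ℕ} (hx : x < l.length)
    (hi : i < l[x].length) :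
    l.flatten.getD (((l.take x).map List.length).sum + i) d = l[x][i] := by
  have h : l.flatten = (l.take x).flatten ++ (l[x] ++ (l.drop (x + 1)).flatten) := by
    conv_lhs => rw [← List.take_append_drop x l, List.flatten_append,
      List.drop_eq_getElem_cons hx, List.flatten_cons]
  rw [h, ← List.length_flatten, List.getD_append_right _ _ _ _ (by omega), Nat.add_sub_cancel_left,
    List.getD_append _ _ _ _ hi, List.getD_eq_getElem _ _ hi]

section Input

variable {n : ℕ} {G : SimpleGraph (Fin n)} {L : Fin n → List (Fin n)}

theorem initialState_off {k a : ℕ} (ha : a ≤ n) : (initialState L k).arr .off a =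
    (((List.ofFn L).take a).map List.length).sum := if_pos ha

theorem initialState_off_succ {k : ℕ} (x : Fin n) : (initialState L k).arr .off (x + 1) =
    (initialState L k).arr .off x + (L x).length := by
  rw [initialState_off x.2, initialState_off x.2.le, List.take_add_one, List.getElem?_ofFn]
  simp

theorem initialState_adj {k i : ℕ} (x : Fin n) (hi : i < (L x).length) :
    (initialState L k).arr .adj ((initialState L k).arr .off x + i) = ((L x)[i] : Fin n) := by
  rw [initialState_off x.2.le]
  show ((List.ofFn L).flatten.map Fin.val).getD _ 0 = _
  -- The default label has value 0, which matches the default of the array.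
  have h0 : 0 < n := x.pos
  have := getD_flatten (List.ofFn L) (⟨0, h0⟩ : Fin n) (x := x) (i := i) (by simp) (by simpa)
  simp only [List.getElem_ofFn] at this
  rw [← this]
  exact List.getD_map (f := Fin.val) (d := (⟨0, h0⟩ : Fin n)) ..

theorem lists_initialState (hL : IsAdjacencyList G L) (k : ℕ) :
    Lists n ((initialState L k).arr .off) ((initialState L k).arr .adj) (labelAdj G) where
  zero := by
    rw [initialState_off (Nat.zero_le n)]
    simp
  mono x hx := by
    have := initialState_off_succ (L := L) (k := k) ⟨x, hx⟩
    simp only at this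
    omega
  inj x hx := by
    have hs := initialState_off_succ (L := L) (k := k) ⟨x, hx⟩
    intro e he e' he' h
    simp only [Set.mem_Ico] at he he' hs
    obtain ⟨i, rfl⟩ := Nat.exists_eq_add_of_le he.1
    obtain ⟨i', rfl⟩ := Nat.exists_eq_add_of_le he'.1
    have h1 := initialState_adj (L := L) (k := k) (i := i) ⟨x, hx⟩ (by omega)
    have h2 := initialState_adj (L := L) (k := k) (i := i') ⟨x, hx⟩ (by omega)
    simp only at h1 h2
    rw [h1, h2] at h
    rw [((hL ⟨x, hx⟩).1.getElem_inj_iff).1 (Fin.ext h)]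
  mem x hx y := by
    have hs := initialState_off_succ (L := L) (k := k) ⟨x, hx⟩
    simp only at hs
    constructor
    · rintro ⟨_, hy, h⟩
      obtain ⟨i, hi, hiy⟩ := List.getElem_of_mem (((hL ⟨x, hx⟩).2 ⟨y, hy⟩).2 h)
      refine ⟨(initialState L k).arr .off x + i, by omega, by omega, ?_⟩
      have := initialState_adj (L := L) (k := k) (i := i) ⟨x, hx⟩ hi
      simp only at this
      rw [this, hiy]
    · rintro ⟨e, h1, h2, rfl⟩
      obtain ⟨i, rfl⟩ := Nat.exists_eq_add_of_le h1
      have hi : i < (L ⟨x, hx⟩).length := by omega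
      have := initialState_adj (L := L) (k := k) ⟨x, hx⟩ hi
      simp only at this
      rw [this]
      exact ⟨hx, Fin.is_lt _, ((hL ⟨x, hx⟩).2 _).1 (List.getElem_mem hi)⟩

theorem initialState_off_self [DecidableRel G.Adj] (hL : IsAdjacencyList G L) (k : ℕ) :
    (initialState L k).arr .off n = 2 * #G.edgeFinset := by
  rw [initialState_off le_rfl, List.take_of_length_le (by simp), List.map_ofFn, List.sum_ofFn,
    ← G.sum_degrees_eq_twice_card_edges]
  refine sum_congr rfl fun v _ => ?_
  have h : (L v).toFinset = G.neighborFinset v := by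
    ext u
    simp [(hL v).2]
  rw [← G.card_neighborFinset_eq_degree, ← h, List.toFinset_card_of_nodup (hL v).1]
  rfl

end Input

/-! ## The bounds on time and space -/

theorem Lists.sum_adj {N : ℕ} {f g : ℕ → ℕ} {R : ℕ → ℕ → Prop} [DecidableRel R]
    (hL : Lists N f g R) (hR : IsGraph N R) {v : ℕ} (hv : v < N) (h : ℕ → ℕ) :
    ∑ e ∈ Ico (f v) (f (v + 1)), h (g e) = ∑ u ∈ range N, if R v u then h u else 0 := by
  rw [← sum_filter, ← sum_image (f := h) (by simpa using hL.inj v hv)]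
  refine sum_congr ?_ fun _ _ => rfl
  ext u
  simp only [mem_image, mem_Ico, mem_filter, mem_range, hL.mem v hv]
  constructor
  · rintro ⟨e, ⟨h1, h2⟩, rfl⟩
    exact ⟨hR.lt' (hL.rel hv h1 h2), e, h1, h2, rfl⟩
  · rintro ⟨-, e, h1, h2, h3⟩
    exact ⟨e, ⟨h1, h2⟩, h3⟩

/-- The out-degree of `u` is counted once for each neighbour of `u`, so each oriented edge is
counted as often as the degree of its tail. -/
theorem sum_outdegree_eq {N : ℕ} {f g : ℕ → ℕ} {R : ℕ → ℕ → Prop} [DecidableRel R]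
    (hL : Lists N f g R) (hR : IsGraph N R) :
    ∑ v ∈ range N, ∑ e ∈ Ico (f v) (f (v + 1)), #{w ∈ range N | Oriented R f (g e) w} =
      ∑ x : Fin N × Fin N with Oriented R f x.1 x.2, (f (x.1 + 1) - f x.1) := by
  have h1 : ∀ v ∈ range N, ∑ e ∈ Ico (f v) (f (v + 1)), #{w ∈ range N | Oriented R f (g e) w} =
      ∑ u ∈ range N, if R v u then #{w ∈ range N | Oriented R f u w} else 0 := fun v hv =>
    hL.sum_adj hR (by simpa using hv) fun u => #{w ∈ range N | Oriented R f u w}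
  rw [sum_congr rfl h1, sum_comm, sum_filter, ← univ_product_univ, sum_product, sum_range]
  refine sum_congr rfl fun u _ => ?_
  have h2 : ∀ v, R v u ↔ R u v := fun v => ⟨hR.symm, hR.symm⟩
  rw [← sum_filter, sum_const, smul_eq_mul]
  simp only [h2]
  rw [hL.degree hR.lt' u.2, card_filter, mul_sum, sum_range]
  refine sum_congr rfl fun w _ => ?_
  split_ifs <;> simp

/-- The tail of an oriented edge has the smaller degree, so degrees are admissible weights for
`sum_forestCover_le`; their sum is `f n`. -/
theorem sum_outdegree_le {n a : ℕ} {G : SimpleGraph (Fin n)} [DecidableRel (labelAdj G)]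
    {f g : ℕ → ℕ} (hL : Lists n f g (labelAdj G)) (hG : ForestCover a G) :
    ∑ v ∈ range n, ∑ e ∈ Ico (f v) (f (v + 1)), #{w ∈ range n | Oriented (labelAdj G) f (g e) w} ≤
      a * f n := by
  rw [sum_outdegree_eq hL (isGraph_labelAdj G)]
  have h := sum_forestCover_le hG (O := fun u w => DegLT f u w)
    (wt := fun u => f (u + 1) - f u) (fun {u w} h1 h2 => by unfold DegLT at h1 h2; omega)
    (fun {u w} h => by unfold DegLT at h; omega)
    {x : Fin n × Fin n | Oriented (labelAdj G) f x.1 x.2} fun x hx => by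
      obtain ⟨⟨_, _, h1⟩, h2⟩ := (mem_filter.1 hx).2
      exact ⟨h1, h2⟩
  refine h.trans_eq ?_
  rw [← hL.sum_degree (isGraph_labelAdj G).lt', sum_range]
  congr 1
  exact sum_congr rfl fun v _ => (hL.degree (isGraph_labelAdj G).lt' v.2).symm

instance : Fintype Arr where
  elems := {.off, .adj, .deg, .vert, .pos, .cnt, .bin, .cur, .core, .hhat, .ord, .ooff, .oadj,
    .loc, .edeg, .ecur, .eoff, .eadj, .ecore, .eord, .visited, .queue, .c, .first, .next, .mem}
  complete A := by cases A <;> decide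

theorem space_le {M : Set (Arr × ℕ)} {K : ℕ} (hM : ∀ z ∈ M, z.2 < K) :
    space M ≤ ((26 * K + 23 : ℕ) : ℕ∞) := by
  have hsub : M ⊆ ((univ ×ˢ range K : Finset (Arr × ℕ)) : Set (Arr × ℕ)) := fun z hz => by
    simpa using hM z hz
  have h1 := Set.encard_le_encard hsub
  rw [Set.encard_coe_eq_coe_finsetCard, card_product, card_range] at h1
  have h2 : #(univ : Finset Arr) = 26 := rfl
  have h3 : Fintype.card Var = 23 := rfl
  rw [h2] at h1
  rw [space, h3]
  push_cast at h1 ⊢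
  gcongr

/-- The scores of the labels. -/
noncomputable def labelScore {n : ℕ} (G : SimpleGraph (Fin n)) (v : ℕ) : ℕ :=
  if h : v < n then score G ⟨v, h⟩ else 0

theorem labelScore_coe {n : ℕ} (G : SimpleGraph (Fin n)) (v : Fin n) :
    labelScore G v = score G v := dif_pos v.2

theorem isTopK_answer {n k : ℕ} {G : SimpleGraph (Fin n)} {σ : State} {S : Finset ℕ}
    (hS : S ⊆ range n) (hk : #S = k) (hmem : ∀ v < n, σ.arr .mem v = 1 ↔ v ∈ S)
    (htop : ∀ u ∈ S, ∀ w < n, w ∉ S → labelScore G w ≤ labelScore G u) :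
    IsTopK G k (answer n σ) := by
  have hans : ∀ v, v ∈ answer n σ ↔ (v : ℕ) ∈ S := fun v => by
    rw [answer, mem_filter, ← hmem v v.2]
    simp
  have hcard : #(answer n σ) = k := by
    rw [← hk, ← card_map Fin.valEmbedding]
    congr 1
    ext v
    simp only [mem_map, hans, Fin.valEmbedding_apply]
    constructor
    · rintro ⟨v, hv, rfl⟩
      exact hv
    · intro hv
      exact ⟨⟨v, by simpa using hS hv⟩, hv, rfl⟩
  have hhigh : ∀ u ∈ answer n σ, ∀ w, w ∉ answer n σ → score G w ≤ score G u := by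
    intro u hu w hw
    rw [hans] at hu hw
    simpa only [labelScore_coe] using htop u hu w w.2 hw
  refine ⟨hcard, hhigh, fun T hT => ?_⟩
  -- A different set of the same size contains a vertex outside the answer, whose score is at most
  -- every score in the answer.
  by_cases hTS : T ⊆ answer n σ
  · rw [eq_of_subset_of_card_le hTS (by omega)]
  · obtain ⟨w, hwT, hwS⟩ := not_subset.1 hTS
    refine Finset.le_inf fun u hu => (Finset.inf_le hwT).trans ?_
    exact_mod_cast hhigh u hu w hwS

end StructDiv

theorem mainTheorem1 :
    ∃ C : ℕ, ∀ (n : ℕ) (G : SimpleGraph (Fin n)) [DecidableRel G.Adj], G.Connected →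
      -- correctness, running time and space on every input
      (∀ L : Fin n → List (Fin n), StructDiv.IsAdjacencyList G L → ∀ k : ℕ, k ≤ n →
        ∃ (T : ℕ) (M : Set (StructDiv.Arr × ℕ)) (σ : StructDiv.State),
          StructDiv.Exec StructDiv.topKSearch (StructDiv.initialState L k) T M σ ∧
          StructDiv.IsTopK G k (StructDiv.answer n σ) ∧
          (1 ≤ G.edgeFinset.card →
            T ≤ C * (StructDiv.arboricity G * G.edgeFinset.card) ∧
            StructDiv.space M ≤ ((C * G.edgeFinset.card : ℕ) : ℕ∞))) ∧
      -- the bounds on the arboricity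
      StructDiv.arboricity G ≤ G.maxDegree ∧
      (¬ (n = 3 ∧ G = ⊤) → (StructDiv.arboricity G : ℝ) ≤ √(G.edgeFinset.card : ℝ)) := by
  classical
  -- Using `n ≤ m + 1`, `1 ≤ m` and `1 ≤ ρ`, the time is at most `2000 ρ m` and the space at most
  -- `205 m`; any constant from 2000 on would do.
  refine ⟨2200, fun n G _ hG => ⟨fun L hL k hk => ?_,
    StructDiv.arboricity_le (StructDiv.forestCover_maxDegree G), fun hne => ?_⟩⟩
  · have hlists := StructDiv.lists_initialState hL k
    have hoff := StructDiv.initialState_off_self hL k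
    have hcover := (StructDiv.forestCover_maxDegree G).arboricity
    obtain ⟨T, M, σ, hE, hM, hT, S, hS, hSk, hmem, htop⟩ := StructDiv.wp_topKSearch
      -- The indices must stay above `n` and up to twice the length `2 m` of the input lists, the
      -- reserve for the lists of an ego-network.
      (K := n + 4 * G.edgeFinset.card + 1) (N := n) (σ := StructDiv.initialState L k)
      (sc := StructDiv.labelScore G) rfl rfl rfl rfl hlists (StructDiv.isGraph_labelAdj G) hk
      (by omega) (by omega)
      (fun v hv κ tm s h1 h2 h3 h4 => by
        rw [StructDiv.eq_score hlists ⟨v, hv⟩ h1 h2 h3 h4]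
        exact (StructDiv.labelScore_coe G ⟨v, hv⟩).symm)
      (fun φ hφ v hv => by
        rw [show StructDiv.labelScore G v = StructDiv.score G ⟨v, hv⟩ from
          StructDiv.labelScore_coe G ⟨v, hv⟩]
        exact StructDiv.score_mul_le hlists hφ ⟨v, hv⟩)
    refine ⟨T, M, σ, hE, StructDiv.isTopK_answer hS hSk hmem htop, fun hm => ?_⟩
    have hn : n ≤ G.edgeFinset.card + 1 := by
      have := hG.card_vert_le_card_edgeSet_add_one
      rwa [Nat.card_fin, Nat.card_eq_fintype_card, ← SimpleGraph.edgeFinset_card] at this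
    -- With an edge present, zero forests cannot cover the graph; this lets the linear terms be
    -- absorbed into `ρ m`.
    have hpos : 1 ≤ StructDiv.arboricity G := by
      by_contra! h
      obtain ⟨F, -, hF⟩ := hcover
      rw [Nat.lt_one_iff] at h
      have : IsEmpty (Fin (StructDiv.arboricity G)) := by
        rw [h]
        infer_instance
      rw [iSup_of_empty, le_bot_iff] at hF
      subst hF
      simp at hm
    have hsum := StructDiv.sum_outdegree_le hlists hcover
    rw [hoff] at hsum hT
    refine ⟨?_, (StructDiv.space_le hM).trans ?_⟩
    · generalize StructDiv.arboricity G = ρ at *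
      have h1 : G.edgeFinset.card ≤ ρ * G.edgeFinset.card := Nat.le_mul_of_pos_left _ hpos
      rw [show ρ * (2 * G.edgeFinset.card) = 2 * (ρ * G.edgeFinset.card) by ring] at hsum
      omega
    · exact_mod_cast (by omega : 26 * (n + 4 * G.edgeFinset.card + 1) + 23 ≤
        2200 * G.edgeFinset.card)
  · have h := StructDiv.sq_arboricity_le hG (by rwa [Fintype.card_fin])
    refine Real.le_sqrt_of_sq_le ?_
    rw [sq]
    exact_mod_cast h
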